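/- Signatures are many-sorted and small; structures are set-based, with possibly empty carriers. $L_\infty(\Sigma)$ is the infinitary first-order language over $\Sigma$ whose formulae have finitely many free variables (declared in a sorted context) and may use conjunctions and disjunctions over arbitrary small sets. A cartesian theory $T$ is a set of sequents $\varphi\vdash_{\vec x}\psi$ admitting a well-founded partial order such that both sides of each axiom are built from atomic formulae by finite conjunctions and existential quantifiers that are provably unique over the preceding axioms; formulae built in this way over $T$ itself are called cartesian over $T$. $\mathrm{Mod}(T)$ is the category of models of $T$ and all homomorphisms. Let $T,T'$ be cartesian theories in signatures $\Sigma,\Sigma'$ and let $F:\mathrm{Mod}(T')\to\mathrm{Mod}(T)$ be a functor that preserves small filtered colimits. Let $\mathcal U$ be the syntactic category of $T'$: its objects are the formulae-in-context $\{\vec x\mid\varphi\}$ cartesian over $T'$, and its morphisms are the $T'$-provable functional relations up to provable equivalence. For an object $\{\vec x\mid\varphi\}$ let $\langle\vec x\mid\varphi\rangle\in\mathrm{Mod}(T')$ be the model whose elements of sort $\sigma$ are the morphisms $\{\vec x\mid\varphi\}\to\{y:\sigma\mid\top\}$ of $\mathcal U$; it represents $M\mapsto[\![\varphi]\!]_M=\{\vec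 a\mid M\models\varphi(\vec a)\}$. For $\vec a\in[\![\varphi]\!]_M$ let $h_{\vec a}:\langle\vec x\mid\varphi\rangle\to M$ be the homomorphism taking $\vec x$ to $\vec a$. The word-construction $W$ associated with $F$ is the following. The signature $\Sigma(W)$ has the sorts of $\Sigma$ and of $\Sigma'$ and extends $\Sigma$ by a function symbol $f^c_{\langle\vec x\mid\varphi\rangle}:\sigma'_1\cdots\sigma'_k\to\sigma$ for each object $\{\vec x:\vec\sigma'\mid\varphi\}$ of $\mathcal U$, each sort $\sigma$ of $\Sigma$ and each $c\in(F\langle\vec x\mid\varphi\rangle)(\sigma)$. For terms $t$ of $\Sigma(W)$ of a sort of $\Sigma$, in contexts with sorts from $\Sigma'$, put $\mathrm{Te}(f^c_{\langle\vec x\mid\varphi\rangle}(\vec x))=\varphi(\vec x)$ and $\mathrm{Te}(t)=\bot$ if $t$ is not of this form. For an atomic formula $\beta=\alpha(f^{c_1}_{\langle\vec x_1\mid\varphi_1\rangle}(\vec x_1),\dots,f^{c_n}_{\langle\vec x_n\mid\varphi_n\rangle}(\vec x_n))$ with $\alpha$ atomic in $\Sigma$, put $$\mathrm{At}(\beta)=\bigvee_{\{\vec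 x\mid\varphi\}}\ \bigvee_{\theta_1,\dots,\theta_n}(\exists\vec x)\Big(\varphi\wedge\bigwedge_{i}\theta_i(\vec x,\vec x_i)\Big),$$ where $\{\vec x\mid\varphi\}$ ranges over the objects of $\mathcal U$ and $(\theta_i:\{\vec x\mid\varphi\}\to\{\vec x_i\mid\varphi_i\})_i$ over the tuples of morphisms with $F\langle\vec x\mid\varphi\rangle\models\alpha((Fk_1)(c_1),\dots,(Fk_n)(c_n))$, for $k_i:\langle\vec x_i\mid\varphi_i\rangle\to\langle\vec x\mid\varphi\rangle$ the homomorphism corresponding to $\theta_i$ under the Yoneda embedding. For $M\in\mathrm{Mod}(T')$, the presentation $W(M)$ has as generators the expressions $t(\vec a)$ with $M\models\mathrm{Te}(t)(\vec a)$, and as relations the atomic formulae $\beta(\vec a)$ with $M\models\mathrm{At}(\beta)(\vec a)$. The translation $(-)^W$ from $L_\infty(\Sigma)$ to $L_\infty(\Sigma')$ is defined, for $\psi(y_1,\dots,y_n)$ and $\vec f=(f^{c_i}_{\langle\vec x_i\mid\varphi_i\rangle}(\vec x_i))_{i\le n}$ of matching sorts, by $\psi(\vec f)^W=\mathrm{At}(\psi(\vec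 f))$ for $\psi$ atomic, by commuting with negations and with small conjunctions and disjunctions, by $$\big((\exists y:\sigma)\psi'\big)(\vec f)^W=\bigvee_{\{\vec x\mid\varphi\}}\ \bigvee_{c\in(F\langle\vec x\mid\varphi\rangle)(\sigma)}(\exists\vec x)\big(\varphi\wedge\psi'(\vec f,f^c_{\langle\vec x\mid\varphi\rangle}(\vec x))^W\big),$$ and dually (with $\bigwedge$, $\forall\vec x$, $\varphi\to$) for $\forall$. Then: (1) For every $M\in\mathrm{Mod}(T')$, $W(M)$ presents in $\mathrm{Mod}(T)$ the structure $FM$ expanded by the valuation $C:f^c_{\langle\vec x\mid\varphi\rangle}(\vec a)\mapsto(Fh_{\vec a})(c)$ of the generators. That is, $FM$ is generated as a $\Sigma$-structure by the values of $C$, $(FM,C)$ satisfies all relations of $W(M)$, and for every $N\in\mathrm{Mod}(T)$ with a valuation $b$ of the generators satisfying these relations there is a unique homomorphism $FM\to N$ taking $C$ to $b$. (2) Let $\psi(y_1,\dots,y_n)\in L_\infty(\Sigma)$, let $\vec f=(f^{c_i}_{\langle\vec x_i\mid\varphi_i\rangle}(\vec x_i))_{i\le n}$ be new function symbols whose output sorts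 match the sorts of the $y_i$ (the tuples of variables $\vec x_i$ need not be disjoint), let $M\in\mathrm{Mod}(T')$, let $\vec a$ be a valuation in $M$ of the variables, and let $\vec a_i$ be the values of $\vec x_i$. If $M\models\mathrm{Te}(f^{c_i}_{\langle\vec x_i\mid\varphi_i\rangle}(\vec x_i))(\vec a_i)$, i.e. $M\models\varphi_i(\vec a_i)$, for each $i$, and $h_i=h_{\vec a_i}:\langle\vec x_i\mid\varphi_i\rangle\to M$, then $$FM\models\psi\big((Fh_1)(c_1),\dots,(Fh_n)(c_n)\big)\iff M\models\psi(\vec f)^W(\vec a).$$ -/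

import Mathlib

open CategoryTheory CategoryTheory.Limits

universe u

namespace CartLogic

/-! ### Signatures, contexts, terms -/

/-- A many-sorted signature: sorts, function symbols `f : dom f ⟶ cod f`, and relation symbols
`R ↣ ar R`. -/
structure Signature where
  Srt : Type u
  Fn : Type u
  dom : Fn → List Srt
  cod : Fn → Srt
  Rl : Type u
  ar : Rl → List Srt

/-- A context is a list of sorts; `Var Γ s` is the set of variables of sort `s` declared in `Γ`
(de Bruijn style, so that formulae-in-context are taken up to renaming of variables).
The most recently declared variable comes first. -/
inductive Var {I : Type u} : List I → I → Type u
  | zero {Γ : List I} {s : I} : Var (s :: Γ) s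
  | succ {Γ : List I} {s t : I} : Var Γ s → Var (t :: Γ) s

/-- Tuples of elements of the sorted family `X` that match the sorts of the context `Γ`; for the
carriers of a structure `M` and `Γ = σ₁ … σₙ` this is `M(σ₁) × ⋯ × M(σₙ)`. -/
abbrev Tuple {I : Type u} (X : I → Type u) (Γ : List I) : Type u := ∀ s, Var Γ s → X s

namespace Tuple
variable {I : Type u} {X Y : I → Type u}

def nil : Tuple X [] := fun _ v => nomatch v

def cons {Γ : List I} {t : I} (x : X t) (a : Tuple X Γ) : Tuple X (t :: Γ)
  | _, .zero => x
  | _, .succ v => a _ v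

def tail {Γ : List I} {t : I} (a : Tuple X (t :: Γ)) : Tuple X Γ := fun s v => a s v.succ

def append : ∀ {Γ Δ : List I}, Tuple X Γ → Tuple X Δ → Tuple X (Γ ++ Δ)
  | [], _, _, b => b
  | _ :: _, _, a, b => cons (a _ .zero) (append a.tail b)

def map (h : ∀ s, X s → Y s) {Γ : List I} (a : Tuple X Γ) : Tuple Y Γ := fun s v => h s (a s v)

end Tuple

namespace Var
variable {I : Type u}

/-- The inclusions of the variables of `Γ` and of `Δ` in those of `Γ ++ Δ`. -/
def left : ∀ {Γ Δ : List I}, Tuple (Var (Γ ++ Δ)) Γ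
  | _ :: _, _, _, .zero => .zero
  | _ :: _, _, _, .succ v => .succ (left _ v)

def right : ∀ {Γ Δ : List I}, Tuple (Var (Γ ++ Δ)) Δ
  | [], _, _, v => v
  | _ :: _, _, _, v => .succ (right _ v)

/-- Functions on the variables of the context `Γ.map f`. -/
def mapElim {J : Type u} {f : I → J} {P : J → Type u} :
    ∀ {Γ : List I}, (∀ i, Var Γ i → P (f i)) → ∀ j, Var (Γ.map f) j → P j
  | _ :: _, h, _, .zero => h _ .zero
  | _ :: _, h, _, .succ v => mapElim (fun i w => h i (.succ w)) _ v

def map {J : Type u} (f : I → J) : ∀ {Γ : List I} {i : I}, Var Γ i → Var (Γ.map f) (f i)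
  | _, _, .zero => .zero
  | _, _, .succ v => .succ (map f v)

theorem mapElim_map {J : Type u} {f : I → J} {P : J → Type u} {Γ : List I}
    (h : ∀ i, Var Γ i → P (f i)) {i : I} (v : Var Γ i) : mapElim h _ (v.map f) = h i v := by
  induction v with
  | zero => rfl
  | succ v ih => exact ih _

end Var

section TupleLemmas
variable {I : Type u} {X Y : I → Type u}

@[simp] theorem Tuple.cons_zero {Γ : List I} {t : I} (x : X t) (a : Tuple X Γ) :
    Tuple.cons x a t .zero = x := rfl

@[simp] theorem Tuple.cons_succ {Γ : List I} {t s : I} (x : X t) (a : Tuple X Γ) (v : Var Γ s) :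
    Tuple.cons x a s (.succ v) = a s v := rfl

theorem Tuple.cons_ext {Γ : List I} {t : I} {a b : Tuple X (t :: Γ)}
    (h0 : a t .zero = b t .zero) (hs : ∀ s (v : Var Γ s), a s v.succ = b s v.succ) : a = b := by
  funext s v
  cases v with
  | zero => exact h0
  | succ v => exact hs s v

@[simp] theorem Tuple.append_left : ∀ {Γ Δ : List I} (a : Tuple X Γ) (b : Tuple X Δ) (s : I)
    (v : Var Γ s), Tuple.append a b s (Var.left s v) = a s v
  | _ :: _, _, _, _, _, .zero => rfl
  | _ :: _, _, a, b, _, .succ v => Tuple.append_left a.tail b _ v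

@[simp] theorem Tuple.append_right : ∀ {Γ Δ : List I} (a : Tuple X Γ) (b : Tuple X Δ) (s : I)
    (v : Var Δ s), Tuple.append a b s (Var.right s v) = b s v
  | [], _, _, _, _, _ => rfl
  | _ :: _, _, a, b, _, v => Tuple.append_right a.tail b _ v

theorem Tuple.append_eta : ∀ {Γ Δ : List I} (a : Tuple X (Γ ++ Δ)),
    Tuple.append (fun s v => a s (Var.left s v)) (fun s v => a s (Var.right s v)) = a
  | [], _, _ => rfl
  | _ :: _, _, a => Tuple.cons_ext rfl (fun s v =>
      congrFun (congrFun (Tuple.append_eta a.tail) s) v)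

theorem Tuple.append_map (h : ∀ s, X s → Y s) : ∀ {Γ Δ : List I} (a : Tuple X Γ) (b : Tuple X Δ),
    (fun s v => h s (Tuple.append a b s v)) =
      Tuple.append (fun s v => h s (a s v)) (fun s v => h s (b s v))
  | [], _, _, _ => rfl
  | _ :: _, _, a, b => Tuple.cons_ext rfl (fun s v =>
      congrFun (congrFun (Tuple.append_map h a.tail b) s) v)

end TupleLemmas

/-- Terms of the signature `S` over the sorted family `X`. With `X = Var Γ` these are the
terms-in-context; with `X` a family of sets, the elements of `X` act as new constant symbols. -/
inductive Term (S : Signature.{u}) (X : S.Srt → Type u) : S.Srt → Type u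
  | var {s : S.Srt} (x : X s) : Term S X s
  | app (f : S.Fn) (ts : ∀ s, Var (S.dom f) s → Term S X s) : Term S X (S.cod f)

namespace Term
variable {S : Signature.{u}} {X Y Z : S.Srt → Type u}

/-- Simultaneous substitution. -/
def bind (σ : ∀ s, X s → Term S Y s) : ∀ {s : S.Srt}, Term S X s → Term S Y s
  | _, .var x => σ _ x
  | _, .app f ts => .app f (fun s v => bind σ (ts s v))

def map (r : ∀ s, X s → Y s) {s : S.Srt} (t : Term S X s) : Term S Y s :=
  t.bind (fun _ x => .var (r _ x))

/-- The elements of `X` that occur in a term. -/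
def occ : ∀ {s : S.Srt}, Term S X s → Set (Σ s, X s)
  | s, .var x => {⟨s, x⟩}
  | _, .app _ ts => {p | ∃ s v, p ∈ occ (ts s v)}

/-- A term all of whose variables are in `Q`, as a term over the family `Q`. -/
def restrict (Q : Set (Σ s, X s)) : ∀ {s : S.Srt} (t : Term S X s), t.occ ⊆ Q →
    Term S (fun s => {x : X s // (⟨s, x⟩ : Σ s, X s) ∈ Q}) s
  | _, .var x, h => .var ⟨x, h rfl⟩
  | _, .app f ts, h => .app f (fun s v => restrict Q (ts s v) (fun _ hp => h ⟨s, v, hp⟩))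

end Term

/-! ### Structures -/

/-- A structure for the signature `S`. -/
structure Str (S : Signature.{u}) where
  carrier : S.Srt → Type u
  fn : ∀ f : S.Fn, Tuple carrier (S.dom f) → carrier (S.cod f)
  rl : ∀ R : S.Rl, Tuple carrier (S.ar R) → Prop

namespace Str
variable {S : Signature.{u}}

/-- Homomorphisms of structures. -/
@[ext] structure Hom (M N : Str S) where
  toFun : ∀ s, M.carrier s → N.carrier s
  map_fn : ∀ f (a : Tuple M.carrier (S.dom f)), toFun _ (M.fn f a) = N.fn f (a.map toFun)
  map_rl : ∀ R (a : Tuple M.carrier (S.ar R)), M.rl R a → N.rl R (a.map toFun)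

instance : Category (Str S) where
  Hom := Hom
  id M := ⟨fun _ a => a, fun _ _ => rfl, fun _ _ h => h⟩
  comp g h := ⟨fun s a => h.toFun s (g.toFun s a),
    fun f a => by rw [g.map_fn, h.map_fn]; rfl,
    fun R a ha => h.map_rl R _ (g.map_rl R a ha)⟩

end Str

/-- The value of a term in a structure, under a valuation of its variables. -/
def Term.eval {S : Signature.{u}} (M : Str S) {X : S.Srt → Type u}
    (a : ∀ s, X s → M.carrier s) : ∀ {s : S.Srt}, Term S X s → M.carrier s
  | _, .var x => a _ x
  | _, .app f ts => M.fn f (fun s v => (ts s v).eval M a)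

/-! ### Formulae -/

/-- Atomic formulae built from equality and the relation symbols of `S`, with entries taken in the
sorted family `P` of expressions. -/
inductive AtomOver (S : Signature.{u}) (P : S.Srt → Type u) : Type u
  | eq {s : S.Srt} (t t' : P s) : AtomOver S P
  | rel (R : S.Rl) (ts : ∀ s, Var (S.ar R) s → P s) : AtomOver S P

/-- Atomic formulae of `S` over the sorted family `X` (of variables or of new constants). -/
abbrev Atom (S : Signature.{u}) (X : S.Srt → Type u) : Type u := AtomOver S (Term S X)

namespace AtomOver
variable {S : Signature.{u}} {P Q : S.Srt → Type u}

def map (h : ∀ s, P s → Q s) : AtomOver S P → AtomOver S Q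
  | .eq t t' => .eq (h _ t) (h _ t')
  | .rel R ts => .rel R (fun s v => h s (ts s v))

/-- Truth of an atomic formula in a structure, given the values of its entries. -/
def Holds (M : Str S) (val : ∀ s, P s → M.carrier s) : AtomOver S P → Prop
  | .eq t t' => val _ t = val _ t'
  | .rel R ts => M.rl R (fun s v => val s (ts s v))

end AtomOver

namespace Atom
variable {S : Signature.{u}} {X Y : S.Srt → Type u}

/-- `M ⊨ α` under a valuation of the variables of `α`. -/
def Realize (M : Str S) (a : ∀ s, X s → M.carrier s) (α : Atom S X) : Prop :=
  AtomOver.Holds M (fun _ t => t.eval M a) α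

/-- The elements of `X` that occur in an atomic formula. -/
def occ : Atom S X → Set (Σ s, X s)
  | .eq t t' => t.occ ∪ t'.occ
  | .rel _ ts => {p | ∃ s v, p ∈ (ts s v).occ}

/-- An atomic formula, as an atomic formula over the family of the elements that occur in it. -/
def ownVars : (α : Atom S X) →
    Atom S (fun s => {x : X s // (⟨s, x⟩ : Σ s, X s) ∈ occ α})
  | .eq t t' => .eq (t.restrict _ (fun _ h => Or.inl h)) (t'.restrict _ (fun _ h => Or.inr h))
  | .rel R ts => .rel R (fun s v => (ts s v).restrict _ (fun _ h => ⟨s, v, h⟩))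

end Atom

/-- Formulae-in-context of the infinitary language `L_∞(S)`: finitely many free variables,
conjunctions and disjunctions indexed by small sets. -/
inductive LInf (S : Signature.{u}) : List S.Srt → Type (u + 1)
  | atom {Γ : List S.Srt} (α : Atom S (Var Γ)) : LInf S Γ
  | neg {Γ : List S.Srt} (φ : LInf S Γ) : LInf S Γ
  | all {Γ : List S.Srt} (s : S.Srt) (φ : LInf S (s :: Γ)) : LInf S Γ
  | ex {Γ : List S.Srt} (s : S.Srt) (φ : LInf S (s :: Γ)) : LInf S Γ
  | conj {Γ : List S.Srt} {I : Type u} (φ : I → LInf S Γ) : LInf S Γ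
  | disj {Γ : List S.Srt} {I : Type u} (φ : I → LInf S Γ) : LInf S Γ

namespace LInf
variable {S : Signature.{u}}

/-- `M ⊨ φ(a)`. -/
def Realize (M : Str S) : ∀ {Γ : List S.Srt}, LInf S Γ → Tuple M.carrier Γ → Prop
  | _, .atom α, a => α.Realize M a
  | _, .neg φ, a => ¬ φ.Realize M a
  | _, .all _ φ, a => ∀ x, φ.Realize M (Tuple.cons x a)
  | _, .ex _ φ, a => ∃ x, φ.Realize M (Tuple.cons x a)
  | _, .conj φ, a => ∀ i, (φ i).Realize M a
  | _, .disj φ, a => ∃ i, (φ i).Realize M a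

/-- Renaming of free variables. -/
def rename : ∀ {Γ Δ : List S.Srt}, Tuple (Var Δ) Γ → LInf S Γ → LInf S Δ
  | _, _, r, .atom α => .atom (α.map (fun _ t => t.map r))
  | _, _, r, .neg φ => .neg (φ.rename r)
  | _, _, r, .all s φ => .all s (φ.rename (Tuple.cons .zero (fun _ v => .succ (r _ v))))
  | _, _, r, .ex s φ => .ex s (φ.rename (Tuple.cons .zero (fun _ v => .succ (r _ v))))
  | _, _, r, .conj φ => .conj (fun i => (φ i).rename r)
  | _, _, r, .disj φ => .disj (fun i => (φ i).rename r)

def top {Γ : List S.Srt} : LInf S Γ := .conj (I := PEmpty) (fun i => nomatch i)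

def bot {Γ : List S.Srt} : LInf S Γ := .disj (I := PEmpty) (fun i => nomatch i)

def and {Γ : List S.Srt} (φ ψ : LInf S Γ) : LInf S Γ :=
  .conj (I := ULift Bool) (fun i => bif i.down then φ else ψ)

def or {Γ : List S.Srt} (φ ψ : LInf S Γ) : LInf S Γ :=
  .disj (I := ULift Bool) (fun i => bif i.down then φ else ψ)

def imp {Γ : List S.Srt} (φ ψ : LInf S Γ) : LInf S Γ := or (.neg φ) ψ

/-- Quantification over a block of variables. -/
def exs : ∀ (Δ : List S.Srt) {Γ : List S.Srt}, LInf S (Δ ++ Γ) → LInf S Γ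
  | [], _, φ => φ
  | s :: Δ, _, φ => exs Δ (.ex s φ)

def alls : ∀ (Δ : List S.Srt) {Γ : List S.Srt}, LInf S (Δ ++ Γ) → LInf S Γ
  | [], _, φ => φ
  | s :: Δ, _, φ => alls Δ (.all s φ)

end LInf

/-- Regular formulae-in-context: the finitary formulae built from atomic formulae by `⊤`, `∧`
and `∃`. -/
inductive Reg (S : Signature.{u}) : List S.Srt → Type u
  | atom {Γ : List S.Srt} (α : Atom S (Var Γ)) : Reg S Γ
  | top {Γ : List S.Srt} : Reg S Γ
  | and {Γ : List S.Srt} (φ ψ : Reg S Γ) : Reg S Γ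
  | ex {Γ : List S.Srt} (s : S.Srt) (φ : Reg S (s :: Γ)) : Reg S Γ

/-- Substitutions: the variables of `Γ` are replaced by terms in the context `Δ`. -/
abbrev Sub (S : Signature.{u}) (Γ Δ : List S.Srt) : Type u := Tuple (Term S (Var Δ)) Γ

namespace Sub
variable {S : Signature.{u}}

/-- The substitution that replaces variables by variables. -/
def ofVar {Γ Δ : List S.Srt} (r : Tuple (Var Δ) Γ) : Sub S Γ Δ := fun _ v => .var (r _ v)

/-- Extension of a substitution under a binder. -/
def lift {Γ Δ : List S.Srt} (σ : Sub S Γ Δ) (s : S.Srt) : Sub S (s :: Γ) (s :: Δ) :=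
  Tuple.cons (.var .zero) (fun _ v => (σ _ v).map (fun _ => .succ))

def comp {Γ Δ Θ : List S.Srt} (σ : Sub S Γ Δ) (τ : Sub S Δ Θ) : Sub S Γ Θ :=
  fun _ v => (σ _ v).bind τ

end Sub

namespace Reg
variable {S : Signature.{u}}

/-- A regular formula as a formula of `L_∞`. -/
def toLInf : ∀ {Γ : List S.Srt}, Reg S Γ → LInf S Γ
  | _, .atom α => .atom α
  | _, .top => .top
  | _, .and φ ψ => .and φ.toLInf ψ.toLInf
  | _, .ex s φ => .ex s φ.toLInf

/-- `M ⊨ φ(a)`. -/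
def Realize (M : Str S) {Γ : List S.Srt} (φ : Reg S Γ) (a : Tuple M.carrier Γ) : Prop :=
  φ.toLInf.Realize M a

/-- Capture-avoiding substitution. -/
def subst : ∀ {Γ Δ : List S.Srt}, Reg S Γ → Sub S Γ Δ → Reg S Δ
  | _, _, .atom α, σ => .atom (α.map (fun _ t => t.bind σ))
  | _, _, .top, _ => .top
  | _, _, .and φ ψ, σ => .and (φ.subst σ) (ψ.subst σ)
  | _, _, .ex s φ, σ => .ex s (φ.subst (σ.lift s))

/-- Renaming of variables. -/
def rename {Γ Δ : List S.Srt} (r : Tuple (Var Δ) Γ) (φ : Reg S Γ) : Reg S Δ :=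
  φ.subst (Sub.ofVar r)

/-- Weakening by one fresh variable. -/
def wk {Γ : List S.Srt} (s : S.Srt) (φ : Reg S Γ) : Reg S (s :: Γ) :=
  φ.rename (fun _ => .succ)

def eq {Γ : List S.Srt} {s : S.Srt} (t t' : Term S (Var Γ) s) : Reg S Γ := .atom (.eq t t')

/-- The conjunction of the equations `σ v = τ v`, for the variables `v` of a context. -/
def eqs : ∀ {Γ Δ : List S.Srt}, Sub S Γ Δ → Sub S Γ Δ → Reg S Δ
  | [], _, _, _ => .top
  | _ :: _, _, σ, τ => .and (eq (σ _ .zero) (τ _ .zero)) (eqs σ.tail τ.tail)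

/-- Existential quantification over a block of variables. -/
def exs : ∀ (Δ : List S.Srt) {Γ : List S.Srt}, Reg S (Δ ++ Γ) → Reg S Γ
  | [], _, φ => φ
  | s :: Δ, _, φ => exs Δ (.ex s φ)

end Reg

/-! ### Cartesian theories -/

/-- A sequent `φ ⊢_Γ ψ` between regular formulae in the context `Γ`. -/
structure Sequent (S : Signature.{u}) where
  ctx : List S.Srt
  lhs : Reg S ctx
  rhs : Reg S ctx

/-- Provability of sequents of regular formulae from a set of axioms: the sequent calculus of
regular logic (structural rules, equality, finite conjunction, existential quantification and the
Frobenius axiom). -/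
inductive Prov {S : Signature.{u}} (T : Set (Sequent S)) :
    ∀ {Γ : List S.Srt}, Reg S Γ → Reg S Γ → Prop
  | ax {q : Sequent S} : q ∈ T → Prov T q.lhs q.rhs
  | refl {Γ : List S.Srt} (φ : Reg S Γ) : Prov T φ φ
  | cut {Γ : List S.Srt} {φ ψ χ : Reg S Γ} : Prov T φ ψ → Prov T ψ χ → Prov T φ χ
  | subst {Γ Δ : List S.Srt} (σ : Sub S Γ Δ) {φ ψ : Reg S Γ} :
      Prov T φ ψ → Prov T (φ.subst σ) (ψ.subst σ)
  | eq_refl {Γ : List S.Srt} {s : S.Srt} (t : Term S (Var Γ) s) : Prov T .top (.eq t t)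
  | eq_subst {Γ Δ : List S.Srt} (σ τ : Sub S Γ Δ) (φ : Reg S Γ) :
      Prov T (.and (.eqs σ τ) (φ.subst σ)) (φ.subst τ)
  | top_intro {Γ : List S.Srt} (φ : Reg S Γ) : Prov T φ .top
  | and_left {Γ : List S.Srt} (φ ψ : Reg S Γ) : Prov T (.and φ ψ) φ
  | and_right {Γ : List S.Srt} (φ ψ : Reg S Γ) : Prov T (.and φ ψ) ψ
  | and_intro {Γ : List S.Srt} {φ ψ χ : Reg S Γ} :
      Prov T φ ψ → Prov T φ χ → Prov T φ (.and ψ χ)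
  | ex_left {Γ : List S.Srt} {s : S.Srt} {φ : Reg S (s :: Γ)} {ψ : Reg S Γ} :
      Prov T φ (ψ.wk s) → Prov T (.ex s φ) ψ
  | ex_right {Γ : List S.Srt} {s : S.Srt} {φ : Reg S (s :: Γ)} {ψ : Reg S Γ} :
      Prov T (.ex s φ) ψ → Prov T φ (ψ.wk s)
  | frobenius {Γ : List S.Srt} {s : S.Srt} (φ : Reg S Γ) (ψ : Reg S (s :: Γ)) :
      Prov T (.and φ (.ex s ψ)) (.ex s (.and (φ.wk s) ψ))

/-- The sequent `φ(y) ∧ φ(z) ⊢ y = z` is provable, for a formula `φ` with a distinguished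
variable. -/
def ProvUnique {S : Signature.{u}} (T : Set (Sequent S)) {Γ : List S.Srt} {s : S.Srt}
    (φ : Reg S (s :: Γ)) : Prop :=
  Prov T (Γ := s :: s :: Γ)
    (.and (φ.rename (Tuple.cons (.succ .zero) (fun _ v => .succ (.succ v))))
      (φ.rename (Tuple.cons .zero (fun _ v => .succ (.succ v)))))
    (.eq (.var (.succ .zero)) (.var .zero))

/-- Formulae that are cartesian over `T`: built from atomic formulae by finite conjunctions and
`T`-provably unique existential quantification. -/
def IsCartesian {S : Signature.{u}} (T : Set (Sequent S)) :
    ∀ {Γ : List S.Srt}, Reg S Γ → Prop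
  | _, .atom _ => True
  | _, .top => True
  | _, .and φ ψ => IsCartesian T φ ∧ IsCartesian T ψ
  | _, .ex _ φ => IsCartesian T φ ∧ ProvUnique T φ

/-- A cartesian theory: a set of sequents with a well-founded (strict) partial order such that both
sides of every axiom are cartesian over the theory formed by the axioms that precede it. -/
structure CartTheory (S : Signature.{u}) where
  seqs : Set (Sequent S)
  cartesian : ∃ r : Sequent S → Sequent S → Prop, WellFounded r ∧
    (∀ p q q', r p q → r q q' → r p q') ∧
    ∀ q ∈ seqs, IsCartesian {p | p ∈ seqs ∧ r p q} q.lhs ∧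
      IsCartesian {p | p ∈ seqs ∧ r p q} q.rhs

/-- `M` is a model of `T`. -/
def CartTheory.IsModel {S : Signature.{u}} (T : CartTheory S) : ObjectProperty (Str S) :=
  fun M => ∀ q ∈ T.seqs, ∀ a : Tuple M.carrier q.ctx, q.lhs.Realize M a → q.rhs.Realize M a

/-- The category of models of `T` and all homomorphisms. -/
abbrev CartTheory.Mod {S : Signature.{u}} (T : CartTheory S) : Type (u + 1) :=
  T.IsModel.FullSubcategory

/-! ### The syntactic category -/

/-- Objects of the syntactic category: formulae-in-context that are cartesian over `T`. -/
structure Obj {S : Signature.{u}} (T : CartTheory S) where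
  ctx : List S.Srt
  fml : Reg S ctx
  cart : IsCartesian T.seqs fml

/-- The object `{y : s | ⊤}`. -/
def Obj.ofSort {S : Signature.{u}} (T : CartTheory S) (s : S.Srt) : Obj T := ⟨[s], .top, trivial⟩

/-- Provable functional relations `θ(x, y)` from `A = {x | φ}` to `B = {y | ψ}`; the variables of `B`
come first in the context of `θ`. -/
structure FunRel {S : Signature.{u}} {T : CartTheory S} (A B : Obj T) where
  fml : Reg S (B.ctx ++ A.ctx)
  cart : IsCartesian T.seqs fml
  le : Prov T.seqs fml
    (.and (A.fml.rename (fun _ v => Var.right _ v)) (B.fml.rename (fun _ v => Var.left _ v)))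
  uniq : Prov T.seqs (Γ := B.ctx ++ (B.ctx ++ A.ctx))
    (.and (fml.rename (Tuple.append (fun _ v => Var.left _ v)
        (fun _ v => Var.right _ (Var.right _ v))))
      (fml.rename (fun _ v => Var.right _ v)))
    (.eqs (.ofVar (fun _ v => Var.left _ v)) (.ofVar (fun _ v => Var.right _ (Var.left _ v))))
  total : Prov T.seqs A.fml (.exs B.ctx fml)

/-- `T`-provable equivalence of functional relations. -/
instance FunRel.setoid {S : Signature.{u}} {T : CartTheory S} (A B : Obj T) :
    Setoid (FunRel A B) where
  r θ η := Prov T.seqs θ.fml η.fml ∧ Prov T.seqs η.fml θ.fml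
  iseqv := ⟨fun _ => ⟨.refl _, .refl _⟩, fun h => ⟨h.2, h.1⟩,
    fun h h' => ⟨h.1.cut h'.1, h'.2.cut h.2⟩⟩

/-- Morphisms `A ⟶ B` of the syntactic category. -/
def SynHom {S : Signature.{u}} {T : CartTheory S} (A B : Obj T) : Type u :=
  Quotient (FunRel.setoid A B)

/-! ### Facts on substitution and on truth in structures -/

namespace Term
variable {S : Signature.{u}} {X Y Z : S.Srt → Type u}

theorem bind_bind (σ : ∀ s, X s → Term S Y s) (τ : ∀ s, Y s → Term S Z s) {s : S.Srt}
    (t : Term S X s) : (t.bind σ).bind τ = t.bind (fun s x => (σ s x).bind τ) := by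
  induction t with
  | var x => rfl
  | app f ts ih => simp only [bind]; congr 1; funext s v; exact ih s v

theorem bind_var {s : S.Srt} (t : Term S X s) : t.bind (fun _ x => .var x) = t := by
  induction t with
  | var x => rfl
  | app f ts ih => simp only [bind]; congr 1; funext s v; exact ih s v

theorem eval_bind (M : Str S) (σ : ∀ s, X s → Term S Y s) (a : ∀ s, Y s → M.carrier s) {s : S.Srt}
    (t : Term S X s) : (t.bind σ).eval M a = t.eval M (fun s x => (σ s x).eval M a) := by
  induction t with
  | var x => rfl
  | app f ts ih => simp only [bind, eval]; congr 1; funext s v; exact ih s v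

theorem eval_hom {M N : Str S} (h : M ⟶ N) (a : ∀ s, X s → M.carrier s) {s : S.Srt}
    (t : Term S X s) : h.toFun s (t.eval M a) = t.eval N (fun s x => h.toFun s (a s x)) := by
  induction t with
  | var x => rfl
  | app f ts ih =>
    simp only [eval]; rw [h.map_fn]; congr 1; funext s v; exact ih s v

end Term

namespace LInf
variable {S : Signature.{u}}

theorem realize_rename (M : Str S) {Γ : List S.Srt} (φ : LInf S Γ) :
    ∀ {Δ : List S.Srt} (r : Tuple (Var Δ) Γ) (a : Tuple M.carrier Δ),
      (φ.rename r).Realize M a ↔ φ.Realize M (fun _ v => a _ (r _ v)) := by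
  induction φ with
  | atom α =>
    intro Δ r a
    cases α with
    | eq t t' =>
      simp only [rename, Realize, Atom.Realize, AtomOver.map, AtomOver.Holds, Term.map,
        Term.eval_bind, Term.eval]
    | rel R ts =>
      simp only [rename, Realize, Atom.Realize, AtomOver.map, AtomOver.Holds, Term.map,
        Term.eval_bind, Term.eval]
  | neg φ ih => intro Δ r a; simp only [rename, Realize, ih]
  | all s φ ih =>
    intro Δ r a
    simp only [rename, Realize, ih]
    refine forall_congr' fun x => iff_of_eq (congrArg _ ?_)
    exact Tuple.cons_ext rfl (fun _ _ => rfl)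
  | ex s φ ih =>
    intro Δ r a
    simp only [rename, Realize, ih]
    refine exists_congr fun x => iff_of_eq (congrArg _ ?_)
    exact Tuple.cons_ext rfl (fun _ _ => rfl)
  | conj φ ih => intro Δ r a; simp only [rename, Realize, ih]
  | disj φ ih => intro Δ r a; simp only [rename, Realize, ih]

theorem realize_and (M : Str S) {Γ : List S.Srt} (φ ψ : LInf S Γ) (a : Tuple M.carrier Γ) :
    (φ.and ψ).Realize M a ↔ φ.Realize M a ∧ ψ.Realize M a := by
  constructor
  · intro h; exact ⟨h ⟨true⟩, h ⟨false⟩⟩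
  · rintro ⟨h, h'⟩ ⟨i⟩
    cases i
    · exact h'
    · exact h

end LInf

namespace Reg
variable {S : Signature.{u}}

@[simp] theorem realize_top (M : Str S) {Γ : List S.Srt} (a : Tuple M.carrier Γ) :
    (Reg.top : Reg S Γ).Realize M a := fun i => nomatch i

@[simp] theorem realize_and (M : Str S) {Γ : List S.Srt} (φ ψ : Reg S Γ) (a : Tuple M.carrier Γ) :
    (Reg.and φ ψ).Realize M a ↔ φ.Realize M a ∧ ψ.Realize M a := LInf.realize_and M _ _ a

@[simp] theorem realize_ex (M : Str S) {Γ : List S.Srt} {s : S.Srt} (φ : Reg S (s :: Γ))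
    (a : Tuple M.carrier Γ) : (Reg.ex s φ).Realize M a ↔ ∃ x, φ.Realize M (Tuple.cons x a) := Iff.rfl

@[simp] theorem realize_eq (M : Str S) {Γ : List S.Srt} {s : S.Srt} (t t' : Term S (Var Γ) s)
    (a : Tuple M.carrier Γ) : (Reg.eq t t').Realize M a ↔ t.eval M a = t'.eval M a := Iff.rfl

theorem realize_subst (M : Str S) {Γ : List S.Srt} (φ : Reg S Γ) :
    ∀ {Δ : List S.Srt} (σ : Sub S Γ Δ) (a : Tuple M.carrier Δ),
      (φ.subst σ).Realize M a ↔ φ.Realize M (fun _ v => (σ _ v).eval M a) := by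
  induction φ with
  | atom α =>
    intro Δ σ a
    cases α with
    | eq t t' =>
      simp only [subst, Realize, toLInf, LInf.Realize, Atom.Realize, AtomOver.map, AtomOver.Holds,
        Term.eval_bind]
    | rel R ts =>
      simp only [subst, Realize, toLInf, LInf.Realize, Atom.Realize, AtomOver.map, AtomOver.Holds,
        Term.eval_bind]
  | top => intro Δ σ a; simp [subst]
  | and φ ψ ih ih' => intro Δ σ a; simp only [subst, realize_and, ih, ih']
  | ex s φ ih =>
    intro Δ σ a
    simp only [subst, realize_ex, ih]
    refine exists_congr fun x => iff_of_eq (congrArg _ ?_)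
    refine Tuple.cons_ext rfl (fun _ v => ?_)
    simp only [Sub.lift, Tuple.cons_succ, Term.map, Term.eval_bind, Term.eval]

theorem realize_rename (M : Str S) {Γ Δ : List S.Srt} (φ : Reg S Γ) (r : Tuple (Var Δ) Γ)
    (a : Tuple M.carrier Δ) :
    (φ.rename r).Realize M a ↔ φ.Realize M (fun _ v => a _ (r _ v)) := realize_subst M φ _ a

theorem realize_wk (M : Str S) {Γ : List S.Srt} {s : S.Srt} (φ : Reg S Γ) (x : M.carrier s)
    (a : Tuple M.carrier Γ) : (φ.wk s).Realize M (Tuple.cons x a) ↔ φ.Realize M a :=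
  realize_rename M φ _ _

theorem realize_eqs (M : Str S) : ∀ {Γ Δ : List S.Srt} (σ τ : Sub S Γ Δ) (a : Tuple M.carrier Δ),
    (eqs σ τ).Realize M a ↔ ∀ s v, (σ s v).eval M a = (τ s v).eval M a
  | [], _, _, _, _ => ⟨fun _ _ v => (nomatch v), fun _ => realize_top M _⟩
  | _ :: _, _, σ, τ, a => by
    simp only [eqs, realize_and, realize_eq, realize_eqs M σ.tail τ.tail a]
    constructor
    · rintro ⟨h, h'⟩ s v
      cases v with
      | zero => exact h
      | succ v => exact h' s v
    · intro h; exact ⟨h _ _, fun s v => h s v.succ⟩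

theorem realize_exs (M : Str S) : ∀ (Δ : List S.Srt) {Γ : List S.Srt} (φ : Reg S (Δ ++ Γ))
    (a : Tuple M.carrier Γ), (exs Δ φ).Realize M a ↔ ∃ b, φ.Realize M (Tuple.append b a)
  | [], _, φ, a => ⟨fun h => ⟨Tuple.nil, h⟩, fun ⟨_, h⟩ => h⟩
  | s :: Δ, _, φ, a => by
    simp only [exs, realize_exs M Δ, realize_ex]
    constructor
    · rintro ⟨b, x, h⟩; exact ⟨Tuple.cons x b, h⟩
    · rintro ⟨b, h⟩; exact ⟨b.tail, b _ .zero, h⟩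

/-- Regular formulae are preserved by homomorphisms. -/
theorem realize_hom {M N : Str S} (h : M ⟶ N) {Γ : List S.Srt} (φ : Reg S Γ) :
    ∀ (a : Tuple M.carrier Γ), φ.Realize M a → φ.Realize N (a.map h.toFun) := by
  induction φ with
  | atom α =>
    intro a ha
    cases α with
    | eq t t' =>
      have := congrArg (h.toFun _) ha
      rw [Term.eval_hom, Term.eval_hom] at this
      exact this
    | rel R ts =>
      have := h.map_rl R _ ha
      change N.rl R _ at this
      change N.rl R _
      convert this using 1
      funext s v
      exact (Term.eval_hom h a (ts s v)).symm
  | top => intro a _; exact realize_top N _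
  | and φ ψ ih ih' =>
    intro a ha
    rw [realize_and] at ha ⊢
    exact ⟨ih a ha.1, ih' a ha.2⟩
  | ex s φ ih =>
    rintro a ⟨x, hx⟩
    refine ⟨h.toFun s x, ?_⟩
    have e : (Tuple.cons x a).map h.toFun = Tuple.cons (h.toFun s x) (a.map h.toFun) :=
      Tuple.cons_ext rfl (fun _ _ => rfl)
    have := ih _ hx
    rw [e] at this
    exact this

end Reg

/-- The sequent calculus is sound. -/
theorem Prov.sound {S : Signature.{u}} {T : Set (Sequent S)} {M : Str S}
    (hM : ∀ q ∈ T, ∀ a : Tuple M.carrier q.ctx, q.lhs.Realize M a → q.rhs.Realize M a)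
    {Γ : List S.Srt} {φ ψ : Reg S Γ} (h : Prov T φ ψ) :
    ∀ a : Tuple M.carrier Γ, φ.Realize M a → ψ.Realize M a := by
  induction h with
  | ax h => exact hM _ h
  | refl => exact fun _ h => h
  | cut _ _ ih ih' => exact fun a h => ih' a (ih a h)
  | subst σ _ ih =>
    intro a h
    rw [Reg.realize_subst] at h ⊢
    exact ih _ h
  | eq_refl t => intro a _; exact (Reg.realize_eq M t t a).mpr rfl
  | eq_subst σ τ φ =>
    intro a h
    rw [Reg.realize_and, Reg.realize_eqs, Reg.realize_subst] at h
    rw [Reg.realize_subst]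
    convert h.2 using 1
    funext s v
    exact (h.1 s v).symm
  | top_intro => exact fun a _ => Reg.realize_top M a
  | and_left => exact fun a h => ((Reg.realize_and M _ _ a).mp h).1
  | and_right => exact fun a h => ((Reg.realize_and M _ _ a).mp h).2
  | and_intro _ _ ih ih' => exact fun a h => (Reg.realize_and M _ _ a).mpr ⟨ih a h, ih' a h⟩
  | ex_left _ ih =>
    rintro a ⟨x, hx⟩
    exact (Reg.realize_wk M _ x a).mp (ih _ hx)
  | @ex_right Γ s φ ψ _ ih =>
    intro a h
    have e : Tuple.cons (a s .zero) (fun s v => a s (.succ v)) = a :=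
      Tuple.cons_ext rfl (fun _ _ => rfl)
    rw [← e, Reg.realize_wk]
    refine ih _ ⟨a s .zero, ?_⟩
    rw [e]; exact h
  | frobenius φ ψ =>
    intro a h
    rw [Reg.realize_and] at h
    obtain ⟨h, x, hx⟩ := h
    exact ⟨x, (Reg.realize_and M _ _ _).mpr ⟨(Reg.realize_wk M _ x a).mpr h, hx⟩⟩

/-! ### The function `⟦A⟧_M → ⟦B⟧_M` induced by a functional relation -/

namespace FunRel
variable {S : Signature.{u}} {T : CartTheory S} {A B : Obj T}

theorem existsUnique_realize (θ : FunRel A B) (M : T.Mod) (a : Tuple M.obj.carrier A.ctx)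
    (ha : A.fml.Realize M.obj a) :
    ∃! b : Tuple M.obj.carrier B.ctx, θ.fml.Realize M.obj (Tuple.append b a) := by
  obtain ⟨b, hb⟩ := (Reg.realize_exs M.obj B.ctx θ.fml a).mp (θ.total.sound M.property a ha)
  refine ⟨b, hb, fun c hc => ?_⟩
  have := θ.uniq.sound M.property (Tuple.append c (Tuple.append b a))
    ((Reg.realize_and _ _ _ _).mpr ⟨by
      rw [Reg.realize_rename]
      convert hc using 1
      rw [Tuple.append_map (fun s v => Tuple.append c (Tuple.append b a) s v)]
      simp, by
      rw [Reg.realize_rename]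
      simpa using hb⟩)
  rw [Reg.realize_eqs] at this
  funext s v
  simpa [Sub.ofVar, Term.eval] using this s v

/-- The function `⟦A⟧_M → ⟦B⟧_M` whose graph is defined by `θ`. -/
noncomputable def apply (θ : FunRel A B) (M : T.Mod) (a : Tuple M.obj.carrier A.ctx)
    (ha : A.fml.Realize M.obj a) : Tuple M.obj.carrier B.ctx :=
  (θ.existsUnique_realize M a ha).choose

theorem realize_apply (θ : FunRel A B) (M : T.Mod) (a : Tuple M.obj.carrier A.ctx)
    (ha : A.fml.Realize M.obj a) : θ.fml.Realize M.obj (Tuple.append (θ.apply M a ha) a) :=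
  (θ.existsUnique_realize M a ha).choose_spec.1

theorem apply_eq_iff (θ : FunRel A B) (M : T.Mod) (a : Tuple M.obj.carrier A.ctx)
    (ha : A.fml.Realize M.obj a) (b : Tuple M.obj.carrier B.ctx) :
    θ.apply M a ha = b ↔ θ.fml.Realize M.obj (Tuple.append b a) := by
  constructor
  · rintro rfl; exact θ.realize_apply M a ha
  · intro h
    exact (θ.existsUnique_realize M a ha).unique (θ.realize_apply M a ha) h

end FunRel

/-! ### Derivations -/

namespace Sub
variable {S : Signature.{u}} {Γ Δ Θ : List S.Srt}

theorem cons_comp {s : S.Srt} (t : Term S (Var Δ) s) (σ : Sub S Γ Δ) (τ : Sub S Δ Θ) :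
    Sub.comp (Tuple.cons t σ : Sub S (s :: Γ) Δ) τ = Tuple.cons (t.bind τ) (σ.comp τ) :=
  Tuple.cons_ext rfl (fun _ _ => rfl)

theorem lift_comp_cons (σ : Sub S Γ Δ) (τ : Sub S Δ Θ) {s : S.Srt} (t : Term S (Var Θ) s) :
    (σ.lift s).comp (Tuple.cons t τ) = Tuple.cons t (σ.comp τ) := by
  refine Tuple.cons_ext rfl (fun _ v => ?_)
  simp only [comp, lift, Tuple.cons_succ, Term.map, Term.bind_bind, Term.bind]

theorem lift_comp_lift (σ : Sub S Γ Δ) (τ : Sub S Δ Θ) (s : S.Srt) :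
    (σ.lift s).comp (τ.lift s) = (σ.comp τ).lift s := by
  refine Tuple.cons_ext rfl (fun _ v => ?_)
  simp only [comp, lift, Tuple.cons_succ, Term.map, Term.bind_bind, Term.bind]

theorem lift_id (s : S.Srt) :
    Sub.lift (fun _ v => .var v : Sub S Γ Γ) s = fun _ v => .var v :=
  Tuple.cons_ext rfl (fun _ _ => rfl)

theorem comp_id (σ : Sub S Γ Δ) : σ.comp (fun _ v => .var v) = σ := by
  funext s v; exact Term.bind_var _

theorem id_comp (σ : Sub S Γ Δ) : Sub.comp (fun _ v => .var v) σ = σ := rfl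

theorem comp_assoc {Λ : List S.Srt} (σ : Sub S Γ Δ) (τ : Sub S Δ Θ) (ρ : Sub S Θ Λ) :
    (σ.comp τ).comp ρ = σ.comp (τ.comp ρ) := by
  funext s v; exact Term.bind_bind _ _ _

end Sub

namespace Reg
variable {S : Signature.{u}}

theorem subst_subst {Γ : List S.Srt} (φ : Reg S Γ) : ∀ {Δ Θ : List S.Srt} (σ : Sub S Γ Δ)
    (τ : Sub S Δ Θ), (φ.subst σ).subst τ = φ.subst (σ.comp τ) := by
  induction φ with
  | atom α =>
    intro Δ Θ σ τ
    cases α <;> simp only [subst, AtomOver.map, Term.bind_bind] <;> rfl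
  | top => intros; rfl
  | and φ ψ ih ih' => intro Δ Θ σ τ; simp only [subst, ih, ih']
  | ex s φ ih => intro Δ Θ σ τ; simp only [subst, ih, Sub.lift_comp_lift]

theorem subst_id {Γ : List S.Srt} (φ : Reg S Γ) : φ.subst (fun _ v => .var v) = φ := by
  induction φ with
  | atom α => cases α <;> simp only [subst, AtomOver.map, Term.bind_var]
  | top => rfl
  | and φ ψ ih ih' => simp only [subst, ih, ih']
  | ex s φ ih => simp only [subst, Sub.lift_id, ih]

end Reg

namespace Prov
variable {S : Signature.{u}} {T : Set (Sequent S)} {Γ Δ Θ : List S.Srt}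

theorem mono {T' : Set (Sequent S)} (h : T ⊆ T') {φ ψ : Reg S Γ} (p : Prov T φ ψ) :
    Prov T' φ ψ := by
  induction p with
  | ax hq => exact .ax (h hq)
  | refl => exact .refl _
  | cut _ _ ih ih' => exact .cut ih ih'
  | subst σ _ ih => exact .subst σ ih
  | eq_refl t => exact .eq_refl t
  | eq_subst σ τ φ => exact .eq_subst σ τ φ
  | top_intro => exact .top_intro _
  | and_left => exact .and_left _ _
  | and_right => exact .and_right _ _
  | and_intro _ _ ih ih' => exact .and_intro ih ih'
  | ex_left _ ih => exact .ex_left ih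
  | ex_right _ ih => exact .ex_right ih
  | frobenius => exact .frobenius _ _

theorem fst {χ φ ψ : Reg S Γ} (h : Prov T χ (.and φ ψ)) : Prov T χ φ := h.cut (.and_left _ _)

theorem snd {χ φ ψ : Reg S Γ} (h : Prov T χ (.and φ ψ)) : Prov T χ ψ := h.cut (.and_right _ _)

theorem inst {χ : Reg S Δ} {φ ψ : Reg S Γ} (h : Prov T φ ψ) {σ : Sub S Γ Δ}
    (h' : Prov T χ (φ.subst σ)) : Prov T χ (ψ.subst σ) := h'.cut (h.subst σ)

theorem ex_intro {χ : Reg S Δ} {σ : Sub S Γ Δ} {s : S.Srt} {φ : Reg S (s :: Γ)}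
    (t : Term S (Var Δ) s) (h : Prov T χ (φ.subst (Tuple.cons t σ))) :
    Prov T χ ((Reg.ex s φ).subst σ) := by
  have := (ex_right (.refl (T := T) ((Reg.ex s φ).subst σ))).subst
    (Tuple.cons t (fun _ v => .var v))
  rw [Reg.wk, Reg.rename, Reg.subst_subst, Reg.subst_subst] at this
  rw [Sub.lift_comp_cons, Sub.comp_id] at this
  refine (h.cut this).cut ?_
  rw [show (Sub.ofVar (fun _ => Var.succ)).comp (Tuple.cons t (fun _ v => .var v)) =
    (fun _ v => .var v : Sub S Δ Δ) from rfl, Reg.subst_id]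
  exact .refl _

theorem ex_elim {χ ρ : Reg S Δ} {σ : Sub S Γ Δ} {s : S.Srt} {φ : Reg S (s :: Γ)}
    (h : Prov T χ ((Reg.ex s φ).subst σ))
    (h' : ∀ (Θ : List S.Srt) (τ : Sub S Δ Θ) (χ' : Reg S Θ) (t : Term S (Var Θ) s),
      Prov T χ' (χ.subst τ) → Prov T χ' (φ.subst (Tuple.cons t (σ.comp τ))) →
      Prov T χ' (ρ.subst τ)) : Prov T χ ρ := by
  refine ((and_intro (.refl _) h).cut (frobenius _ _)).cut (ex_left ?_)
  exact h' (s :: Δ) (.ofVar (fun _ => .succ)) _ (.var .zero) (.and_left _ _) (.and_right _ _)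

theorem eq_rfl {χ : Reg S Γ} {s : S.Srt} (t : Term S (Var Γ) s) : Prov T χ (.eq t t) :=
  (top_intro _).cut (eq_refl t)

theorem eqs_intro : ∀ {Γ Δ : List S.Srt} {χ : Reg S Δ} {σ τ : Sub S Γ Δ},
    (∀ s v, Prov T χ (.eq (σ s v) (τ s v))) → Prov T χ (.eqs σ τ)
  | [], _, _, _, _, _ => top_intro _
  | _ :: _, _, _, _, _, h => and_intro (h _ _) (eqs_intro (fun s v => h s v.succ))

theorem eqs_elim : ∀ {Γ Δ : List S.Srt} {χ : Reg S Δ} {σ τ : Sub S Γ Δ},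
    Prov T χ (.eqs σ τ) → ∀ s v, Prov T χ (.eq (σ s v) (τ s v))
  | _ :: _, _, _, _, _, h, _, .zero => h.fst
  | _ :: _, _, _, _, _, h, _, .succ v => eqs_elim h.snd _ v

theorem replace {χ : Reg S Δ} {σ τ : Sub S Γ Δ} {φ : Reg S Γ}
    (h : ∀ s v, Prov T χ (.eq (σ s v) (τ s v))) (h' : Prov T χ (φ.subst σ)) :
    Prov T χ (φ.subst τ) := (and_intro (eqs_intro h) h').cut (eq_subst σ τ φ)

theorem replace_cons {χ : Reg S Δ} {s : S.Srt} {t t' : Term S (Var Δ) s} {σ : Sub S Γ Δ}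
    {φ : Reg S (s :: Γ)} (h : Prov T χ (.eq t t')) (h' : Prov T χ (φ.subst (Tuple.cons t σ))) :
    Prov T χ (φ.subst (Tuple.cons t' σ)) := by
  refine replace (fun s v => ?_) h'
  cases v with
  | zero => exact h
  | succ v => exact eq_rfl _

theorem eq_symm {χ : Reg S Δ} {s : S.Srt} {t t' : Term S (Var Δ) s} (h : Prov T χ (.eq t t')) :
    Prov T χ (.eq t' t) :=
  replace_cons (Γ := Δ) (σ := fun _ v => .var v)
    (φ := .eq (.var .zero) (t.map (fun _ => .succ))) h (by
      simp only [Reg.eq, Reg.subst, AtomOver.map, Term.bind, Term.map, Term.bind_bind,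
        Tuple.cons_zero, Tuple.cons_succ, Term.bind_var]
      exact eq_rfl t) |> fun h => by
      simpa only [Reg.eq, Reg.subst, AtomOver.map, Term.bind, Term.map, Term.bind_bind,
        Tuple.cons_zero, Tuple.cons_succ, Term.bind_var] using h

theorem eq_trans {χ : Reg S Δ} {s : S.Srt} {t t' t'' : Term S (Var Δ) s}
    (h : Prov T χ (.eq t t')) (h' : Prov T χ (.eq t' t'')) : Prov T χ (.eq t t'') :=
  replace_cons (Γ := Δ) (σ := fun _ v => .var v)
    (φ := .eq (t.map (fun _ => .succ)) (.var .zero)) h' (by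
      simpa only [Reg.eq, Reg.subst, AtomOver.map, Term.bind, Term.map, Term.bind_bind,
        Tuple.cons_zero, Tuple.cons_succ, Term.bind_var] using h) |> fun h => by
      simpa only [Reg.eq, Reg.subst, AtomOver.map, Term.bind, Term.map, Term.bind_bind,
        Tuple.cons_zero, Tuple.cons_succ, Term.bind_var] using h

end Prov

theorem ProvUnique.eq {S : Signature.{u}} {T : Set (Sequent S)} {Γ Δ : List S.Srt} {s : S.Srt}
    {φ : Reg S (s :: Γ)} (h : ProvUnique T φ) {χ : Reg S Δ} {σ : Sub S Γ Δ}
    {t t' : Term S (Var Δ) s} (h1 : Prov T χ (φ.subst (Tuple.cons t σ)))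
    (h2 : Prov T χ (φ.subst (Tuple.cons t' σ))) : Prov T χ (.eq t t') := by
  refine Prov.inst h (σ := Tuple.cons t' (Tuple.cons t σ)) (.and_intro ?_ ?_)
  · rw [Reg.rename, Reg.subst_subst]
    convert h1 using 2
    exact Tuple.cons_ext rfl (fun _ _ => rfl)
  · rw [Reg.rename, Reg.subst_subst]
    convert h2 using 2
    exact Tuple.cons_ext rfl (fun _ _ => rfl)

theorem ProvUnique.intro {S : Signature.{u}} {T : Set (Sequent S)} {Γ : List S.Srt} {s : S.Srt}
    {φ : Reg S (s :: Γ)} (h : ∀ (Δ : List S.Srt) (χ : Reg S Δ) (σ : Sub S Γ Δ)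
      (t t' : Term S (Var Δ) s), Prov T χ (φ.subst (Tuple.cons t σ)) →
      Prov T χ (φ.subst (Tuple.cons t' σ)) → Prov T χ (.eq t t')) : ProvUnique T φ := by
  refine h (s :: s :: Γ) _ (.ofVar (fun _ v => .succ (.succ v))) _ _ ?_ ?_
  · convert Prov.and_left _ _ using 2
    exact congrArg φ.subst (Tuple.cons_ext rfl (fun _ _ => rfl))
  · convert Prov.and_right _ _ using 2
    exact congrArg φ.subst (Tuple.cons_ext rfl (fun _ _ => rfl))

namespace IsCartesian
variable {S : Signature.{u}} {T : Set (Sequent S)}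

theorem mono {T' : Set (Sequent S)} (h : T ⊆ T') {Γ : List S.Srt} {φ : Reg S Γ} :
    IsCartesian T φ → IsCartesian T' φ := by
  induction φ with
  | atom α => exact id
  | top => exact id
  | and φ ψ ih ih' => exact fun p => ⟨ih p.1, ih' p.2⟩
  | ex s φ ih => exact fun p => ⟨ih p.1, p.2.mono h⟩

theorem subst {Γ : List S.Srt} {φ : Reg S Γ} : ∀ {Δ : List S.Srt} (σ : Sub S Γ Δ),
    IsCartesian T φ → IsCartesian T (φ.subst σ) := by
  induction φ with
  | atom α => exact fun _ _ => trivial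
  | top => exact fun _ _ => trivial
  | and φ ψ ih ih' => exact fun σ p => ⟨ih σ p.1, ih' σ p.2⟩
  | ex s φ ih =>
    refine fun σ p => ⟨ih _ p.1, ProvUnique.intro fun Δ χ τ t t' h h' => ?_⟩
    rw [Reg.subst_subst, Sub.lift_comp_cons] at h h'
    exact p.2.eq h h'

end IsCartesian

/-- The formula `∃ y (⋀ᵥ eᵥ(yᵥ, ι) ∧ ψ(y, -))`, where `y` runs over the context `Θ`. -/
def Reg.comb {S : Signature.{u}} {Γ : List S.Srt} : ∀ (Θ : List S.Srt) {Δ : List S.Srt},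
    (∀ s, Var Θ s → Reg S (s :: Γ)) → Sub S Γ Δ → Reg S (Θ ++ Δ) → Reg S Δ
  | [], _, _, _, ψ => ψ
  | s :: Θ, _, e, ι, ψ => Reg.comb Θ (fun s v => e s v.succ) ι
      (.ex s (.and ((e s .zero).subst
        (Tuple.cons (.var .zero) (fun s v => (ι s v).map (fun _ w => .succ (.right _ w))))) ψ))

section Comb
variable {S : Signature.{u}} {T : Set (Sequent S)} {Γ : List S.Srt}

theorem comb_aux {Θ Δ Δ' : List S.Srt} {s : S.Srt} (e : Reg S (s :: Γ)) (ι : Sub S Γ Δ)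
    (ψ : Reg S (s :: (Θ ++ Δ))) (τ : Sub S Θ Δ') (t : Term S (Var Δ') s) (σ : Sub S Δ Δ') :
    (Reg.and (e.subst
        (Tuple.cons (.var .zero) (fun s v => (ι s v).map (fun _ w => .succ (.right _ w))))) ψ).subst
        (Tuple.cons t (Tuple.append τ σ)) =
      .and (e.subst (Tuple.cons t (ι.comp σ)))
        (ψ.subst (Tuple.append (Γ := s :: Θ) (Tuple.cons t τ) σ)) := by
  simp only [Reg.subst, Reg.subst_subst]
  congr 2
  refine Tuple.cons_ext rfl (fun s v => ?_)
  simp only [Sub.comp, Tuple.cons_succ, Term.map, Term.bind_bind, Term.bind, Tuple.append_right]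

theorem comb_intro : ∀ {Θ Δ : List S.Srt} {e : ∀ s, Var Θ s → Reg S (s :: Γ)} {ι : Sub S Γ Δ}
    {ψ : Reg S (Θ ++ Δ)} {Δ' : List S.Srt} {σ : Sub S Δ Δ'} {χ : Reg S Δ'} (τ : Sub S Θ Δ'),
    (∀ s v, Prov T χ ((e s v).subst (Tuple.cons (τ s v) (ι.comp σ)))) →
    Prov T χ (ψ.subst (Tuple.append τ σ)) → Prov T χ ((Reg.comb Θ e ι ψ).subst σ)
  | [], _, _, _, _, _, _, _, _, _, h => h
  | s :: Θ, _, e, ι, ψ, _, σ, χ, τ, he, h => by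
    refine comb_intro (Θ := Θ) (e := fun s v => e s v.succ) (Tuple.tail (Γ := Θ) τ)
      (fun s v => he s v.succ) (.ex_intro (τ _ .zero) ?_)
    rw [comb_aux]
    refine .and_intro (he _ .zero) ?_
    exact h

theorem comb_elim : ∀ {Θ Δ : List S.Srt} {e : ∀ s, Var Θ s → Reg S (s :: Γ)} {ι : Sub S Γ Δ}
    {ψ : Reg S (Θ ++ Δ)} {Δ' : List S.Srt} {σ : Sub S Δ Δ'} {χ : Reg S Δ'} {τ : Sub S Θ Δ'},
    (∀ s v, ProvUnique T (e s v)) →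
    (∀ s v, Prov T χ ((e s v).subst (Tuple.cons (τ s v) (ι.comp σ)))) →
    Prov T χ ((Reg.comb Θ e ι ψ).subst σ) → Prov T χ (ψ.subst (Tuple.append τ σ))
  | [], _, _, _, _, _, _, _, _, _, _, h => h
  | s :: Θ, _, e, ι, ψ, _, σ, χ, τ, hu, he, h => by
    have := comb_elim (Θ := Θ) (e := fun s v => e s v.succ) (τ := Tuple.tail (Γ := Θ) τ)
      (fun s v => hu s v.succ) (fun s v => he s v.succ) h
    refine .ex_elim this (fun Ξ ρ χ' t h1 h2 => ?_)
    have e1 : Sub.comp (Tuple.append τ.tail σ : Sub S (Θ ++ _) _) ρ =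
        Tuple.append (Sub.comp τ.tail ρ) (σ.comp ρ) := Tuple.append_map (fun _ t => Term.bind ρ t) _ _
    rw [e1, comb_aux] at h2
    have h3 := (Prov.subst ρ (he s .zero))
    rw [Reg.subst_subst, Sub.cons_comp, Sub.comp_assoc] at h3
    have h4 := (hu s .zero).eq h2.fst (h1.cut h3)
    have h5 := Prov.replace_cons (T := T) (φ := ψ) (σ := Tuple.append (Sub.comp τ.tail ρ) (σ.comp ρ))
      h4 h2.snd
    have e2 : Sub.comp (Tuple.append τ σ : Sub S (s :: Θ ++ _) _) ρ =
        Tuple.append (Γ := s :: Θ) (Sub.comp τ ρ) (σ.comp ρ) :=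
      Tuple.append_map (Γ := s :: Θ) (fun _ t => Term.bind ρ t) τ σ
    have h6 := Reg.subst_subst (Γ := s :: Θ ++ _) ψ (Tuple.append τ σ) ρ
    rw [h6, e2]
    exact h5

theorem comb_cases : ∀ {Θ Δ : List S.Srt} {e : ∀ s, Var Θ s → Reg S (s :: Γ)} {ι : Sub S Γ Δ}
    {χ ρ : Reg S Δ}, (∀ s v, Prov T χ ((Reg.ex s (e s v)).subst ι)) →
    (∀ (Δ' : List S.Srt) (σ : Sub S Δ Δ') (χ' : Reg S Δ') (τ : Sub S Θ Δ'),
      Prov T χ' (χ.subst σ) →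
      (∀ s v, Prov T χ' ((e s v).subst (Tuple.cons (τ s v) (ι.comp σ)))) →
      Prov T χ' (ρ.subst σ)) → Prov T χ ρ
  | [], _, _, _, χ, ρ, _, h => by
    have := h _ (fun _ v => .var v) χ Tuple.nil (by rw [Reg.subst_id]; exact .refl _)
      (fun _ v => nomatch v)
    rwa [Reg.subst_id] at this
  | s :: Θ, _, e, ι, χ, ρ, he, h => by
    refine comb_cases (e := fun s v => e s v.succ) (fun s v => he s v.succ)
      (fun Δ' σ χ' τ h1 h2 => ?_)
    have h0 := (he s .zero).subst σ
    rw [Reg.subst_subst] at h0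
    refine .ex_elim (h1.cut h0) (fun Ξ κ χ'' t h3 h4 => ?_)
    rw [Reg.subst_subst]
    refine h Ξ (σ.comp κ) χ'' (Tuple.cons t (Sub.comp τ κ)) ?_ ?_
    · rw [← Reg.subst_subst]
      exact h3.cut (h1.subst κ)
    · intro s v
      rw [← Sub.comp_assoc]
      cases v with
      | zero => exact h4
      | succ v =>
        have := h3.cut ((h2 s v).subst κ)
        rwa [Reg.subst_subst, Sub.cons_comp] at this

theorem comb_cart : ∀ {Θ Δ : List S.Srt} {e : ∀ s, Var Θ s → Reg S (s :: Γ)} {ι : Sub S Γ Δ}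
    {ψ : Reg S (Θ ++ Δ)}, (∀ s v, IsCartesian T (e s v)) → (∀ s v, ProvUnique T (e s v)) →
    IsCartesian T ψ → IsCartesian T (Reg.comb Θ e ι ψ)
  | [], _, _, _, _, _, _, h => h
  | s :: Θ, _, e, ι, ψ, hc, hu, h => by
    refine comb_cart (Θ := Θ) (e := fun s v => e s v.succ) (fun s v => hc s v.succ) (fun s v => hu s v.succ)
      ⟨⟨(hc s .zero).subst _, h⟩, ProvUnique.intro (fun Δ' χ σ t t' h1 h2 => ?_)⟩
    have e1 := Tuple.append_eta (X := Term S (Var Δ')) (Γ := Θ) σ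
    rw [← e1, comb_aux] at h1 h2
    exact (hu s .zero).eq h1.fst h2.fst

end Comb

/-! ### Finitely presentable models -/

namespace FunRel
variable {S : Signature.{u}} {T : CartTheory S} {A : Obj T} {s : S.Srt}

/-- Functional relations into `{y : s | ⊤}`. -/
def mk1 (fml : Reg S (s :: A.ctx)) (cart : IsCartesian T.seqs fml)
    (le : Prov T.seqs fml (A.fml.wk s)) (uniq : ProvUnique T.seqs fml)
    (total : Prov T.seqs A.fml (.ex s fml)) : FunRel A (Obj.ofSort T s) where
  fml := fml
  cart := cart
  le := .and_intro le (.top_intro _)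
  uniq := by
    refine .and_intro (uniq.eq (σ := .ofVar (fun _ v => .succ (.succ v))) ?_ ?_) (.top_intro _)
    · refine Prov.cut (.and_left _ _) ?_
      have e : (Sub.ofVar (Tuple.append (Γ := [s]) (fun _ v => Var.left _ v)
          (fun _ v => Var.right (Γ := [s]) _ (Var.right (Γ := [s]) _ v))) :
          Sub S (s :: A.ctx) (s :: s :: A.ctx)) =
          Tuple.cons (.var .zero) (Sub.ofVar (fun _ v => .succ (.succ v))) :=
        Tuple.cons_ext rfl (fun _ _ => rfl)
      exact e ▸ .refl _
    · refine Prov.cut (.and_right _ _) ?_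
      have e : (Sub.ofVar (fun _ v => Var.right (Γ := [s]) _ v) :
          Sub S (s :: A.ctx) (s :: s :: A.ctx)) =
          Tuple.cons (.var (.succ .zero)) (Sub.ofVar (fun _ v => .succ (.succ v))) :=
        Tuple.cons_ext rfl (fun _ _ => rfl)
      exact e ▸ .refl _
  total := total

variable (θ : FunRel A (Obj.ofSort T s))

/-- The formula of a functional relation into `{y : s | ⊤}`. -/
def fml1 : Reg S (s :: A.ctx) := θ.fml

theorem le1 : Prov T.seqs θ.fml1 (A.fml.wk s) := θ.le.fst

theorem total1 : Prov T.seqs A.fml (.ex s θ.fml1) := θ.total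

theorem uniq1 : ProvUnique T.seqs θ.fml1 := by
  refine ProvUnique.intro (fun Δ χ σ t t' h h' => ?_)
  let r : Tuple (Var (s :: s :: A.ctx)) (s :: A.ctx) :=
    Tuple.append (Γ := [s]) (fun _ v => Var.left (Γ := [s]) _ v)
      (fun _ v => Var.right (Γ := [s]) _ (Var.right (Γ := [s]) _ v))
  let r' : Tuple (Var (s :: s :: A.ctx)) (s :: A.ctx) := fun _ v => Var.right (Γ := [s]) _ v
  have hu : Prov T.seqs (Γ := s :: s :: A.ctx) (.and (θ.fml1.rename r) (θ.fml1.rename r'))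
      (.and (.eq (.var .zero) (.var (.succ .zero))) .top) := θ.uniq
  refine (Prov.inst hu (σ := Tuple.cons t (Tuple.cons t' σ)) (.and_intro ?_ ?_)).fst
  · rw [Reg.rename, Reg.subst_subst]
    have e : Sub.comp (Sub.ofVar r : Sub S _ _) (Tuple.cons t (Tuple.cons t' σ)) =
        Tuple.cons t σ := Tuple.cons_ext rfl (fun _ _ => rfl)
    rwa [e]
  · rw [Reg.rename, Reg.subst_subst]
    have e : Sub.comp (Sub.ofVar r' : Sub S _ _) (Tuple.cons t (Tuple.cons t' σ)) =
        Tuple.cons t' σ := Tuple.cons_ext rfl (fun _ _ => rfl)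
    rwa [e]

end FunRel

namespace FG
variable {S : Signature.{u}} {T : CartTheory S} (A : Obj T)

/-- A formula that represents the morphism `q` from `A` to `{y : s | ⊤}`. -/
noncomputable def rep {A : Obj T} {s : S.Srt} (q : SynHom A (Obj.ofSort T s)) :
    Reg S (s :: A.ctx) := (Quotient.out q).fml1

theorem rep_cart {A : Obj T} {s : S.Srt} (q : SynHom A (Obj.ofSort T s)) :
    IsCartesian T.seqs (rep q) := (Quotient.out q).cart

theorem rep_uniq {A : Obj T} {s : S.Srt} (q : SynHom A (Obj.ofSort T s)) :
    ProvUnique T.seqs (rep q) := (Quotient.out q).uniq1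

theorem rep_total {A : Obj T} {s : S.Srt} (q : SynHom A (Obj.ofSort T s)) {Δ : List S.Srt}
    {χ : Reg S Δ} {σ : Sub S A.ctx Δ} (h : Prov T.seqs χ (A.fml.subst σ)) :
    Prov T.seqs χ ((Reg.ex s (rep q)).subst σ) := .inst (Quotient.out q).total1 h

theorem rep_le {A : Obj T} {s : S.Srt} (q : SynHom A (Obj.ofSort T s)) {Δ : List S.Srt}
    {χ : Reg S Δ} {σ : Sub S A.ctx Δ} {t : Term S (Var Δ) s}
    (h : Prov T.seqs χ ((rep q).subst (Tuple.cons t σ))) : Prov T.seqs χ (A.fml.subst σ) := by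
  have := Prov.inst (Quotient.out q).le1 h
  rwa [Reg.wk, Reg.rename, Reg.subst_subst] at this

/-- The graph of the composite of a tuple `q` of morphisms from `A` with a term. -/
noncomputable def fnFml {Θ : List S.Srt} {s : S.Srt}
    (q : ∀ s, Var Θ s → SynHom A (Obj.ofSort T s)) (ψ : Reg S (s :: Θ)) :
    Reg S (s :: A.ctx) :=
  .and (A.fml.wk s) (.comb Θ (fun s v => rep (q s v)) (.ofVar (fun _ v => .succ v))
    (ψ.rename (Tuple.cons (.right _ .zero) (fun _ v => .left _ v))))

theorem fnFml_intro {A : Obj T} {Θ : List S.Srt} {s : S.Srt}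
    {q : ∀ s, Var Θ s → SynHom A (Obj.ofSort T s)} {ψ : Reg S (s :: Θ)} {Δ : List S.Srt}
    {χ : Reg S Δ} {σ : Sub S A.ctx Δ} {t : Term S (Var Δ) s} (τ : Sub S Θ Δ)
    (hA : Prov T.seqs χ (A.fml.subst σ))
    (h : ∀ s v, Prov T.seqs χ ((rep (q s v)).subst (Tuple.cons (τ s v) σ)))
    (h' : Prov T.seqs χ (ψ.subst (Tuple.cons t τ))) :
    Prov T.seqs χ ((fnFml A q ψ).subst (Tuple.cons t σ)) := by
  refine .and_intro ?_ (comb_intro τ h ?_)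
  · rwa [Reg.wk, Reg.rename, Reg.subst_subst]
  · rw [Reg.rename, Reg.subst_subst]
    convert h' using 2
    refine Tuple.cons_ext ?_ (fun s v => ?_)
    · simp [Sub.comp, Sub.ofVar, Term.bind]
    · simp [Sub.comp, Sub.ofVar, Term.bind]

theorem fnFml_elim {A : Obj T} {Θ : List S.Srt} {s : S.Srt}
    {q : ∀ s, Var Θ s → SynHom A (Obj.ofSort T s)} {ψ : Reg S (s :: Θ)} {Δ : List S.Srt}
    {χ : Reg S Δ} {σ : Sub S A.ctx Δ} {t : Term S (Var Δ) s} {τ : Sub S Θ Δ}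
    (h : ∀ s v, Prov T.seqs χ ((rep (q s v)).subst (Tuple.cons (τ s v) σ)))
    (h' : Prov T.seqs χ ((fnFml A q ψ).subst (Tuple.cons t σ))) :
    Prov T.seqs χ (ψ.subst (Tuple.cons t τ)) := by
  have := comb_elim (σ := Tuple.cons t σ) (fun s v => rep_uniq (q s v)) h h'.snd
  rw [Reg.rename, Reg.subst_subst] at this
  convert this using 2
  refine Tuple.cons_ext ?_ (fun s v => ?_)
  · simp [Sub.comp, Sub.ofVar, Term.bind]
  · simp [Sub.comp, Sub.ofVar, Term.bind]

/-- Reduction to the case that the values of the tuple `q` are given by terms. -/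
theorem cases {A : Obj T} {Θ : List S.Srt} (q : ∀ s, Var Θ s → SynHom A (Obj.ofSort T s))
    {Δ : List S.Srt} {χ ρ : Reg S Δ} {σ : Sub S A.ctx Δ} (hA : Prov T.seqs χ (A.fml.subst σ))
    (h : ∀ (Δ' : List S.Srt) (κ : Sub S Δ Δ') (χ' : Reg S Δ') (τ : Sub S Θ Δ'),
      Prov T.seqs χ' (χ.subst κ) →
      (∀ s v, Prov T.seqs χ' ((rep (q s v)).subst (Tuple.cons (τ s v) (σ.comp κ)))) →
      Prov T.seqs χ' (ρ.subst κ)) : Prov T.seqs χ ρ :=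
  comb_cases (e := fun s v => rep (q s v)) (ι := σ) (fun s v => rep_total (q s v) hA) h

/-- The morphism to `{y : s | ⊤}` that is defined from the tuple `q` by a functional formula. -/
noncomputable def fnRel {Θ : List S.Srt} {s : S.Srt}
    (q : ∀ s, Var Θ s → SynHom A (Obj.ofSort T s)) (ψ : Reg S (s :: Θ))
    (hc : IsCartesian T.seqs ψ) (hu : ProvUnique T.seqs ψ)
    (ht : ∀ (Δ : List S.Srt) (χ : Reg S Δ) (σ : Sub S A.ctx Δ) (τ : Sub S Θ Δ),
      Prov T.seqs χ (A.fml.subst σ) →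
      (∀ s v, Prov T.seqs χ ((rep (q s v)).subst (Tuple.cons (τ s v) σ))) →
      Prov T.seqs χ ((Reg.ex s ψ).subst τ)) : FunRel A (Obj.ofSort T s) :=
  FunRel.mk1 (fnFml A q ψ)
    ⟨A.cart.subst _, comb_cart (fun s v => rep_cart (q s v)) (fun s v => rep_uniq (q s v))
      (hc.subst _)⟩
    (.and_left _ _)
    (ProvUnique.intro (fun Δ χ σ t t' h h' => by
      have hA : Prov T.seqs χ (A.fml.subst σ) := by
        have := h.fst
        rwa [Reg.wk, Reg.rename, Reg.subst_subst] at this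
      refine cases q hA (fun Δ' κ χ' τ h1 h2 => ?_)
      have h3 := h1.cut (h.subst κ)
      have h4 := h1.cut (h'.subst κ)
      rw [Reg.subst_subst, Sub.cons_comp] at h3 h4
      exact hu.eq (fnFml_elim h2 h3) (fnFml_elim h2 h4)))
    (by
      have hA : Prov T.seqs A.fml (A.fml.subst (fun _ v => .var v)) := by
        rw [Reg.subst_id]; exact .refl _
      refine cases q hA (fun Δ' κ χ' τ h1 h2 => ?_)
      refine .ex_elim (ht _ χ' κ τ h1 h2) (fun Ξ ρ χ'' t h3 h4 => ?_)
      rw [Reg.subst_subst]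
      refine .ex_intro t (fnFml_intro (Sub.comp τ ρ) ?_ (fun s v => ?_) h4)
      · rw [← Reg.subst_subst]; exact h3.cut (h1.subst ρ)
      · have := h3.cut ((h2 s v).subst ρ)
        rwa [Reg.subst_subst, Sub.cons_comp] at this)

theorem rep_mk {A : Obj T} {s : S.Srt} (θ : FunRel A (Obj.ofSort T s)) {Δ : List S.Srt}
    {χ : Reg S Δ} {σ : Sub S (s :: A.ctx) Δ} :
    Prov T.seqs χ ((rep (Quotient.mk _ θ : SynHom A _)).subst σ) ↔
      Prov T.seqs χ (θ.fml1.subst σ) := by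
  have h := Quotient.mk_out (s := FunRel.setoid A (Obj.ofSort T s)) θ
  exact ⟨fun p => .inst h.1 p, fun p => .inst h.2 p⟩

/-- The formula `y = f(x₁, …, xₙ)`. -/
def graph (f : S.Fn) : Reg S (S.cod f :: S.dom f) :=
  .eq (.var .zero) (.app f (fun _ v => .var (.succ v)))

theorem graph_subst (f : S.Fn) {Δ : List S.Srt} (t : Term S (Var Δ) (S.cod f))
    (τ : Sub S (S.dom f) Δ) : (graph f).subst (Tuple.cons t τ) = .eq t (.app f τ) := rfl

/-- The structure of morphisms from `A` to the objects `{y : s | ⊤}` of the syntactic category. -/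
noncomputable def str : Str S where
  carrier s := SynHom A (Obj.ofSort T s)
  fn f q := Quotient.mk _ (fnRel A q (graph f) trivial
    (ProvUnique.intro (fun Δ χ σ t t' h h' => by
      rw [graph_subst] at h h'
      exact h.eq_trans h'.eq_symm))
    (fun Δ χ σ τ _ _ => .ex_intro (.app f τ) (by rw [graph_subst]; exact .eq_rfl _)))
  rl R q := Prov T.seqs A.fml (.comb (S.ar R) (fun s v => rep (q s v)) (.ofVar (fun _ v => v))
    (.atom (.rel R (fun _ v => .var (.left _ v)))))

theorem eval_rep {A : Obj T} {Θ : List S.Srt} {q : Tuple (str A).carrier Θ} {Δ : List S.Srt}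
    {χ : Reg S Δ} {σ : Sub S A.ctx Δ} {τ : Sub S Θ Δ} (hA : Prov T.seqs χ (A.fml.subst σ))
    (h : ∀ s v, Prov T.seqs χ ((rep (q s v)).subst (Tuple.cons (τ s v) σ)))
    {s : S.Srt} (t : Term S (Var Θ) s) :
    Prov T.seqs χ ((rep (t.eval (str A) q)).subst (Tuple.cons (t.bind τ) σ)) := by
  induction t with
  | var x => exact h _ x
  | app f ts ih =>
    refine (rep_mk _).mpr ?_
    refine fnFml_intro (fun s v => (ts s v).bind τ) hA ih ?_
    rw [graph_subst]
    exact .eq_rfl _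

theorem eq_of_forces {A : Obj T} {s : S.Srt} (p q : SynHom A (Obj.ofSort T s))
    (h : Prov T.seqs (rep p) (rep q)) : p = q := by
  rw [← Quotient.out_eq p, ← Quotient.out_eq q]
  refine Quotient.sound ⟨h, ?_⟩
  have id_eq : Tuple.cons (.var .zero) (Sub.ofVar (fun _ v => .succ v)) =
      (fun _ v => .var v : Sub S (s :: A.ctx) (s :: A.ctx)) := Tuple.cons_ext rfl (fun _ _ => rfl)
  have hq : Prov T.seqs (rep q)
      ((rep q).subst (Tuple.cons (.var .zero) (Sub.ofVar (fun _ v => .succ v)))) := by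
    rw [id_eq, Reg.subst_id]; exact .refl _
  have h2 : Prov T.seqs (rep q)
      ((rep p).subst (Tuple.cons (.var .zero) (Sub.ofVar (fun _ v => .succ v)))) := by
    refine .ex_elim (rep_total p (rep_le q hq)) (fun Ξ κ χ t h3 h4 => ?_)
    have h5 := h3.cut (hq.subst κ)
    rw [Reg.subst_subst, Sub.cons_comp] at h5 ⊢
    exact Prov.replace_cons ((rep_uniq q).eq (Prov.inst h h4) h5) h4
  rwa [id_eq, Reg.subst_id] at h2

/-- Truth of a cartesian formula in the structure `str A`. -/
theorem realize_iff {A : Obj T} {Θ : List S.Srt} {ψ : Reg S Θ} :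
    IsCartesian T.seqs ψ → ∀ (q : Tuple (str A).carrier Θ), ψ.Realize (str A) q ↔
      ∀ (Δ : List S.Srt) (χ : Reg S Δ) (σ : Sub S A.ctx Δ) (τ : Sub S Θ Δ),
        Prov T.seqs χ (A.fml.subst σ) →
        (∀ s v, Prov T.seqs χ ((rep (q s v)).subst (Tuple.cons (τ s v) σ))) →
        Prov T.seqs χ (ψ.subst τ) := by
  induction ψ with
  | atom α =>
    intro _ q
    cases α with
    | @eq s t t' =>
      constructor
      · intro h Δ χ σ τ hA hq
        have h1 := eval_rep hA hq t
        have h2 := eval_rep hA hq t'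
        rw [show t.eval (str A) q = t'.eval (str A) q from h] at h1
        exact (rep_uniq _).eq h1 h2
      · intro h
        refine eq_of_forces (t.eval (str A) q) (t'.eval (str A) q) ?_
        have id_eq : Tuple.cons (.var .zero) (Sub.ofVar (fun _ v => .succ v)) =
            (fun _ v => .var v : Sub S (s :: A.ctx) (s :: A.ctx)) :=
          Tuple.cons_ext rfl (fun _ _ => rfl)
        have hp : Prov T.seqs (rep (t.eval (str A) q)) ((rep (t.eval (str A) q)).subst
            (Tuple.cons (.var .zero) (Sub.ofVar (fun _ v => .succ v)))) := by
          rw [id_eq, Reg.subst_id]; exact .refl _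
        refine cases q (rep_le _ hp) (fun Δ' κ χ' τ h1 h2 => ?_)
        have h3 := h1.cut (hp.subst κ)
        rw [Reg.subst_subst, Sub.cons_comp] at h3
        have hA := rep_le _ h3
        have h4 := (rep_uniq _).eq (eval_rep hA h2 t) h3
        have h5 := eval_rep hA h2 t'
        have h6 := Prov.replace_cons ((h _ χ' _ τ hA h2).eq_symm.eq_trans h4) h5
        have e : κ = Tuple.cons ((Term.var .zero).bind κ) (Sub.comp (Sub.ofVar fun _ v => .succ v) κ) :=
          Tuple.cons_ext rfl (fun _ _ => rfl)
        rw [e]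
        exact h6
    | rel R ts =>
      constructor
      · intro h Δ χ σ τ hA hq
        have h1 : Prov T.seqs A.fml (.comb (S.ar R)
          (fun s v => rep ((ts s v).eval (str A) q)) (.ofVar (fun _ v => v))
          (.atom (.rel R (fun _ v => .var (.left _ v))))) := h
        have h2 := comb_elim (τ := fun s v => (ts s v).bind τ) (fun s v => rep_uniq _)
          (fun s v => eval_rep hA hq (ts s v)) (Prov.inst h1 hA)
        simp only [Reg.subst, AtomOver.map, Term.bind, Tuple.append_left] at h2
        exact h2
      · intro h
        change Prov T.seqs A.fml (.comb (S.ar R)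
          (fun s v => rep ((ts s v).eval (str A) q)) (.ofVar (fun _ v => v))
          (.atom (.rel R (fun _ v => .var (.left _ v)))))
        have hA : Prov T.seqs A.fml (A.fml.subst (fun _ v => .var v)) := by
          rw [Reg.subst_id]; exact .refl _
        refine cases q hA (fun Δ' κ χ' τ h1 h2 => ?_)
        refine comb_intro (fun s v => (ts s v).bind τ) (fun s v => eval_rep h1 h2 (ts s v)) ?_
        have := h _ χ' κ τ h1 h2
        simp only [Reg.subst, AtomOver.map, Term.bind, Tuple.append_left]
        exact this
  | top => exact fun _ q => ⟨fun _ _ _ _ _ _ _ => .top_intro _, fun _ => Reg.realize_top _ _⟩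
  | and φ ψ ih ih' =>
    intro hc q
    rw [Reg.realize_and, ih hc.1, ih' hc.2]
    constructor
    · exact fun h Δ χ σ τ hA hq => .and_intro (h.1 Δ χ σ τ hA hq) (h.2 Δ χ σ τ hA hq)
    · exact fun h => ⟨fun Δ χ σ τ hA hq => (h Δ χ σ τ hA hq).fst,
        fun Δ χ σ τ hA hq => (h Δ χ σ τ hA hq).snd⟩
  | ex s ψ ih =>
    intro hc q
    rw [Reg.realize_ex]
    constructor
    · rintro ⟨x, hx⟩ Δ χ σ τ hA hq
      rw [ih hc.1] at hx
      refine .ex_elim (rep_total x hA) (fun Ξ κ χ' t h1 h2 => ?_)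
      rw [Reg.subst_subst]
      refine .ex_intro t (hx _ χ' (σ.comp κ) _ ?_ (fun s v => ?_))
      · rw [← Reg.subst_subst]; exact h1.cut (hA.subst κ)
      · cases v with
        | zero => exact h2
        | succ v =>
          have := h1.cut ((hq s v).subst κ)
          rwa [Reg.subst_subst, Sub.cons_comp] at this
    · intro h
      refine ⟨Quotient.mk _ (fnRel A q ψ hc.1 hc.2 h), ?_⟩
      rw [ih hc.1]
      intro Δ χ σ τ hA hq
      have h1 := (rep_mk _).mp (hq s .zero)
      have h2 := fnFml_elim (τ := τ.tail) (fun s v => hq s v.succ) h1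
      convert h2 using 2
      exact Tuple.cons_ext rfl (fun _ _ => rfl)

theorem isModel : T.IsModel (str A) := by
  obtain ⟨r, _, _, hr⟩ := T.cartesian
  intro q hq a h
  have h1 := (hr q hq).1.mono (T' := T.seqs) (fun _ hp => hp.1)
  have h2 := (hr q hq).2.mono (T' := T.seqs) (fun _ hp => hp.1)
  rw [realize_iff h1] at h
  rw [realize_iff h2]
  exact fun Δ χ σ τ hA ha => .inst (.ax hq) (h Δ χ σ τ hA ha)

end FG

theorem Reg.realize_comb {S : Signature.{u}} (M : Str S) {Γ : List S.Srt} :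
    ∀ {Θ Δ : List S.Srt} (e : ∀ s, Var Θ s → Reg S (s :: Γ)) (ι : Sub S Γ Δ) (ψ : Reg S (Θ ++ Δ))
      (a : Tuple M.carrier Δ), (Reg.comb Θ e ι ψ).Realize M a ↔ ∃ c : Tuple M.carrier Θ,
        (∀ s v, (e s v).Realize M (Tuple.cons (c s v) (fun s w => (ι s w).eval M a))) ∧
          ψ.Realize M (Tuple.append c a)
  | [], _, _, _, _, _ =>
    ⟨fun h => ⟨Tuple.nil, fun _ v => (nomatch v), h⟩, fun ⟨_, _, h⟩ => h⟩
  | s :: Θ, _, e, ι, ψ, a => by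
    have key : ∀ (c : Tuple M.carrier Θ) (x : M.carrier s),
        (fun s' v => Term.eval M (Tuple.cons x (Tuple.append c a)) ((Tuple.cons (.var .zero)
          (fun s v => (ι s v).map (fun _ w => .succ (.right _ w))) :
          Sub S (s :: Γ) (s :: (Θ ++ _))) s' v)) =
        Tuple.cons x (fun s w => (ι s w).eval M a) := by
      intro c x
      refine Tuple.cons_ext rfl (fun s v => ?_)
      simp only [Tuple.cons_succ, Term.map, Term.eval_bind, Term.eval, Tuple.append_right]
    simp only [Reg.comb, Reg.realize_comb M (fun s v => e s v.succ) ι, Reg.realize_ex,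
      Reg.realize_and, Reg.realize_subst, key]
    constructor
    · rintro ⟨c, hc, x, hx, hψ⟩
      refine ⟨Tuple.cons x c, fun s v => ?_, hψ⟩
      cases v with
      | zero => exact hx
      | succ v => exact hc s v
    · rintro ⟨c, hc, hψ⟩
      exact ⟨c.tail, fun s v => hc s v.succ, c _ .zero, hc _ .zero, hψ⟩

/-- The finitely presentable model `⟨x | φ⟩` that represents `M ↦ ⟦φ⟧_M`, for `A = {x | φ}`: its
elements of sort `s` are the morphisms from `A` to `{y : s | ⊤}` in the syntactic category. -/
noncomputable def FG {S : Signature.{u}} {T : CartTheory S} (A : Obj T) : T.Mod :=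
  ⟨FG.str A, FG.isModel A⟩

/-- The action of a morphism of the syntactic category on the interpretations in a model `M`:
the function `⟦A⟧_M → ⟦B⟧_M`. -/
noncomputable def SynHom.apply {S : Signature.{u}} {T : CartTheory S} {A B : Obj T}
    (q : SynHom A B) (M : T.Mod) (a : Tuple M.obj.carrier A.ctx) (ha : A.fml.Realize M.obj a) :
    Tuple M.obj.carrier B.ctx :=
  Quotient.lift (fun θ : FunRel A B => θ.apply M a ha) (fun θ η (h : _ ∧ _) =>
    (θ.apply_eq_iff M a ha _).mpr (h.2.sound M.property _ (η.realize_apply M a ha))) q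

namespace FG
variable {S : Signature.{u}} {T : CartTheory S} (A : Obj T)

/-- The generators `x₁, …, xₙ` of `⟨x | φ⟩`, given by the projections `φ(x) ∧ y = xᵢ`. -/
noncomputable def gen : Tuple (FG A).obj.carrier A.ctx := fun s v =>
  Quotient.mk _ (FunRel.mk1 (.and (A.fml.wk s) (.eq (.var .zero) (.var (.succ v))))
    ⟨A.cart.subst _, trivial⟩ (.and_left _ _)
    (ProvUnique.intro (fun _ _ _ _ _ h h' => h.snd.eq_trans h'.snd.eq_symm))
    (by
      have := Prov.ex_intro (T := T.seqs) (χ := A.fml) (σ := fun _ v => .var v)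
        (φ := .and (A.fml.wk s) (.eq (.var .zero) (.var (.succ v)))) (.var v)
        (.and_intro (by
          rw [Reg.wk, Reg.rename, Reg.subst_subst]
          exact (Reg.subst_id A.fml).symm ▸ .refl _) (.eq_rfl _))
      rwa [Reg.subst_id] at this))

theorem realize_gen : A.fml.Realize (FG A).obj (gen A) := by
  refine (realize_iff A.cart (gen A)).mpr (fun Δ χ σ τ hA h => ?_)
  refine Prov.replace (fun s v => ?_) hA
  exact ((rep_mk _).mp (h s v)).snd.eq_symm

variable {A}

theorem apply_out {s : S.Srt} (q : SynHom A (Obj.ofSort T s)) (M : T.Mod)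
    (a : Tuple M.obj.carrier A.ctx) (ha : A.fml.Realize M.obj a) (x : M.obj.carrier s) :
    q.apply M a ha s .zero = x ↔ (rep q).Realize M.obj (Tuple.cons x a) := by
  have h : q.apply M a ha = (Quotient.out q).apply M a ha := by
    conv_lhs => rw [← Quotient.out_eq q]
    rfl
  have h' := (Quotient.out q).apply_eq_iff M a ha (Tuple.cons x Tuple.nil)
  rw [h]
  refine Iff.trans ⟨fun e => ?_, fun e => ?_⟩ h'
  · exact Tuple.cons_ext e (fun _ v => nomatch v)
  · rw [e]; rfl

theorem le_rep_mk {s : S.Srt} (θ : FunRel A (Obj.ofSort T s)) :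
    Prov T.seqs θ.fml1 (rep (Quotient.mk _ θ : SynHom A _)) :=
  (Quotient.mk_out (s := FunRel.setoid A (Obj.ofSort T s)) θ).2

theorem apply_fn (f : S.Fn) (q : ∀ s, Var (S.dom f) s → SynHom A (Obj.ofSort T s)) (M : T.Mod)
    (a : Tuple M.obj.carrier A.ctx) (ha : A.fml.Realize M.obj a) :
    SynHom.apply ((str A).fn f q) M a ha _ .zero =
      M.obj.fn f (fun s v => (q s v).apply M a ha s .zero) := by
  have h : (fnFml A q (graph f)).Realize M.obj
      (Tuple.cons (M.obj.fn f (fun s v => (q s v).apply M a ha s .zero)) a) := by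
    refine (Reg.realize_and _ _ _ _).mpr ⟨(Reg.realize_wk _ _ _ _).mpr ha, ?_⟩
    refine (Reg.realize_comb _ _ _ _ _).mpr ⟨fun s v => (q s v).apply M a ha s .zero,
      fun s v => (apply_out (q s v) M a ha _).mp rfl, ?_⟩
    rw [Reg.realize_rename]
    simp only [graph, Reg.realize_eq, Term.eval, Tuple.cons_zero, Tuple.cons_succ,
      Tuple.append_right, Tuple.append_left]
  exact (apply_out _ M a ha _).mpr (Prov.sound M.property (le_rep_mk (fnRel A q _ _ _ _)) _ h)

theorem apply_rl (R : S.Rl) (q : ∀ s, Var (S.ar R) s → SynHom A (Obj.ofSort T s)) (M : T.Mod)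
    (a : Tuple M.obj.carrier A.ctx) (ha : A.fml.Realize M.obj a) (h : (str A).rl R q) :
    M.obj.rl R (fun s v => (q s v).apply M a ha s .zero) := by
  have h1 := Prov.sound M.property (show Prov T.seqs A.fml _ from h) a ha
  obtain ⟨c, hc, hR⟩ := (Reg.realize_comb _ _ _ _ _).mp h1
  have e : (fun s v => (q s v).apply M a ha s .zero) = c := by
    funext s v
    exact (apply_out (q s v) M a ha _).mpr (hc s v)
  rw [e]
  have h2 : M.obj.rl R (fun s v => Tuple.append c a s (.left s v)) := hR
  simpa only [Tuple.append_left] using h2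

/-- The homomorphism `⟨x | φ⟩ ⟶ M` that takes `x` to `a ∈ ⟦φ⟧_M`, given by `θ ↦ ⟦θ⟧_M(a)`. -/
noncomputable def lift (A : Obj T) (M : T.Mod) (a : Tuple M.obj.carrier A.ctx)
    (ha : A.fml.Realize M.obj a) : FG A ⟶ M :=
  ObjectProperty.homMk
    { toFun := fun s q => SynHom.apply (A := A) (B := Obj.ofSort T s) q M a ha s .zero
      map_fn := fun f q => apply_fn f q M a ha
      map_rl := fun R q h => apply_rl R q M a ha h }

/-- The homomorphism `⟨y | ψ⟩ ⟶ ⟨x | φ⟩` that corresponds under the Yoneda embedding to a morphism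
`θ : {x | φ} ⟶ {y | ψ}` of the syntactic category. -/
noncomputable def yonedaMap {B : Obj T} (θ : FunRel A B) : FG B ⟶ FG A :=
  lift B (FG A) (θ.apply (FG A) (gen A) (realize_gen A)) (by
    have h := θ.le.sound (FG A).property _ (θ.realize_apply (FG A) (gen A) (realize_gen A))
    have h2 := ((Reg.realize_and _ _ _ _).mp h).2
    rw [Reg.realize_rename] at h2
    simpa only [Tuple.append_left] using h2)

end FG

/-! ### Presentations -/

/-- The tuple (or family) `a` generates `M`: every substructure that contains `a` is all of `M`. -/
def Str.GeneratedBy {S : Signature.{u}} (M : Str S) {X : S.Srt → Type u}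
    (a : ∀ s, X s → M.carrier s) : Prop :=
  ∀ N : ∀ s, Set (M.carrier s),
    (∀ (f : S.Fn) (b : Tuple M.carrier (S.dom f)), (∀ s v, b s v ∈ N s) → M.fn f b ∈ N (S.cod f)) →
    (∀ s x, a s x ∈ N s) → ∀ s m, m ∈ N s

/-- A presentation: a sorted family of generators and a set of atomic formulae over them. -/
structure Presentation (S : Signature.{u}) where
  gens : S.Srt → Type u
  rels : Set (Atom S gens)

/-- The presentation presents the expanded structure `(M, a)` in the class `K` of structures. -/
structure Presentation.Presents {S : Signature.{u}} (P : Presentation S) (K : Str S → Prop)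
    (M : Str S) (a : ∀ s, P.gens s → M.carrier s) : Prop where
  mem : K M
  generated : M.GeneratedBy a
  rels : ∀ α ∈ P.rels, α.Realize M a
  desc : ∀ N : Str S, K N → ∀ b : ∀ s, P.gens s → N.carrier s,
    (∀ α ∈ P.rels, α.Realize N b) → ∃! h : M ⟶ N, ∀ s x, h.toFun s (a s x) = b s x

/-! ### Word-constructions -/

section Words
variable {S S' : Signature.{u}} (W : List S'.Srt → S.Srt → Type u)

/-- The signature that extends `S` with the sorts of `S'` and with new function symbols
`f : xs ⟶ s`, for `f ∈ W xs s`, from sorts of `S'` to sorts of `S`. -/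
def wordSig : Signature.{u} where
  Srt := S.Srt ⊕ S'.Srt
  Fn := S.Fn ⊕ (Σ (xs : List S'.Srt) (s : S.Srt), W xs s)
  dom := Sum.elim (fun f => (S.dom f).map Sum.inl) (fun f => f.1.map Sum.inr)
  cod := Sum.elim (fun f => Sum.inl (S.cod f)) (fun f => Sum.inl f.2.1)
  Rl := S.Rl
  ar R := (S.ar R).map Sum.inl

/-- A family of variables (or constants) all of whose sorts are sorts of `S'`. -/
def Fam (X : S'.Srt → Type u) : S.Srt ⊕ S'.Srt → Type u
  | .inl _ => PEmpty
  | .inr s => X s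

def Fam.map {X Y : S'.Srt → Type u} (h : ∀ s, X s → Y s) :
    ∀ k : S.Srt ⊕ S'.Srt, Fam X k → Fam Y k
  | .inl _, x => x
  | .inr s, x => h s x

/-- Terms of the extended signature over `X`, of a sort of `S`. For `X = Var xs` these are the terms
`x : xs ▹ t : s` with `xs` in the sorts of `S'`; for the family `X` of the carriers of a structure
`M` they are the expressions `t(a)` with `a ∈ M`. -/
abbrev Word (X : S'.Srt → Type u) (s : S.Srt) : Type u :=
  Term (wordSig W) (Fam X) (Sum.inl s)

namespace Word
variable {W} {X Y : S'.Srt → Type u}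

/-- Replacement of variables by variables or elements; for `a : Tuple M xs` this is `t ↦ t(a)`. -/
def map (h : ∀ s, X s → Y s) {s : S.Srt} (t : Word W X s) : Word W Y s :=
  Term.map (Fam.map h) t

/-- The word `f(a)`, for a new function symbol `f`. -/
def sym {xs : List S'.Srt} {s : S.Srt} (f : W xs s) (a : Tuple X xs) : Word W X s :=
  Term.app (S := wordSig W) (X := Fam X) (Sum.inr ⟨xs, s, f⟩)
    (Var.mapElim (P := fun k => Term (wordSig W) (Fam X) k)
      (fun s v => Term.var (S := wordSig W) (X := Fam X) (s := Sum.inr s) (a s v)))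

/-- The word obtained from a term of `S` by putting words in place of its variables. -/
def graft {Z : S.Srt → Type u} (w : ∀ s, Z s → Word W X s) : ∀ {s : S.Srt}, Term S Z s → Word W X s
  | _, .var z => w _ z
  | _, .app f ts => Term.app (S := wordSig W) (X := Fam X) (Sum.inl f)
      (Var.mapElim (P := fun k => Term (wordSig W) (Fam X) k) (fun s v => graft w (ts s v)))

end Word

/-- Expressions `f(a)` of sort `s`, with `f` a new function symbol and `a` a tuple from `X`. -/
structure Gen (X : S'.Srt → Type u) (s : S.Srt) where
  dom : List S'.Srt
  fn : W dom s
  args : Tuple X dom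

namespace Gen
variable {W} {X Y : S'.Srt → Type u}

def map (h : ∀ s, X s → Y s) {s : S.Srt} (g : Gen W X s) : Gen W Y s :=
  ⟨g.dom, g.fn, g.args.map h⟩

def toWord {s : S.Srt} (g : Gen W X s) : Word W X s := Word.sym g.fn g.args

end Gen

/-- The result of reading a term of the extended signature: a term of a sort of `S` is a term of `S`
with the expressions `f(a)` as its variables; a term of a sort of `S'` is a variable. -/
def Parsed (X : S'.Srt → Type u) : S.Srt ⊕ S'.Srt → Type u
  | .inl s => Term S (Gen W X) s
  | .inr s => X s

def parseVar {X : S'.Srt → Type u} : ∀ (k : S.Srt ⊕ S'.Srt), Fam X k → Parsed W X k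
  | .inl _, x => nomatch x
  | .inr _, x => x

def parseApp {X : S'.Srt → Type u} : ∀ (f : (wordSig W).Fn),
    (∀ k, Var ((wordSig W).dom f) k → Parsed W X k) → Parsed W X ((wordSig W).cod f)
  | .inl f, ts => Term.app f (fun s v => ts (Sum.inl s) (v.map Sum.inl))
  | .inr f, ts => Term.var ⟨f.1, f.2.2, fun s v => ts (Sum.inr s) (v.map Sum.inr)⟩

def parse {X : S'.Srt → Type u} : ∀ {k : S.Srt ⊕ S'.Srt}, Term (wordSig W) (Fam X) k → Parsed W X k
  | k, .var x => parseVar W k x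
  | _, .app f ts => parseApp W f (fun k v => parse (ts k v))

/-- Every word is, in a unique way, a term of `S` with expressions `f(a)` as its variables. -/
def Word.parse {W : List S'.Srt → S.Srt → Type u} {X : S'.Srt → Type u} {s : S.Srt} (t : Word W X s) : Term S (Gen W X) s :=
  CartLogic.parse W t

end Words

/-- A word-construction from `S'` to `S`: an extension of `S` by the sorts of `S'` and by new
function symbols `f : xs ⟶ s` from sorts of `S'` to a sort of `S`, a function `Te` from terms of the
extended signature to formulae of `S'`, and a function `At` from atomic formulae of `S` with entries
in the terms of the extended signature to formulae of `S'`. The contexts are in the sorts of `S'`. -/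
structure WordConstruction (S' S : Signature.{u}) where
  New : List S'.Srt → S.Srt → Type u
  Te : ∀ {xs : List S'.Srt} {s : S.Srt}, Word New (Var xs) s → LInf S' xs
  At : ∀ {xs : List S'.Srt}, AtomOver S (Word New (Var xs)) → LInf S' xs

/-- The presentation induced by a word-construction at a structure `M`: the generators are the
expressions `t(a)` with `M ⊨ Te(t)(a)`, the relations are the atomic formulae of the form `α(a)`
with `M ⊨ At(α)(a)`. -/
def WordConstruction.presentation {S S' : Signature.{u}} (W : WordConstruction S' S) (M : Str S') :
    Presentation S where
  gens s := {e : Word W.New M.carrier s // ∃ (xs : List S'.Srt) (t : Word W.New (Var xs) s)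
    (a : Tuple M.carrier xs), t.map a = e ∧ (W.Te t).Realize M a}
  rels := {β | ∃ (xs : List S'.Srt) (α : AtomOver S (Word W.New (Var xs)))
    (a : Tuple M.carrier xs), α.map (fun _ t => t.map a) =
      AtomOver.map (fun _ t => Word.graft (fun _ e => e.1) t) β ∧ (W.At α).Realize M a}

section WordFacts
variable {S S' : Signature.{u}} (W : List S'.Srt → S.Srt → Type u)

theorem parse_sym {X : S'.Srt → Type u} {s : S.Srt} (g : Gen W X s) :
    g.toWord.parse = Term.var g := by
  obtain ⟨xs, f, a⟩ := g
  refine congrArg (fun b => Term.var (⟨xs, f, b⟩ : Gen W X s)) ?_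
  funext s v
  have h := Var.mapElim_map (f := Sum.inr) (P := fun k => Term (wordSig W) (Fam X) k)
    (fun s v => Term.var (S := wordSig W) (X := Fam X) (s := Sum.inr s) (a s v)) v
  exact congrArg (parse W) h

def Parsed.map {X Y : S'.Srt → Type u} (h : ∀ s, X s → Y s) :
    ∀ k : S.Srt ⊕ S'.Srt, Parsed W X k → Parsed W Y k
  | .inl _, t => Term.map (fun _ g => g.map h) t
  | .inr _, x => h _ x

theorem parse_map {X Y : S'.Srt → Type u} (h : ∀ s, X s → Y s) : ∀ {k : S.Srt ⊕ S'.Srt}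
    (t : Term (wordSig W) (Fam X) k),
    parse W (Term.map (S := wordSig W) (Fam.map h) t) = Parsed.map W h k (parse W t)
  | k, .var x => by
    cases k with
    | inl s => exact nomatch x
    | inr s => rfl
  | _, .app f ts => by
    have e : parse W (Term.map (S := wordSig W) (Fam.map h) (.app f ts)) =
        parseApp W f (fun k v => Parsed.map W h k (parse W (ts k v))) :=
      congrArg (parseApp W f) (funext fun k => funext fun v => parse_map h (ts k v))
    rw [e]
    cases f <;> rfl

end WordFacts

/-! ### The word-construction of a functor between categories of models -/

section FunctorWords
variable {S S' : Signature.{u}} {T : CartTheory S} {T' : CartTheory S'} (F : T'.Mod ⥤ T.Mod)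

/-- The new function symbols `f^c_{⟨x | φ⟩} : xs ⟶ s`, for `φ` a formula in the context `xs` that is
cartesian over `T'` and `c ∈ (F ⟨x | φ⟩)(s)`. -/
structure NewSym (xs : List S'.Srt) (s : S.Srt) where
  fml : Reg S' xs
  cart : IsCartesian T'.seqs fml
  elt : (F.obj (FG ⟨xs, fml, cart⟩)).obj.carrier s

variable {F}

/-- The object `{x | φ}` of the syntactic category that belongs to `f^c_{⟨x | φ⟩}(a)`. -/
def Gen.obj {X : S'.Srt → Type u} {s : S.Srt} (g : Gen (NewSym F) X s) : Obj T' :=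
  ⟨g.dom, g.fn.fml, g.fn.cart⟩

/-- The element `c` that belongs to `f^c_{⟨x | φ⟩}(a)`. -/
noncomputable def Gen.elt {X : S'.Srt → Type u} {s : S.Srt} (g : Gen (NewSym F) X s) :
    (F.obj (FG g.obj)).obj.carrier s := g.fn.elt

/-- The element `(F h)(c)` of `F M`, where `h : ⟨x | φ⟩ ⟶ M`, and `g` is `f^c_{⟨x | φ⟩}(a)`. -/
noncomputable def Gen.value {X : S'.Srt → Type u} {s : S.Srt} (g : Gen (NewSym F) X s) {M : T'.Mod}
    (h : FG g.obj ⟶ M) : (F.obj M).obj.carrier s := (F.map h).hom.toFun s g.elt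

variable (F)

/-- `Te(f^c_{⟨x | φ⟩}(x)) = φ(x)`, and `Te(t) = ⊥` for all other terms. -/
noncomputable def teParsed {xs : List S'.Srt} {s : S.Srt} : Term S (Gen (NewSym F) (Var xs)) s → LInf S' xs
  | .var g => g.obj.fml.toLInf.rename g.args
  | .app _ _ => .bot

/-- For an atomic formula `α(g₁, …, gₙ)` with entries `gᵢ = f^{cᵢ}_{⟨xᵢ | φᵢ⟩}(xᵢ)`, the disjunction
over all objects `A = {x | φ}` of the syntactic category of `T'` and all morphisms
`θᵢ : {x | φ} ⟶ {xᵢ | φᵢ}` such that `F ⟨x | φ⟩ ⊨ α((F k₁)(c₁), …, (F kₙ)(cₙ))`, where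
`kᵢ : ⟨xᵢ | φᵢ⟩ ⟶ ⟨x | φ⟩` corresponds to `θᵢ`, of the formulae `∃ x (φ ∧ ⋀ᵢ θᵢ(x, xᵢ))`. The
`gᵢ` are the expressions that occur in the given formula. -/
noncomputable def atParsed {xs : List S'.Srt} (α : Atom S (Gen (NewSym F) (Var xs))) : LInf S' xs :=
  .disj (I := Obj T') fun A =>
    .disj (I := {θ : ∀ g : {g // g ∈ α.occ}, FunRel A g.1.2.obj //
        α.ownVars.Realize (F.obj (FG A)).obj
          (fun s g => g.1.value (FG.yonedaMap (θ ⟨⟨s, g.1⟩, g.2⟩)))}) fun θ =>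
      .exs A.ctx (.and (A.fml.toLInf.rename (fun _ v => Var.left _ v))
        (.conj (I := {g // g ∈ α.occ}) fun g => (θ.1 g).fml.toLInf.rename
          (Tuple.append (fun _ v => Var.right _ (g.1.2.args _ v)) (fun _ v => Var.left _ v))))

/-- The word-construction associated with the functor `F`. -/
noncomputable def wordConstruction : WordConstruction S' S where
  New := NewSym F
  Te t := teParsed F t.parse
  At β := atParsed F (β.map (fun _ t => t.parse))

variable {F}

theorem realize_te_iff {xs : List S'.Srt} {s : S.Srt} (g : Gen (NewSym F) (Var xs) s) (M : T'.Mod)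
    (a : Tuple M.obj.carrier xs) : ((wordConstruction F).Te g.toWord).Realize M.obj a ↔
      g.obj.fml.Realize M.obj (fun _ v => a _ (g.args _ v)) := by
  change (teParsed F g.toWord.parse).Realize M.obj a ↔ _
  rw [parse_sym]
  exact LInf.realize_rename _ _ _ _

/-- The term is `f^c_{⟨x | φ⟩}(a)` with `M ⊨ φ(a)`. -/
def IsGood (M : T'.Mod) {s : S.Srt} : Term S (Gen (NewSym F) M.obj.carrier) s → Prop
  | .var g => g.obj.fml.Realize M.obj g.args
  | .app _ _ => False

theorem isGood_map {M : T'.Mod} {xs : List S'.Srt} {s : S.Srt} (t : Word (NewSym F) (Var xs) s)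
    (a : Tuple M.obj.carrier xs) (ht : (teParsed F t.parse).Realize M.obj a) :
    IsGood M (Word.parse (t.map a)) := by
  have h : Word.parse (t.map a) = Term.map (fun _ g => g.map a) t.parse := parse_map (NewSym F) a t
  rw [h]
  generalize t.parse = p at ht
  cases p with
  | var g =>
    have := (LInf.realize_rename M.obj g.obj.fml.toLInf g.args a).mp ht
    exact this
  | app f ts =>
    obtain ⟨i, _⟩ := ht
    exact nomatch i

theorem isGood_parse {M : T'.Mod} {s : S.Srt}
    (e : ((wordConstruction F).presentation M.obj).gens s) : IsGood M (Word.parse e.1) := by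
  obtain ⟨e, xs, t, a, h, ht⟩ := e
  cases h
  exact isGood_map t a ht

noncomputable def valuationAux (M : T'.Mod) {s : S.Srt} :
    (t : Term S (Gen (NewSym F) M.obj.carrier) s) → IsGood M t → (F.obj M).obj.carrier s
  | .var g, h => g.value (FG.lift g.obj M g.args h)
  | .app _ _, h => False.elim h

variable (F)

/-- The valuation `C` of the generators in `F M`: the expression `f^c_{⟨x | φ⟩}(a)`, for
`a ∈ ⟦φ⟧_M`, is sent to `(F h_a)(c)`, where `h_a : ⟨x | φ⟩ ⟶ M` takes `x` to `a`. -/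
noncomputable def valuation (M : T'.Mod) (s : S.Srt)
    (e : ((wordConstruction F).presentation M.obj).gens s) : (F.obj M).obj.carrier s :=
  valuationAux M (Word.parse e.1) (isGood_parse e)

/-! ### The formula translation -/

/-- The translation `ψ(f)^W` of `ψ(y₁, …, yₙ)`, where `fᵢ = f^{cᵢ}_{⟨xᵢ | φᵢ⟩}(xᵢ)` is put in place
of `yᵢ`; the `xᵢ` are tuples of variables from a context `xs` in the sorts of `S'`. -/
noncomputable def translate : ∀ {ys : List S.Srt}, LInf S ys → ∀ {xs : List S'.Srt},
    (∀ s, Var ys s → Gen (NewSym F) (Var xs) s) → LInf S' xs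
  | _, .atom α, _, f =>
    (wordConstruction F).At (α.map (fun _ t => Word.graft (fun s v => (f s v).toWord) t))
  | _, .neg ψ, _, f => .neg (translate ψ f)
  | _, .conj ψ, _, f => .conj (fun i => translate (ψ i) f)
  | _, .disj ψ, _, f => .disj (fun i => translate (ψ i) f)
  | _, .ex s ψ, _, f =>
    .disj (I := Obj T') fun A => .disj (I := (F.obj (FG A)).obj.carrier s) fun c =>
      .exs A.ctx (.and (A.fml.toLInf.rename (fun _ v => Var.left _ v))
        (translate ψ (Tuple.cons ⟨A.ctx, ⟨A.fml, A.cart, c⟩, fun _ v => Var.left _ v⟩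
          (fun s v => (f s v).map (fun _ w => Var.right _ w)))))
  | _, .all s ψ, _, f =>
    .conj (I := Obj T') fun A => .conj (I := (F.obj (FG A)).obj.carrier s) fun c =>
      .alls A.ctx (.imp (A.fml.toLInf.rename (fun _ v => Var.left _ v))
        (translate ψ (Tuple.cons ⟨A.ctx, ⟨A.fml, A.cart, c⟩, fun _ v => Var.left _ v⟩
          (fun s v => (f s v).map (fun _ w => Var.right _ w)))))

end FunctorWords

end CartLogic

open CartLogic

/-!
The proof rests on three facts.

*Every model `M` of `T'` is a filtered colimit of the models `⟨x | φ⟩`* (`Point.isColimit`). The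
index category consists of the tuples `a ∈ ⟦φ⟧_M`, with the homomorphisms over `M` between the
representing models. It is filtered because the syntactic category has finite products and, for two
elements `p`, `q` of `⟨x | φ⟩`, the formula `φ ∧ ∃ y (p(x, y) ∧ q(x, y))` is
again cartesian. As `F` preserves this colimit, `F M` is the filtered colimit of the models `F ⟨x | φ⟩`.

*Filtered colimits of models are computed on the underlying structures* (`FilteredColim.model`).
Hence every element of the colimit comes from some stage (`FilteredColim.exists_rep`), and an atomic
formula that is true in the colimit is true at some stage (`FilteredColim.exists_realize`). In
particular, every element of `F M` is a value `(F h_a)(c)`.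

*The Yoneda embedding is full* (`FG.exists_yonedaMap_eq`), and `θ(x, y)` holds of tuples of `M`
exactly when the homomorphism that names `y` factors through the one that names `x` by means of `θ`
(`FG.yonedaMap_comp_lift`). So the formula `At(β)` expresses that `β` becomes true at a stage of the
colimit to which all expressions in `β` have been transported.

Together they give the central equivalence `realize_atParsed_iff`: `M ⊨ At(β)(a)` if and only if the
expressions in `β(a)` have values in `F M` and `β` is true of these values. Thus the relations of
`W(M)` are the atomic formulae over the generators, in a common context, that are true in `F M`. A
valuation in `N` that satisfies them restricts to a homomorphism on each `F ⟨x | φ⟩` (`leg`), these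
are compatible, and the colimit property yields the homomorphism on `F M`. The statement on the
translation follows by induction on the formula: the atomic case is the central equivalence, and the
quantifiers are correct because every element of `F M` is a value.

The expressions `f^c_{⟨x | φ⟩}(a)` have values only when `a ∈ ⟦φ⟧_M`. Truth under such a partial
valuation is expressed by `Atom.RelRealize`, in which a valuation is a relation.
-/

namespace CartLogic

/-! ### Relational valuations -/

theorem Var.finite {I : Type u} : ∀ Γ : List I, Finite (Σ s, Var Γ s)
  | [] => by
    have : IsEmpty (Σ s, Var ([] : List I) s) := ⟨fun p => nomatch p.2⟩
    infer_instance
  | t :: Γ => by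
    have := Var.finite Γ
    refine Finite.of_surjective (fun o : Option (Σ s, Var Γ s) =>
      (o.elim ⟨t, .zero⟩ fun p => ⟨p.1, p.2.succ⟩ : Σ s, Var (t :: Γ) s)) ?_
    rintro ⟨s, v⟩
    cases v with
    | zero => exact ⟨none, rfl⟩
    | succ v => exact ⟨some ⟨s, v⟩, rfl⟩

section Relational
variable {S : Signature.{u}} {X Y : S.Srt → Type u} {M N : Str S}

theorem Term.occ_finite {s : S.Srt} (t : Term S X s) : t.occ.Finite := by
  induction t with
  | var x => exact Set.finite_singleton _
  | app f ts ih =>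
    have := Var.finite (S.dom f)
    refine (Set.finite_iUnion fun p : Σ s, Var (S.dom f) s => ih p.1 p.2).subset ?_
    rintro p ⟨s, v, h⟩
    exact Set.mem_iUnion.mpr ⟨⟨s, v⟩, h⟩

theorem Atom.occ_finite (α : Atom S X) : (Atom.occ α).Finite := by
  cases α with
  | eq t t' => exact t.occ_finite.union t'.occ_finite
  | rel R ts =>
    have := Var.finite (S.ar R)
    refine (Set.finite_iUnion fun p : Σ s, Var (S.ar R) s => (ts p.1 p.2).occ_finite).subset ?_
    rintro p ⟨s, v, h⟩
    exact Set.mem_iUnion.mpr ⟨⟨s, v⟩, h⟩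

/-- The term `t` takes the value `n` when its variables take values according to the relation `V`,
which may leave some of them without a value. -/
def Term.EvalsTo (M : Str S) (V : ∀ s, X s → M.carrier s → Prop) :
    ∀ {s : S.Srt}, Term S X s → M.carrier s → Prop
  | _, .var x, n => V _ x n
  | _, .app f ts, n => ∃ ns : Tuple M.carrier (S.dom f),
      (∀ s v, (ts s v).EvalsTo M V (ns s v)) ∧ n = M.fn f ns

/-- The entries of the atomic formula have values, in the sense of `Term.EvalsTo`, for which it
holds in `M`. -/
def Atom.RelRealize (M : Str S) (V : ∀ s, X s → M.carrier s → Prop) : Atom S X → Prop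
  | .eq t t' => ∃ n, t.EvalsTo M V n ∧ t'.EvalsTo M V n
  | .rel R ts => ∃ ns : Tuple M.carrier (S.ar R), (∀ s v, (ts s v).EvalsTo M V (ns s v)) ∧ M.rl R ns

theorem Term.evalsTo_bind (V : ∀ s, Y s → M.carrier s → Prop) (σ : ∀ s, X s → Term S Y s)
    {s : S.Srt} (t : Term S X s) : ∀ n, (t.bind σ).EvalsTo M V n ↔
      t.EvalsTo M (fun s x => (σ s x).EvalsTo M V) n := by
  induction t with
  | var x => exact fun n => Iff.rfl
  | app f ts ih => intro n; simp only [bind, EvalsTo, ih]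

theorem Atom.relRealize_bind (V : ∀ s, Y s → M.carrier s → Prop) (σ : ∀ s, X s → Term S Y s)
    (α : Atom S X) : Atom.RelRealize M V (AtomOver.map (fun _ t => t.bind σ) α) ↔
      α.RelRealize M (fun s x => (σ s x).EvalsTo M V) := by
  cases α <;> simp only [AtomOver.map, RelRealize, Term.evalsTo_bind]

theorem Atom.relRealize_map (V : ∀ s, Y s → M.carrier s → Prop) (r : ∀ s, X s → Y s)
    (α : Atom S X) : Atom.RelRealize M V (AtomOver.map (fun _ t => t.map r) α) ↔
      α.RelRealize M (fun s x => V s (r s x)) := Atom.relRealize_bind V _ α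

theorem Atom.realize_map (r : ∀ s, X s → Y s) (a : ∀ s, Y s → M.carrier s) (α : Atom S X) :
    Atom.Realize M a (AtomOver.map (fun _ t => t.map r) α) ↔
      α.Realize M (fun s x => a s (r s x)) := by
  cases α <;> simp only [AtomOver.map, Realize, AtomOver.Holds, Term.map, Term.eval_bind, Term.eval]

theorem Term.evalsTo_restrict (Q : Set (Σ s, X s))
    (a : ∀ s, {x : X s // (⟨s, x⟩ : Σ s, X s) ∈ Q} → M.carrier s) {s : S.Srt} (t : Term S X s) :
    ∀ (h : t.occ ⊆ Q) (n : M.carrier s),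
      t.EvalsTo M (fun s x n => ∃ h : (⟨s, x⟩ : Σ s, X s) ∈ Q, n = a s ⟨x, h⟩) n ↔
        n = (t.restrict Q h).eval M a := by
  induction t with
  | @var s x =>
    intro h n
    change (∃ h : (⟨s, x⟩ : Σ s, X s) ∈ Q, n = a s ⟨x, h⟩) ↔ n = a s ⟨x, h rfl⟩
    exact ⟨fun ⟨_, e⟩ => e, fun e => ⟨_, e⟩⟩
  | app f ts ih =>
    intro h n
    constructor
    · rintro ⟨ns, h1, rfl⟩
      exact congrArg (M.fn f) (funext fun s => funext fun v => (ih s v _ _).mp (h1 s v))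
    · rintro rfl
      exact ⟨_, fun s v => (ih s v _ _).mpr rfl, rfl⟩

/-- For a partial valuation of the occurring variables, `RelRealize` is truth of `ownVars`. -/
theorem Atom.relRealize_ownVars (α : Atom S X)
    (a : ∀ s, {x : X s // (⟨s, x⟩ : Σ s, X s) ∈ α.occ} → M.carrier s) :
    α.RelRealize M (fun s x n => ∃ h : (⟨s, x⟩ : Σ s, X s) ∈ α.occ, n = a s ⟨x, h⟩) ↔
      α.ownVars.Realize M a := by
  cases α with
  | eq t t' =>
    constructor
    · rintro ⟨n, h, h'⟩
      exact ((Term.evalsTo_restrict _ a t _ _).mp h).symm.trans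
        ((Term.evalsTo_restrict _ a t' _ _).mp h')
    · intro h
      exact ⟨_, (Term.evalsTo_restrict _ a t (fun _ h => Or.inl h) _).mpr rfl,
        (Term.evalsTo_restrict _ a t' (fun _ h => Or.inr h) _).mpr h⟩
  | rel R ts =>
    constructor
    · rintro ⟨ns, h, hR⟩
      have e : ns = fun s v =>
          ((ts s v).restrict (Atom.occ (.rel R ts)) (fun _ h => ⟨s, v, h⟩)).eval M a :=
        funext fun s => funext fun v => (Term.evalsTo_restrict _ a (ts s v) _ _).mp (h s v)
      rw [e] at hR
      exact hR
    · intro h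
      exact ⟨_, fun s v => (Term.evalsTo_restrict _ a (ts s v) (fun _ h => ⟨s, v, h⟩) _).mpr rfl, h⟩

theorem Term.evalsTo_eq (a : ∀ s, X s → M.carrier s) {s : S.Srt} (t : Term S X s) :
    ∀ n, t.EvalsTo M (fun s x n => n = a s x) n ↔ n = t.eval M a := by
  induction t with
  | var x => exact fun _ => Iff.rfl
  | app f ts ih =>
    intro n
    constructor
    · rintro ⟨ns, h1, rfl⟩
      exact congrArg (M.fn f) (funext fun s => funext fun v => (ih s v _).mp (h1 s v))
    · rintro rfl
      exact ⟨_, fun s v => (ih s v _).mpr rfl, rfl⟩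

/-- For a total valuation, `RelRealize` is truth in the ordinary sense. -/
theorem Atom.relRealize_eq (a : ∀ s, X s → M.carrier s) (α : Atom S X) :
    α.RelRealize M (fun s x n => n = a s x) ↔ α.Realize M a := by
  cases α with
  | eq t t' =>
    simp only [RelRealize, Term.evalsTo_eq, exists_eq_left]
    exact Iff.rfl
  | rel R ts =>
    simp only [RelRealize, Term.evalsTo_eq]
    constructor
    · rintro ⟨ns, h, hR⟩
      have e : ns = fun s v => (ts s v).eval M a := funext fun s => funext fun v => h s v
      rw [e] at hR
      exact hR
    · exact fun h => ⟨_, fun _ _ => rfl, h⟩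

theorem Term.EvalsTo.hom {V : ∀ s, X s → M.carrier s → Prop} {V' : ∀ s, X s → N.carrier s → Prop}
    (h : M ⟶ N) {s : S.Srt} {t : Term S X s} :
    (∀ s x, (⟨s, x⟩ : Σ s, X s) ∈ t.occ → ∀ n, V s x n → V' s x (h.toFun s n)) →
    ∀ {n}, t.EvalsTo M V n → t.EvalsTo N V' (h.toFun s n) := by
  induction t with
  | var x => exact fun hV n hn => hV _ _ rfl n hn
  | app f ts ih =>
    rintro hV n ⟨ns, h1, rfl⟩
    exact ⟨ns.map h.toFun, fun s v => ih s v (fun s' x hx => hV s' x ⟨s, v, hx⟩) (h1 s v),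
      h.map_fn f ns⟩

theorem Atom.RelRealize.hom {V : ∀ s, X s → M.carrier s → Prop}
    {V' : ∀ s, X s → N.carrier s → Prop} (h : M ⟶ N) {α : Atom S X}
    (hV : ∀ s x, (⟨s, x⟩ : Σ s, X s) ∈ α.occ → ∀ n, V s x n → V' s x (h.toFun s n))
    (H : α.RelRealize M V) : α.RelRealize N V' := by
  cases α with
  | eq t t' =>
    obtain ⟨n, h1, h2⟩ := H
    exact ⟨_, h1.hom h (fun s x hx => hV s x (Or.inl hx)),
      h2.hom h (fun s x hx => hV s x (Or.inr hx))⟩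
  | rel R ts =>
    obtain ⟨ns, h1, hR⟩ := H
    exact ⟨ns.map h.toFun, fun s v => (h1 s v).hom h (fun s' x hx => hV s' x ⟨s, v, hx⟩),
      h.map_rl R ns hR⟩

theorem Atom.RelRealize.mono {V V' : ∀ s, X s → M.carrier s → Prop} {α : Atom S X}
    (hV : ∀ s x, (⟨s, x⟩ : Σ s, X s) ∈ α.occ → ∀ n, V s x n → V' s x n)
    (H : α.RelRealize M V) : α.RelRealize M V' := H.hom (𝟙 M) hV

/-- A term that takes a value has values for all the variables that occur in it. -/
theorem Term.EvalsTo.exists_of_occ {V : ∀ s, X s → M.carrier s → Prop} {s : S.Srt}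
    {t : Term S X s} : ∀ {n}, t.EvalsTo M V n → ∀ p ∈ t.occ, ∃ m, V p.1 p.2 m := by
  induction t with
  | var x => rintro n h p rfl; exact ⟨n, h⟩
  | app f ts ih => rintro n ⟨ns, h, _⟩ p ⟨s, v, hp⟩; exact ih s v (h s v) p hp

theorem Atom.RelRealize.exists_of_occ {V : ∀ s, X s → M.carrier s → Prop} {α : Atom S X}
    (H : α.RelRealize M V) : ∀ p ∈ α.occ, ∃ m, V p.1 p.2 m := by
  cases α with
  | eq t t' =>
    obtain ⟨n, h, h'⟩ := H
    rintro p (hp | hp)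
    exacts [h.exists_of_occ p hp, h'.exists_of_occ p hp]
  | rel R ts =>
    obtain ⟨ns, h, _⟩ := H
    rintro p ⟨s, v, hp⟩
    exact (h s v).exists_of_occ p hp

end Relational

namespace LInf
variable {S : Signature.{u}} (M : Str S)

theorem realize_exs : ∀ (Δ : List S.Srt) {Γ : List S.Srt} (φ : LInf S (Δ ++ Γ))
    (a : Tuple M.carrier Γ), (exs Δ φ).Realize M a ↔ ∃ b, φ.Realize M (Tuple.append b a)
  | [], _, φ, a => ⟨fun h => ⟨Tuple.nil, h⟩, fun ⟨_, h⟩ => h⟩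
  | s :: Δ, _, φ, a => by
    rw [exs, realize_exs Δ]
    constructor
    · rintro ⟨b, x, h⟩; exact ⟨Tuple.cons x b, h⟩
    · rintro ⟨b, h⟩; exact ⟨b.tail, b _ .zero, h⟩

theorem realize_alls : ∀ (Δ : List S.Srt) {Γ : List S.Srt} (φ : LInf S (Δ ++ Γ))
    (a : Tuple M.carrier Γ), (alls Δ φ).Realize M a ↔ ∀ b, φ.Realize M (Tuple.append b a)
  | [], _, φ, a => ⟨fun h _ => h, fun h => h Tuple.nil⟩
  | s :: Δ, _, φ, a => by
    rw [alls, realize_alls Δ]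
    exact ⟨fun h b => h b.tail (b _ .zero), fun h b x => h (Tuple.cons x b)⟩

theorem realize_imp {Γ : List S.Srt} (φ ψ : LInf S Γ) (a : Tuple M.carrier Γ) :
    (φ.imp ψ).Realize M a ↔ (φ.Realize M a → ψ.Realize M a) := by
  rw [imp_iff_not_or]
  constructor
  · rintro ⟨⟨i⟩, h⟩
    cases i
    · exact Or.inr h
    · exact Or.inl h
  · rintro (h | h)
    · exact ⟨⟨true⟩, h⟩
    · exact ⟨⟨false⟩, h⟩

end LInf

/-! ### Words -/

/-- Functions on the variables of `Γ.map f` that are given by `Var.mapElim` commute with maps of the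
values. -/
theorem Var.mapElim_comp {I J : Type u} {f : I → J} {P Q : J → Type u} (G : ∀ j, P j → Q j) :
    ∀ {Γ : List I} (h : ∀ i, Var Γ i → P (f i)) (j : J) (v : Var (Γ.map f) j),
      G j (mapElim h j v) = mapElim (fun i w => G _ (h i w)) j v
  | _ :: _, _, _, .zero => rfl
  | _ :: _, h, _, .succ v => mapElim_comp G (fun i w => h i (.succ w)) _ v

section WordLemmas
variable {S S' : Signature.{u}} {W : List S'.Srt → S.Srt → Type u} {X Y : S'.Srt → Type u}
  {Z Z' : S.Srt → Type u}

theorem Gen.toWord_map (h : ∀ s, X s → Y s) {s : S.Srt} (g : Gen W X s) :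
    g.toWord.map h = (g.map h).toWord :=
  congrArg (Term.app (S := wordSig W) (X := Fam Y) (Sum.inr ⟨g.dom, s, g.fn⟩))
    (funext fun k => funext fun v =>
      Var.mapElim_comp (P := fun k => Term (wordSig W) (Fam X) k)
        (Q := fun k => Term (wordSig W) (Fam Y) k)
        (fun _ t => Term.map (S := wordSig W) (Fam.map h) t) _ k v)

theorem Word.parse_map (h : ∀ s, X s → Y s) {s : S.Srt} (t : Word W X s) :
    (t.map h).parse = Term.map (fun _ g => g.map h) t.parse := CartLogic.parse_map W h t

/-- Reading a grafted word returns the term, with the readings of the grafted words in place of its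
variables. -/
theorem Word.parse_graft (w : ∀ s, Z s → Word W X s) {s : S.Srt} (t : Term S Z s) :
    (Word.graft w t).parse = t.bind (fun s z => (w s z).parse) := by
  induction t with
  | var z => rfl
  | app f ts ih =>
    refine congrArg (Term.app f) (funext fun s => funext fun v => ?_)
    have h := Var.mapElim_map (f := Sum.inl) (P := fun k => Term (wordSig W) (Fam X) k)
      (fun s v => Word.graft w (ts s v)) v
    exact (congrArg (CartLogic.parse W) h).trans (ih s v)

theorem Word.map_graft (w : ∀ s, Z s → Word W X s) (h : ∀ s, X s → Y s) {s : S.Srt}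
    (t : Term S Z s) : (Word.graft w t).map h = Word.graft (fun s z => (w s z).map h) t := by
  induction t with
  | var z => rfl
  | app f ts ih =>
    refine congrArg (Term.app (S := wordSig W) (X := Fam Y) (Sum.inl f))
      (funext fun k => funext fun v => ?_)
    refine (Var.mapElim_comp (P := fun k => Term (wordSig W) (Fam X) k)
        (Q := fun k => Term (wordSig W) (Fam Y) k)
        (fun _ t => Term.map (S := wordSig W) (Fam.map h) t) _ k v).trans ?_
    congr 1
    funext s v
    exact ih s v

theorem Word.graft_map (r : ∀ s, Z s → Z' s) (w : ∀ s, Z' s → Word W X s) {s : S.Srt}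
    (t : Term S Z s) : Word.graft w (t.map r) = Word.graft (fun s z => w s (r s z)) t := by
  induction t with
  | var z => rfl
  | app f ts ih =>
    refine congrArg (fun b => Term.app (S := wordSig W) (X := Fam X) (Sum.inl f)
      (Var.mapElim (P := fun k => Term (wordSig W) (Fam X) k) b)) ?_
    funext s v
    exact ih s v

theorem AtomOver.parse_map (h : ∀ s, X s → Y s) (α : AtomOver S (Word W X)) :
    (α.map fun _ t => t.map h).map (fun _ t => Word.parse t) =
      (α.map fun _ t => t.parse).map fun _ t => Term.map (fun _ g => Gen.map h g) t := by
  cases α <;> simp only [AtomOver.map, Word.parse_map]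

theorem AtomOver.parse_graft (w : ∀ s, Z s → Word W X s) (α : Atom S Z) :
    AtomOver.map (fun _ t => Word.parse t) (AtomOver.map (fun _ t => Word.graft w t) α) =
      AtomOver.map (fun _ t => t.bind fun s z => (w s z).parse) α := by
  cases α <;> simp only [AtomOver.map, Word.parse_graft]

theorem AtomOver.map_graft (w : ∀ s, Z s → Word W X s) (h : ∀ s, X s → Y s) (α : Atom S Z) :
    AtomOver.map (fun _ t => Word.map h t) (AtomOver.map (fun _ t => Word.graft w t) α) =
      AtomOver.map (fun _ t => Word.graft (fun s z => (w s z).map h) t) α := by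
  cases α <;> simp only [AtomOver.map, Word.map_graft]

theorem AtomOver.graft_map (r : ∀ s, Z s → Z' s) (w : ∀ s, Z' s → Word W X s) (α : Atom S Z) :
    AtomOver.map (fun _ t => Word.graft w t) (AtomOver.map (fun _ t => Term.map r t) α) =
      AtomOver.map (fun _ t => Word.graft (fun s z => w s (r s z)) t) α := by
  cases α <;> simp only [AtomOver.map, Word.graft_map]

end WordLemmas

/-! ### Filtered colimits of models -/

namespace FilteredColim
variable {S : Signature.{u}} {T : CartTheory S} {J : Type u} [SmallCategory J]
  (D : J ⥤ T.Mod)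

/-- The transition maps of a diagram of models. -/
def act {i j : J} (u : i ⟶ j) (s : S.Srt) (x : (D.obj i).obj.carrier s) :
    (D.obj j).obj.carrier s := (D.map u).hom.toFun s x

theorem act_comp {i j k : J} (u : i ⟶ j) (v : j ⟶ k) (s : S.Srt) (x : (D.obj i).obj.carrier s) :
    act D (u ≫ v) s x = act D v s (act D u s x) := by
  unfold act
  rw [D.map_comp]
  rfl

theorem act_id {i : J} (s : S.Srt) (x : (D.obj i).obj.carrier s) : act D (𝟙 i) s x = x := by
  unfold act
  rw [D.map_id]
  rfl

theorem act_eval {i j : J} (u : i ⟶ j) {X : S.Srt → Type u} (a : ∀ s, X s → (D.obj i).obj.carrier s)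
    {s : S.Srt} (t : Term S X s) :
    act D u s (t.eval _ a) = t.eval _ (fun s x => act D u s (a s x)) :=
  Term.eval_hom (D.map u).hom a t

theorem realize_act {i j : J} (u : i ⟶ j) {Γ : List S.Srt} (φ : Reg S Γ)
    {a : Tuple (D.obj i).obj.carrier Γ} (h : φ.Realize _ a) :
    φ.Realize (D.obj j).obj (fun s x => act D u s (a s x)) :=
  Reg.realize_hom (D.map u).hom φ a h

theorem ι_eval {c : Cocone D} {j : J} {X : S.Srt → Type u}
    (a : ∀ s, X s → (D.obj j).obj.carrier s) {s : S.Srt} (t : Term S X s) :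
    t.eval c.pt.obj (fun s x => (c.ι.app j).hom.toFun s (a s x)) =
      (c.ι.app j).hom.toFun s (t.eval _ a) := (Term.eval_hom (c.ι.app j).hom a t).symm

variable [IsFiltered J]

/-- Elements of the stages are identified when they become equal at a later stage. -/
def setoid (s : S.Srt) : Setoid (Σ j, (D.obj j).obj.carrier s) where
  r p q := ∃ (k : J) (u : p.1 ⟶ k) (v : q.1 ⟶ k), act D u s p.2 = act D v s q.2
  iseqv := by
    refine ⟨fun p => ⟨p.1, 𝟙 _, 𝟙 _, rfl⟩, fun ⟨k, u, v, h⟩ => ⟨k, v, u, h.symm⟩, ?_⟩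
    rintro p q r ⟨k, u, v, h⟩ ⟨l, u', v', h'⟩
    obtain ⟨m, w, w', e⟩ := IsFiltered.span v u'
    refine ⟨m, u ≫ w, v' ≫ w', ?_⟩
    rw [act_comp, act_comp, h, ← h', ← act_comp, ← act_comp, e]

/-- The carriers of the filtered colimit. -/
abbrev carrier (s : S.Srt) : Type u := Quotient (setoid D s)

/-- The class of an element of a stage in the filtered colimit. -/
def mk {j : J} {s : S.Srt} (x : (D.obj j).obj.carrier s) : carrier D s := Quotient.mk _ ⟨j, x⟩

theorem mk_act {i j : J} (u : i ⟶ j) {s : S.Srt} (x : (D.obj i).obj.carrier s) :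
    mk D (act D u s x) = mk D x :=
  Quotient.sound ⟨j, 𝟙 j, u, by rw [act_id]⟩

theorem exists_mk {s : S.Srt} (x : carrier D s) : ∃ (j : J) (y : (D.obj j).obj.carrier s),
    mk D y = x := by
  obtain ⟨⟨j, y⟩, rfl⟩ := Quotient.exists_rep x
  exact ⟨j, y, rfl⟩

theorem exists_of_mk_eq {i j : J} {s : S.Srt} {x : (D.obj i).obj.carrier s}
    {y : (D.obj j).obj.carrier s} (h : mk D x = mk D y) :
    ∃ (k : J) (u : i ⟶ k) (v : j ⟶ k), act D u s x = act D v s y := Quotient.exact h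

theorem exists_act_eq {j : J} {s : S.Srt} {x y : (D.obj j).obj.carrier s} (h : mk D x = mk D y) :
    ∃ (k : J) (u : j ⟶ k), act D u s x = act D u s y := by
  obtain ⟨k, u, v, h⟩ := exists_of_mk_eq D h
  refine ⟨_, u ≫ IsFiltered.coeqHom u v, ?_⟩
  rw [act_comp, h, ← act_comp, IsFiltered.coeq_condition]

/-- A finite tuple of elements of the filtered colimit comes from a single stage. -/
theorem exists_tuple : ∀ {Γ : List S.Srt} (a : Tuple (carrier D) Γ),
    ∃ (j : J) (b : Tuple (D.obj j).obj.carrier Γ), (fun s v => mk D (b s v)) = a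
  | [], _ => ⟨Classical.choice (IsFiltered.nonempty (C := J)), Tuple.nil,
      funext fun _ => funext fun v => nomatch v⟩
  | t :: Γ, a => by
    obtain ⟨j, b, hb⟩ := exists_tuple a.tail
    obtain ⟨i, x, hx⟩ := exists_mk D (a t .zero)
    refine ⟨IsFiltered.max i j, Tuple.cons (act D (IsFiltered.leftToMax i j) t x)
      (fun s v => act D (IsFiltered.rightToMax i j) s (b s v)), Tuple.cons_ext ?_ (fun s v => ?_)⟩
    · exact (mk_act D _ x).trans hx
    · exact (mk_act D _ _).trans (congrFun (congrFun hb s) v)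

theorem exists_tuple_eq : ∀ {Γ : List S.Srt} {j : J} {a b : Tuple (D.obj j).obj.carrier Γ},
    (∀ s v, mk D (a s v) = mk D (b s v)) → ∃ (k : J) (u : j ⟶ k),
      (fun s v => act D u s (a s v)) = fun s v => act D u s (b s v)
  | [], j, _, _, _ => ⟨j, 𝟙 j, funext fun _ => funext fun v => nomatch v⟩
  | t :: Γ, j, a, b, h => by
    obtain ⟨k, u, hu⟩ := exists_tuple_eq (a := a.tail) (b := b.tail) (fun s v => h s v.succ)
    have h0 : mk D (act D u t (a t .zero)) = mk D (act D u t (b t .zero)) := by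
      rw [mk_act, mk_act]
      exact h t .zero
    obtain ⟨l, v, hv⟩ := exists_act_eq D h0
    refine ⟨l, u ≫ v, Tuple.cons_ext ?_ (fun s w => ?_)⟩
    · rw [act_comp, act_comp, hv]
    · rw [act_comp, act_comp]
      exact congrArg (act D v s) (congrFun (congrFun hu s) w)

theorem exists_tuple_eq₂ {Γ : List S.Srt} {i j : J} {a : Tuple (D.obj i).obj.carrier Γ}
    {b : Tuple (D.obj j).obj.carrier Γ}
    (h : (fun s v => mk D (a s v)) = fun s v => mk D (b s v)) :
    ∃ (k : J) (u : i ⟶ k) (v : j ⟶ k),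
      (fun s w => act D u s (a s w)) = fun s w => act D v s (b s w) := by
  obtain ⟨k, u, hu⟩ := exists_tuple_eq D
    (a := fun s w => act D (IsFiltered.leftToMax i j) s (a s w))
    (b := fun s w => act D (IsFiltered.rightToMax i j) s (b s w)) (fun s w => by
      rw [mk_act, mk_act]
      exact congrFun (congrFun h s) w)
  refine ⟨k, IsFiltered.leftToMax i j ≫ u, IsFiltered.rightToMax i j ≫ u, ?_⟩
  simp only [act_comp]
  exact hu

/-- The filtered colimit of the diagram of structures: functions are computed on representatives
at a common stage, and a relation holds if it holds at some stage. -/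
noncomputable abbrev str : Str S where
  carrier := carrier D
  fn f a := mk D ((D.obj (exists_tuple D a).choose).obj.fn f (exists_tuple D a).choose_spec.choose)
  rl R a := ∃ (j : J) (b : Tuple (D.obj j).obj.carrier (S.ar R)),
    (fun s v => mk D (b s v)) = a ∧ (D.obj j).obj.rl R b

theorem mk_fn {j : J} (f : S.Fn) (b : Tuple (D.obj j).obj.carrier (S.dom f)) :
    mk D ((D.obj j).obj.fn f b) = (str D).fn f (fun s v => mk D (b s v)) := by
  let a : Tuple (carrier D) (S.dom f) := fun s v => mk D (b s v)
  obtain ⟨k, u, v, h⟩ := exists_tuple_eq₂ D (exists_tuple D a).choose_spec.choose_spec.symm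
  change mk D _ = mk D ((D.obj (exists_tuple D a).choose).obj.fn f _)
  rw [← mk_act D u, ← mk_act D v]
  exact congrArg (mk D) (((D.map u).hom.map_fn f b).trans
    ((congrArg ((D.obj k).obj.fn f) h).trans ((D.map v).hom.map_fn f _).symm))

theorem mk_eval {j : J} {X : S.Srt → Type u} (a : ∀ s, X s → (D.obj j).obj.carrier s)
    {s : S.Srt} (t : Term S X s) :
    t.eval (str D) (fun s x => mk D (a s x)) = mk D (t.eval _ a) := by
  induction t with
  | var x => rfl
  | app f ts ih =>
    refine Eq.trans ?_ (mk_fn D f _).symm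
    exact congrArg ((str D).fn f) (funext fun s => funext fun v => ih s v)

theorem exists_rl {j : J} (R : S.Rl) {a : Tuple (D.obj j).obj.carrier (S.ar R)}
    (h : (str D).rl R (fun s v => mk D (a s v))) :
    ∃ (k : J) (u : j ⟶ k), (D.obj k).obj.rl R (fun s v => act D u s (a s v)) := by
  obtain ⟨i, b, hb, hR⟩ := h
  obtain ⟨k, u, v, e⟩ := exists_tuple_eq₂ D hb
  refine ⟨k, v, ?_⟩
  rw [← e]
  exact (D.map u).hom.map_rl R b hR

/-- Regular formulae are true in the filtered colimit if and only if they are true at some later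
stage. As a consequence, the models of sequents of such formulae are closed under filtered
colimits. -/
theorem realize_iff {Γ : List S.Srt} (φ : Reg S Γ) : ∀ {j : J} (a : Tuple (D.obj j).obj.carrier Γ),
    φ.Realize (str D) (fun s v => mk D (a s v)) ↔
      ∃ (k : J) (u : j ⟶ k), φ.Realize (D.obj k).obj (fun s v => act D u s (a s v)) := by
  induction φ with
  | @atom Γ α =>
    intro j a
    cases α with
    | eq t t' =>
      have h : (Reg.eq t t').Realize (str D) (fun s v => mk D (a s v)) ↔
          mk D (t.eval (D.obj j).obj a) = mk D (t'.eval (D.obj j).obj a) := by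
        rw [Reg.realize_eq, mk_eval, mk_eval]
      refine h.trans ⟨fun e => ?_, fun ⟨k, u, e⟩ => ?_⟩
      · obtain ⟨k, u, e⟩ := exists_act_eq D e
        rw [act_eval, act_eval] at e
        exact ⟨k, u, e⟩
      · have e' : t.eval _ _ = t'.eval _ _ := e
        rw [← act_eval, ← act_eval] at e'
        rw [← mk_act D u, e', mk_act]
    | rel R ts =>
      have h : Reg.Realize (str D) (.atom (.rel R ts)) (fun s v => mk D (a s v)) ↔
          (str D).rl R (fun s v => mk D ((ts s v).eval _ a)) := by
        have e : (fun s v => (ts s v).eval (str D) (fun s v => mk D (a s v))) =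
          fun s v => mk D ((ts s v).eval _ a) := funext fun s => funext fun v => mk_eval D a _
        rw [← e]
        exact Iff.rfl
      refine h.trans ⟨fun e => ?_, fun ⟨k, u, e⟩ => ?_⟩
      · obtain ⟨k, u, e⟩ := exists_rl D R e
        simp only [act_eval] at e
        exact ⟨k, u, e⟩
      · refine ⟨k, _, ?_, e⟩
        funext s v
        exact (congrArg (mk D) (act_eval D u a (ts s v)).symm).trans (mk_act D u _)
  | top => exact fun {j} a => ⟨fun _ => ⟨j, 𝟙 j, Reg.realize_top _ _⟩, fun _ => Reg.realize_top _ _⟩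
  | and φ ψ ih ih' =>
    intro j a
    simp only [Reg.realize_and, ih, ih']
    constructor
    · rintro ⟨⟨k, u, h⟩, ⟨l, v, h'⟩⟩
      obtain ⟨m, w, w', e⟩ := IsFiltered.span u v
      refine ⟨m, u ≫ w, ?_, ?_⟩
      · simp only [act_comp]
        exact realize_act D w φ h
      · rw [e]
        simp only [act_comp]
        exact realize_act D w' ψ h'
    · rintro ⟨k, u, h, h'⟩
      exact ⟨⟨k, u, h⟩, ⟨k, u, h'⟩⟩
  | @ex Γ s φ ih =>
    intro j a
    simp only [Reg.realize_ex]
    have key : ∀ {i k : J} (u : i ⟶ k) (x : (D.obj i).obj.carrier s)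
        (b : Tuple (D.obj i).obj.carrier Γ),
        (fun s' v => act D u s' (Tuple.cons x b s' v)) =
          Tuple.cons (act D u s x) (fun s v => act D u s (b s v)) :=
      fun u x b => Tuple.cons_ext rfl (fun _ _ => rfl)
    have key' : ∀ {i : J} (x : (D.obj i).obj.carrier s) (b : Tuple (D.obj i).obj.carrier Γ),
        (Tuple.cons (mk D x) (fun s v => mk D (b s v)) : Tuple (str D).carrier (s :: Γ)) =
          fun s' v => mk D (Tuple.cons x b s' v) :=
      fun x b => Tuple.cons_ext rfl (fun _ _ => rfl)
    constructor
    · rintro ⟨x, hx⟩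
      obtain ⟨i, y, rfl⟩ := exists_mk D x
      have e : (Tuple.cons (mk D y) (fun s v => mk D (a s v)) : Tuple (str D).carrier _) =
          fun s' v => mk D (Tuple.cons (act D (IsFiltered.leftToMax i j) s y)
            (fun s v => act D (IsFiltered.rightToMax i j) s (a s v)) s' v) := by
        rw [← key', mk_act]
        simp only [mk_act]
      rw [e, ih] at hx
      obtain ⟨k, u, h⟩ := hx
      rw [key] at h
      simp only [← act_comp] at h
      exact ⟨k, _, _, h⟩
    · rintro ⟨k, u, x, h⟩
      refine ⟨mk D x, ?_⟩
      have e : (fun s v => mk D (a s v)) = fun s v => mk D (act D u s (a s v)) := by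
        simp only [mk_act]
      rw [e, key', ih]
      exact ⟨k, 𝟙 k, by simpa only [act_id] using h⟩

/-- The filtered colimit of the underlying structures is a model. -/
noncomputable abbrev model : T.Mod := ⟨str D, fun q hq a h => by
  obtain ⟨j, b, rfl⟩ := exists_tuple D a
  obtain ⟨k, u, h⟩ := (realize_iff D q.lhs b).mp h
  exact (realize_iff D q.rhs b).mpr ⟨k, u, (D.obj k).property q hq _ h⟩⟩

/-- The cocone of the filtered colimit. For the comparison with a given colimit `c`, it is enough
that the homomorphism from `c` to it has a retraction. -/
noncomputable abbrev cocone : Cocone D where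
  pt := model D
  ι :=
    { app := fun j => ObjectProperty.homMk
        { toFun := fun s x => mk D x
          map_fn := fun f a => mk_fn D f a
          map_rl := fun R a h => ⟨j, a, rfl, h⟩ }
      naturality := fun i j u => by
        apply ObjectProperty.hom_ext
        apply Str.Hom.ext
        funext s x
        exact mk_act D u x }

variable {D} {c : Cocone D}


/-- Every element of a filtered colimit of models comes from some stage. -/
theorem exists_rep (hc : IsColimit c) {s : S.Srt} (x : c.pt.obj.carrier s) :
    ∃ (j : J) (y : (D.obj j).obj.carrier s), (c.ι.app j).hom.toFun s y = x := by
  -- `G` is induced by the legs of `c`, and it is a retraction of `c.pt ⟶ (cocone D).pt`.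
  let G : (cocone D).pt ⟶ c.pt := ObjectProperty.homMk
    { toFun := fun s => Quotient.lift (fun p : Σ j, (D.obj j).obj.carrier s =>
        (c.ι.app p.1).hom.toFun s p.2) (by
          rintro p q ⟨k, u, v, h⟩
          have e := congrArg (fun h => h.hom.toFun s p.2) (c.w u)
          have e' := congrArg (fun h => h.hom.toFun s q.2) (c.w v)
          exact e.symm.trans ((congrArg ((c.ι.app k).hom.toFun s) h).trans e'))
      map_fn := fun f a => by
        obtain ⟨j, b, rfl⟩ := exists_tuple D a
        refine (congrArg _ (mk_fn D f b).symm).trans ?_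
        exact (c.ι.app j).hom.map_fn f b
      map_rl := fun R a h => by
        obtain ⟨j, b, rfl, hR⟩ := h
        exact (c.ι.app j).hom.map_rl R b hR }
  have hG : hc.desc (cocone D) ≫ G = 𝟙 c.pt := hc.hom_ext fun j => by
    rw [← Category.assoc, hc.fac, Category.comp_id]
    rfl
  obtain ⟨j, y, hy⟩ := exists_mk D ((hc.desc (cocone D)).hom.toFun s x)
  refine ⟨j, y, ?_⟩
  have e := congrArg (fun h => h.hom.toFun s x) hG
  refine Eq.trans ?_ e
  exact congrArg (G.hom.toFun s) hy

theorem desc_app (hc : IsColimit c) {j : J} {s : S.Srt} (x : (D.obj j).obj.carrier s) :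
    (hc.desc (cocone D)).hom.toFun s ((c.ι.app j).hom.toFun s x) = mk D x :=
  congrArg (fun h => h.hom.toFun s x) (hc.fac (cocone D) j)

/-- Atomic formulae that are true in a filtered colimit are true at some stage. -/
theorem exists_realize (hc : IsColimit c) {X : S.Srt → Type u} (α : Atom S X) {j : J}
    (a : ∀ s, X s → (D.obj j).obj.carrier s)
    (h : α.Realize c.pt.obj (fun s x => (c.ι.app j).hom.toFun s (a s x))) :
    ∃ (k : J) (u : j ⟶ k), α.Realize (D.obj k).obj (fun s x => act D u s (a s x)) := by
  cases α with
  | eq t t' =>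
    have h1 : t.eval c.pt.obj _ = t'.eval c.pt.obj _ := h
    rw [ι_eval D, ι_eval D] at h1
    have h2 := congrArg ((hc.desc (cocone D)).hom.toFun _) h1
    rw [desc_app, desc_app] at h2
    obtain ⟨k, u, e⟩ := exists_act_eq D h2
    rw [act_eval, act_eval] at e
    exact ⟨k, u, e⟩
  | rel R ts =>
    have h1 := (hc.desc (cocone D)).hom.map_rl R _ h
    have e : (Tuple.map (hc.desc (cocone D)).hom.toFun fun s v =>
        (ts s v).eval c.pt.obj (fun s x => (c.ι.app j).hom.toFun s (a s x))) =
        fun s v => mk D ((ts s v).eval _ a) := by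
      funext s v
      exact (congrArg ((hc.desc (cocone D)).hom.toFun s) (ι_eval D a (ts s v))).trans
        (desc_app hc _)
    rw [e] at h1
    obtain ⟨k, u, h2⟩ := exists_rl D R h1
    simp only [act_eval] at h2
    exact ⟨k, u, h2⟩

end FilteredColim

/-! ### Morphisms between finitely presentable models -/

section Conjs
variable {S : Signature.{u}} {T : Set (Sequent S)}

/-- The conjunction of a family of formulae that is indexed by the variables of a context. -/
def Reg.conjs : ∀ (Θ : List S.Srt) {Δ : List S.Srt}, (∀ s, Var Θ s → Reg S Δ) → Reg S Δ
  | [], _, _ => .top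
  | _ :: Θ, _, φ => .and (φ _ .zero) (Reg.conjs Θ fun s v => φ s v.succ)

theorem Reg.conjs_cart : ∀ {Θ Δ : List S.Srt} {φ : ∀ s, Var Θ s → Reg S Δ},
    (∀ s v, IsCartesian T (φ s v)) → IsCartesian T (Reg.conjs Θ φ)
  | [], _, _, _ => trivial
  | _ :: _, _, _, h => ⟨h _ .zero, Reg.conjs_cart fun s v => h s v.succ⟩

theorem Reg.realize_conjs (M : Str S) : ∀ {Θ Δ : List S.Srt} (φ : ∀ s, Var Θ s → Reg S Δ)
    (a : Tuple M.carrier Δ), (∀ s v, (φ s v).Realize M a) → (Reg.conjs Θ φ).Realize M a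
  | [], _, _, a, _ => Reg.realize_top M a
  | _ :: _, _, _, a, h => (Reg.realize_and M _ _ a).mpr
      ⟨h _ .zero, Reg.realize_conjs M _ a fun s v => h s v.succ⟩

theorem Prov.conjs_intro : ∀ {Θ Δ Δ' : List S.Srt} {φ : ∀ s, Var Θ s → Reg S Δ} {χ : Reg S Δ'}
    {σ : Sub S Δ Δ'}, (∀ s v, Prov T χ ((φ s v).subst σ)) → Prov T χ ((Reg.conjs Θ φ).subst σ)
  | [], _, _, _, _, _, _ => .top_intro _
  | _ :: _, _, _, _, _, _, h => .and_intro (h _ .zero) (Prov.conjs_intro fun s v => h s v.succ)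

theorem Prov.conjs_elim : ∀ {Θ Δ Δ' : List S.Srt} {φ : ∀ s, Var Θ s → Reg S Δ} {χ : Reg S Δ'}
    {σ : Sub S Δ Δ'}, Prov T χ ((Reg.conjs Θ φ).subst σ) → ∀ s v, Prov T χ ((φ s v).subst σ)
  | _ :: _, _, _, _, _, _, h, _, .zero => h.fst
  | _ :: _, _, _, _, _, _, h, _, .succ v => Prov.conjs_elim h.snd _ v

theorem Prov.exs_intro : ∀ {Θ Δ Δ' : List S.Srt} {φ : Reg S (Θ ++ Δ)} {χ : Reg S Δ'}
    {σ : Sub S Δ Δ'} (τ : Sub S Θ Δ'), Prov T χ (φ.subst (Tuple.append τ σ)) →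
      Prov T χ ((Reg.exs Θ φ).subst σ)
  | [], _, _, _, _, _, _, h => h
  | _ :: Θ, _, _, _, _, _, τ, h =>
    Prov.exs_intro (Θ := Θ) (Tuple.tail (Γ := Θ) τ) (.ex_intro (τ _ .zero) h)

end Conjs

namespace FG
variable {S : Signature.{u}} {T : CartTheory S} {A B : Obj T}

/-- Every element of `⟨x | φ⟩` is defined from the generators by its own formula. -/
theorem realize_rep {s : S.Srt} (q : (FG A).obj.carrier s) :
    (rep q).Realize (FG A).obj (Tuple.cons q (gen A)) := by
  refine (realize_iff (rep_cart q) _).mpr fun Δ χ σ τ hA h => ?_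
  refine Prov.replace (σ := Tuple.cons (τ s .zero) σ) (fun s' v => ?_) (h s .zero)
  cases v with
  | zero => exact .eq_rfl _
  | succ v => exact ((rep_mk _).mp (h s' v.succ)).snd.eq_symm

theorem lift_eq_iff {M : T.Mod} {a : Tuple M.obj.carrier A.ctx} {ha : A.fml.Realize M.obj a}
    {s : S.Srt} {q : (FG A).obj.carrier s} {x : M.obj.carrier s} :
    (lift A M a ha).hom.toFun s q = x ↔ (rep q).Realize M.obj (Tuple.cons x a) :=
  apply_out q M a ha x

@[simp] theorem lift_gen {M : T.Mod} (a : Tuple M.obj.carrier A.ctx) (ha : A.fml.Realize M.obj a)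
    {s : S.Srt} (v : Var A.ctx s) : (lift A M a ha).hom.toFun s (gen A s v) = a s v := by
  refine lift_eq_iff.mpr (Prov.sound M.property (le_rep_mk _) _ ?_)
  exact (Reg.realize_and _ _ _ _).mpr ⟨(Reg.realize_wk _ _ _ _).mpr ha, rfl⟩

theorem map_gen_mem {M : T.Mod} (h : FG A ⟶ M) :
    A.fml.Realize M.obj (fun s v => h.hom.toFun s (gen A s v)) :=
  Reg.realize_hom h.hom A.fml _ (realize_gen A)

/-- Homomorphisms from `⟨x | φ⟩` are determined by the images of the generators. -/
theorem eq_lift {M : T.Mod} (h : FG A ⟶ M) : h = lift A M _ (map_gen_mem h) := by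
  apply ObjectProperty.hom_ext
  apply Str.Hom.ext
  funext s q
  refine (lift_eq_iff.mpr ?_).symm
  convert Reg.realize_hom h.hom _ _ (realize_rep q) using 1
  exact Tuple.cons_ext rfl (fun _ _ => rfl)

theorem hom_ext {M : T.Mod} {h h' : FG A ⟶ M}
    (e : ∀ s v, h.hom.toFun s (gen A s v) = h'.hom.toFun s (gen A s v)) : h = h' := by
  rw [eq_lift h, eq_lift h']
  congr 1
  funext s v
  exact e s v

theorem comp_lift {M : T.Mod} (k : FG A ⟶ FG B) (b : Tuple M.obj.carrier B.ctx)
    (hb : B.fml.Realize M.obj b) (a : Tuple M.obj.carrier A.ctx) (ha : A.fml.Realize M.obj a) :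
    k ≫ lift B M b hb = lift A M a ha ↔
      ∀ s v, (lift B M b hb).hom.toFun s (k.hom.toFun s (gen A s v)) = a s v := by
  constructor
  · intro h s v
    have := congrArg (fun h => h.hom.toFun s (gen A s v)) h
    exact this.trans (lift_gen a ha v)
  · intro h
    exact hom_ext fun s v => (h s v).trans (lift_gen a ha v).symm

theorem yonedaMap_gen (θ : FunRel B A) {s : S.Srt} (v : Var A.ctx s) :
    (yonedaMap θ).hom.toFun s (gen A s v) = θ.apply (FG B) (gen B) (realize_gen B) s v :=
  lift_gen _ _ _

/-- Under the Yoneda embedding, the graph of `θ` is the relation of factoring through `θ`. -/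
theorem yonedaMap_comp_lift {M : T.Mod} (θ : FunRel B A) (b : Tuple M.obj.carrier B.ctx)
    (hb : B.fml.Realize M.obj b) (a : Tuple M.obj.carrier A.ctx) (ha : A.fml.Realize M.obj a) :
    yonedaMap θ ≫ lift B M b hb = lift A M a ha ↔ θ.fml.Realize M.obj (Tuple.append a b) := by
  have h := Reg.realize_hom (lift B M b hb).hom _ _
    (θ.realize_apply (FG B) (gen B) (realize_gen B))
  unfold Tuple.map at h
  rw [Tuple.append_map] at h
  simp only [lift_gen] at h
  rw [comp_lift, ← θ.apply_eq_iff M b hb, (θ.apply_eq_iff M b hb _).mpr h]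
  simp only [yonedaMap_gen, funext_iff]

/-- The Yoneda embedding is full: a homomorphism `k` corresponds to the conjunction of the formulae
that represent the images of the generators under `k`. -/
theorem exists_yonedaMap_eq (k : FG A ⟶ FG B) : ∃ θ : FunRel B A, yonedaMap θ = k := by
  let q : Tuple (FG B).obj.carrier A.ctx := fun s v => k.hom.toFun s (gen A s v)
  have hq : A.fml.Realize (FG B).obj q := map_gen_mem k
  let ψ : ∀ s, Var A.ctx s → Reg S (A.ctx ++ B.ctx) := fun s v =>
    (rep (q s v)).subst (Tuple.cons (.var (Var.left s v)) (Sub.ofVar fun _ w => Var.right _ w))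
  have elim : ∀ {Δ : List S.Srt} {χ : Reg S Δ} {σ : Sub S (A.ctx ++ B.ctx) Δ},
      Prov T.seqs χ ((Reg.conjs A.ctx ψ).subst σ) → ∀ s v,
      Prov T.seqs χ ((rep (q s v)).subst
        (Tuple.cons (σ s (Var.left s v)) (fun _ w => σ _ (Var.right _ w)))) := by
    intro Δ χ σ h s v
    have := Prov.conjs_elim h s v
    rw [Reg.subst_subst, Sub.cons_comp] at this
    exact this
  let θ : FunRel B A :=
    { fml := .and (B.fml.rename fun _ v => Var.right _ v) (Reg.conjs A.ctx ψ)
      cart := ⟨B.cart.subst _, Reg.conjs_cart fun s v => (rep_cart (q s v)).subst _⟩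
      le := by
        refine .and_intro (.and_left _ _) ?_
        refine (realize_iff A.cart q).mp hq _ _ (Sub.ofVar fun _ w => Var.right _ w) _
          (.and_left _ _) (fun s v => ?_)
        exact elim (σ := fun _ v => .var v) (by rw [Reg.subst_id]; exact .and_right _ _) s v
      uniq := by
        refine Prov.eqs_intro fun s v => ?_
        refine (rep_uniq (q s v)).eq (σ := .ofVar fun _ w => Var.right _ (Var.right _ w)) ?_ ?_
        · let ρ : Sub S (A.ctx ++ B.ctx) (A.ctx ++ (A.ctx ++ B.ctx)) :=
            Sub.ofVar (Tuple.append (fun _ v => Var.left _ v)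
              (fun _ v => Var.right _ (Var.right _ v)))
          have e : Tuple.cons (ρ s (Var.left s v)) (fun _ w => ρ _ (Var.right _ w)) =
              Tuple.cons (.var (Var.left s v)) (Sub.ofVar fun _ w => Var.right _ (Var.right _ w)) :=
            Tuple.cons_ext (congrArg Term.var (Tuple.append_left _ _ _ _))
              (fun s w => congrArg Term.var (Tuple.append_right _ _ _ _))
          exact e ▸ elim (σ := ρ) (Prov.and_left _ _).snd s v
        · exact elim (Prov.and_right _ _).snd s v
      total := by
        have hB : Prov T.seqs B.fml (B.fml.subst (fun _ v => .var v)) := by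
          rw [Reg.subst_id]; exact .refl _
        refine cases q hB (fun Δ' κ χ' τ h1 h2 => ?_)
        refine Prov.exs_intro τ (.and_intro ?_ (Prov.conjs_intro fun s v => ?_))
        · have e : Sub.comp (Sub.ofVar fun _ w => Var.right _ w) (Tuple.append τ κ) = κ :=
            funext fun s => funext fun w => Tuple.append_right τ κ s w
          rw [Reg.rename, Reg.subst_subst, e]
          exact h1
        · have e : Sub.comp (Tuple.cons (.var (Var.left s v)) (Sub.ofVar fun _ w => Var.right _ w))
              (Tuple.append τ κ) = Tuple.cons (τ s v) κ :=
            Tuple.cons_ext (Tuple.append_left τ κ s v) (fun s w => Tuple.append_right τ κ s w)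
          rw [Reg.subst_subst, e]
          exact h2 s v }
  refine ⟨θ, hom_ext fun s v => ?_⟩
  rw [yonedaMap_gen]
  refine congrFun (congrFun ((θ.apply_eq_iff (FG B) _ _ q).mpr ?_) s) v
  refine (Reg.realize_and _ _ _ _).mpr ⟨?_, Reg.realize_conjs _ _ _ fun s v => ?_⟩
  · rw [Reg.realize_rename]
    simpa only [Tuple.append_right] using realize_gen B
  · rw [Reg.realize_subst]
    convert realize_rep (q s v) using 1
    exact Tuple.cons_ext (Tuple.append_left _ _ _ _) (fun s w => Tuple.append_right _ _ _ _)

end FG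

/-! ### Models as filtered colimits of finitely presentable models -/

/-- The objects of the category of elements of `M`: tuples `a ∈ ⟦φ⟧_M`, for objects `{x | φ}` of
the syntactic category. -/
structure Point {S : Signature.{u}} {T : CartTheory S} (M : T.Mod) : Type u where
  base : Obj T
  elt : Tuple M.obj.carrier base.ctx
  mem : base.fml.Realize M.obj elt

namespace Point
variable {S : Signature.{u}} {T : CartTheory S} {M : T.Mod}

/-- The homomorphism `h_a : ⟨x | φ⟩ ⟶ M`. -/
noncomputable abbrev hom (p : Point M) : FG p.base ⟶ M := FG.lift p.base M p.elt p.mem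

/-- Morphisms of points are the homomorphisms of the representing models over `M`. -/
noncomputable instance : SmallCategory (Point M) where
  Hom p q := {k : FG p.base ⟶ FG q.base // k ≫ q.hom = p.hom}
  id p := ⟨𝟙 _, Category.id_comp _⟩
  comp k l := ⟨k.1 ≫ l.1, by rw [Category.assoc, l.2, k.2]⟩
  id_comp k := Subtype.ext (Category.id_comp _)
  comp_id k := Subtype.ext (Category.comp_id _)
  assoc k l m := Subtype.ext (Category.assoc _ _ _)

/-- Two elements of `⟨x | φ⟩` with the same image in `M` are identified by a morphism of points. -/
theorem exists_eq₁ (q : Point M) {s : S.Srt} (x y : (FG q.base).obj.carrier s)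
    (h : q.hom.hom.toFun s x = q.hom.hom.toFun s y) :
    ∃ (r : Point M) (m : q ⟶ r), m.1.hom.toFun s x = m.1.hom.toFun s y := by
  -- The coequalizer of `x` and `y` is presented by adding that they have a common value.
  let C : Obj T := ⟨q.base.ctx, .and q.base.fml (.ex s (.and (FG.rep x) (FG.rep y))),
    q.base.cart, ⟨FG.rep_cart x, FG.rep_cart y⟩,
    ProvUnique.intro fun Δ χ σ t t' h h' => (FG.rep_uniq x).eq h.fst h'.fst⟩
  have hC := FG.realize_gen C
  rw [Reg.realize_and, Reg.realize_ex] at hC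
  obtain ⟨hq, z, hz⟩ := hC
  rw [Reg.realize_and] at hz
  let r : Point M := ⟨C, q.elt, (Reg.realize_and _ _ _ _).mpr ⟨q.mem, q.hom.hom.toFun s x,
    (Reg.realize_and _ _ _ _).mpr ⟨FG.lift_eq_iff.mp rfl, FG.lift_eq_iff.mp h.symm⟩⟩⟩
  refine ⟨r, ⟨FG.lift q.base (FG C) (FG.gen C) hq, ?_⟩, ?_⟩
  · refine (FG.comp_lift _ _ _ _ _).mpr fun s v => ?_
    rw [FG.lift_gen]
    exact FG.lift_gen (A := C) q.elt r.mem v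
  · exact (FG.lift_eq_iff.mpr hz.1).trans (FG.lift_eq_iff.mpr hz.2).symm

theorem exists_eq : ∀ {Γ : List S.Srt} (q : Point M) (x y : Tuple (FG q.base).obj.carrier Γ),
    (∀ s v, q.hom.hom.toFun s (x s v) = q.hom.hom.toFun s (y s v)) →
    ∃ (r : Point M) (m : q ⟶ r), ∀ s v, m.1.hom.toFun s (x s v) = m.1.hom.toFun s (y s v)
  | [], q, _, _, _ => ⟨q, 𝟙 q, fun _ v => nomatch v⟩
  | t :: Γ, q, x, y, h => by
    obtain ⟨r, m, hm⟩ := exists_eq q x.tail y.tail fun s v => h s v.succ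
    have w : ∀ z, r.hom.hom.toFun t (m.1.hom.toFun t z) = q.hom.hom.toFun t z := fun z =>
      congrArg (fun h => h.hom.toFun t z) m.2
    obtain ⟨r', m', hm'⟩ := exists_eq₁ r (m.1.hom.toFun t (x t .zero)) (m.1.hom.toFun t (y t .zero))
      (by rw [w, w]; exact h t .zero)
    refine ⟨r', m ≫ m', fun s v => ?_⟩
    cases v with
    | zero => exact hm'
    | succ v => exact congrArg (m'.1.hom.toFun s) (hm s v)

instance : IsFiltered (Point M) where
  nonempty := ⟨⟨⟨[], .top, trivial⟩, Tuple.nil, Reg.realize_top _ _⟩⟩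
  cocone_objs p q := by
    let C : Obj T := ⟨p.base.ctx ++ q.base.ctx,
      .and (p.base.fml.rename fun _ v => Var.left _ v) (q.base.fml.rename fun _ v => Var.right _ v),
      p.base.cart.subst _, q.base.cart.subst _⟩
    have hC := FG.realize_gen C
    rw [Reg.realize_and, Reg.realize_rename, Reg.realize_rename] at hC
    let r : Point M := ⟨C, Tuple.append p.elt q.elt, by
      rw [Reg.realize_and, Reg.realize_rename, Reg.realize_rename]
      simp only [Tuple.append_left, Tuple.append_right]
      exact ⟨p.mem, q.mem⟩⟩
    refine ⟨r, ⟨FG.lift p.base (FG C) _ hC.1, ?_⟩, ⟨FG.lift q.base (FG C) _ hC.2, ?_⟩, trivial⟩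
    · refine (FG.comp_lift _ _ _ _ _).mpr fun s v => ?_
      rw [FG.lift_gen]
      exact (FG.lift_gen (A := C) r.elt r.mem _).trans (Tuple.append_left _ _ _ _)
    · refine (FG.comp_lift _ _ _ _ _).mpr fun s v => ?_
      rw [FG.lift_gen]
      exact (FG.lift_gen (A := C) r.elt r.mem _).trans (Tuple.append_right _ _ _ _)
  cocone_maps p q k l := by
    obtain ⟨r, m, hm⟩ := exists_eq q (fun s v => k.1.hom.toFun s (FG.gen p.base s v))
      (fun s v => l.1.hom.toFun s (FG.gen p.base s v)) (fun s v => by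
        have h := congrArg (fun h => h.hom.toFun s (FG.gen p.base s v)) (k.2.trans l.2.symm)
        exact h)
    exact ⟨r, m, Subtype.ext (FG.hom_ext hm)⟩

variable (M)

/-- The canonical diagram of finitely presentable models over `M`. -/
noncomputable def diagram : Point M ⥤ T.Mod where
  obj p := FG p.base
  map k := k.1

/-- The homomorphisms `h_a`, as a cocone over the canonical diagram. -/
noncomputable def cocone : Cocone (diagram M) where
  pt := M
  ι :=
    { app := fun p => p.hom
      naturality := fun _ _ k => k.2.trans (Category.comp_id _).symm }

variable {M}

/-- The point of `{y : s | ⊤}` that is given by an element of `M`. -/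
def ofElt {s : S.Srt} (x : M.obj.carrier s) : Point M :=
  ⟨Obj.ofSort T s, Tuple.cons x Tuple.nil, Reg.realize_top _ _⟩

/-- The component at `s` of the homomorphism that a cocone induces. -/
noncomputable def descFun (c : Cocone (diagram M)) (s : S.Srt) (x : M.obj.carrier s) :
    c.pt.obj.carrier s := (c.ι.app (ofElt x)).hom.toFun s (FG.gen (Obj.ofSort T s) s .zero)

/-- Along `h_a`, the function `descFun` is the leg of the cocone at `a`: an element `q` of `⟨x | φ⟩`
is a morphism from the point given by `h_a(q)` to the point `a`. -/
theorem descFun_hom (c : Cocone (diagram M)) (p : Point M) {s : S.Srt}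
    (q : (FG p.base).obj.carrier s) :
    descFun c s (p.hom.hom.toFun s q) = (c.ι.app p).hom.toFun s q := by
  let k : ofElt (p.hom.hom.toFun s q) ⟶ p :=
    ⟨FG.lift (Obj.ofSort T s) (FG p.base) (Tuple.cons q Tuple.nil) (Reg.realize_top _ _),
      (FG.comp_lift _ _ _ _ _).mpr fun s v => by
        cases v with
        | zero => exact congrArg (p.hom.hom.toFun s) (FG.lift_gen (A := Obj.ofSort T s)
            (Tuple.cons q Tuple.nil) (Reg.realize_top _ _) .zero)
        | succ v => exact nomatch v⟩
  have h := congrArg (fun h => h.hom.toFun s (FG.gen (Obj.ofSort T s) s .zero)) (c.w k)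
  refine h.symm.trans (congrArg ((c.ι.app p).hom.toFun s) ?_)
  exact FG.lift_gen (A := Obj.ofSort T s) (Tuple.cons q Tuple.nil) (Reg.realize_top _ _) .zero

/-- Every model is the filtered colimit of the finitely presentable models over it. -/
noncomputable def isColimit : IsColimit (cocone M) where
  desc c := ObjectProperty.homMk
    { toFun := descFun c
      map_fn := fun f a => by
        let p : Point M := ⟨⟨S.dom f, .top, trivial⟩, a, Reg.realize_top _ _⟩
        have e : ∀ s v, p.hom.hom.toFun s (FG.gen p.base s v) = a s v :=
          fun s v => FG.lift_gen (A := p.base) a p.mem v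
        have e' : Tuple.map p.hom.hom.toFun (FG.gen p.base) = a :=
          funext fun s => funext fun v => e s v
        have h := p.hom.hom.map_fn f (FG.gen p.base)
        rw [e'] at h
        refine (congrArg (descFun c _) h.symm).trans ((descFun_hom c p _).trans
          (((c.ι.app p).hom.map_fn f _).trans (congrArg (c.pt.obj.fn f) ?_)))
        funext s v
        exact (descFun_hom c p _).symm.trans (congrArg (descFun c s) (e s v))
      map_rl := fun R a ha => by
        let p : Point M := ⟨⟨S.ar R, .atom (.rel R fun _ v => .var v), trivial⟩, a, ha⟩
        have h := (c.ι.app p).hom.map_rl R (FG.gen p.base) (FG.realize_gen p.base)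
        refine Eq.mpr (congrArg (c.pt.obj.rl R) ?_) h
        funext s v
        exact (congrArg (descFun c s) (FG.lift_gen (A := p.base) a ha v)).symm.trans
          (descFun_hom c p _) }
  fac c p := by
    apply ObjectProperty.hom_ext
    apply Str.Hom.ext
    funext s q
    exact descFun_hom c p q
  uniq c m h := by
    apply ObjectProperty.hom_ext
    apply Str.Hom.ext
    funext s x
    have h' := congrArg (fun h => h.hom.toFun s (FG.gen (Obj.ofSort T s) s .zero)) (h (ofElt x))
    refine Eq.trans (congrArg (m.hom.toFun s) ?_) h'
    exact (FG.lift_gen (A := Obj.ofSort T s) (Tuple.cons x Tuple.nil)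
      (Reg.realize_top _ _) .zero).symm

end Point

/-! ### Truth of the formulae `At` -/

section Main
variable {S S' : Signature.{u}} {T : CartTheory S} {T' : CartTheory S'} {F : T'.Mod ⥤ T.Mod}

theorem Gen.map_value {X : S'.Srt → Type u} {s : S.Srt} (g : Gen (NewSym F) X s) {M N : T'.Mod}
    (h : FG g.obj ⟶ M) (k : M ⟶ N) :
    (F.map k).hom.toFun s (g.value h) = g.value (h ≫ k) := by
  unfold Gen.value
  rw [F.map_comp]
  rfl

/-- The element `n` of `F M` is the value `(F h_a)(c)` of the expression `f^c_{⟨x | φ⟩}(a)`, which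
is defined when `a ∈ ⟦φ⟧_M`. -/
def HasValue (M : T'.Mod) (s : S.Srt) (g : Gen (NewSym F) M.obj.carrier s)
    (n : (F.obj M).obj.carrier s) : Prop :=
  ∃ h : g.obj.fml.Realize M.obj g.args, n = g.value (FG.lift g.obj M g.args h)

theorem HasValue.iff_eq {M : T'.Mod} {s : S.Srt} {g : Gen (NewSym F) M.obj.carrier s}
    {n : (F.obj M).obj.carrier s} (h : HasValue M s g n) (m : (F.obj M).obj.carrier s) :
    HasValue M s g m ↔ m = n := by
  obtain ⟨h, rfl⟩ := h
  exact ⟨fun ⟨_, e⟩ => e, fun e => ⟨h, e⟩⟩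

/-- `F M` is the colimit of the image under `F` of the canonical diagram over `M`. -/
noncomputable def isColimitMap (hF : PreservesFilteredColimitsOfSize.{u, u} F) (M : T'.Mod) :
    IsColimit (F.mapCocone (Point.cocone M)) :=
  have := hF.preserves_filtered_colimits (Point M)
  isColimitOfPreserves F Point.isColimit

/-- The homomorphism `F h_x`, for a witness `x` of the existential quantifier in `At`, takes the
values of the expressions at the stage `F ⟨x | φ⟩` to their values in `F M`. -/
theorem relRealize_of_atParsed {M : T'.Mod} {xs : List S'.Srt}
    (α : Atom S (Gen (NewSym F) (Var xs))) (a : Tuple M.obj.carrier xs)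
    (H : (atParsed F α).Realize M.obj a) :
    α.RelRealize (F.obj M).obj (fun s g => HasValue M s (g.map a)) := by
  obtain ⟨A, ⟨θ, hθ⟩, h⟩ := H
  obtain ⟨x, hx⟩ := (LInf.realize_exs _ _ _ _).mp h
  obtain ⟨hA, hx⟩ := (LInf.realize_and _ _ _ _).mp hx
  rw [LInf.realize_rename] at hA
  simp only [Tuple.append_left] at hA
  refine Atom.RelRealize.hom (F.map (FG.lift A M x hA)).hom ?_
    ((Atom.relRealize_ownVars α _).mpr hθ)
  rintro s g hg n ⟨_, rfl⟩
  have h1 := (LInf.realize_rename _ _ _ _).mp (hx ⟨⟨s, g⟩, hg⟩)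
  have h2 : (θ ⟨⟨s, g⟩, hg⟩).fml.Realize M.obj
      (Tuple.append (fun s v => a s (g.args s v)) x) := by
    have e := Tuple.append_map (fun s v => Tuple.append x a s v)
      (fun s v => Var.right s (g.args s v)) (fun s (v : Var A.ctx s) => Var.left s v)
    rw [e] at h1
    simp only [Tuple.append_left, Tuple.append_right] at h1
    exact h1
  have h3 := ((Reg.realize_and _ _ _ _).mp ((θ ⟨⟨s, g⟩, hg⟩).le.sound M.property _ h2)).2
  rw [Reg.realize_rename] at h3
  simp only [Tuple.append_left] at h3
  refine ⟨h3, ?_⟩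
  rw [Gen.map_value, (FG.yonedaMap_comp_lift (θ ⟨⟨s, g⟩, hg⟩) x hA _ h3).mpr h2]
  rfl

/-- An atomic formula that is true in the filtered colimit `F M` is true at a stage `F ⟨x | φ⟩`. The
homomorphisms that transport the expressions to this stage are of the form `yonedaMap θ`. -/
theorem atParsed_of_relRealize (hF : PreservesFilteredColimitsOfSize.{u, u} F) {M : T'.Mod}
    {xs : List S'.Srt} (α : Atom S (Gen (NewSym F) (Var xs))) (a : Tuple M.obj.carrier xs)
    (H : α.RelRealize (F.obj M).obj (fun s g => HasValue M s (g.map a))) :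
    (atParsed F α).Realize M.obj a := by
  have good : ∀ g : {g // g ∈ α.occ}, g.1.2.obj.fml.Realize M.obj
      (fun s v => a s (g.1.2.args s v)) := fun g =>
    (H.exists_of_occ g.1 g.2).choose_spec.choose
  let P : {g // g ∈ α.occ} → Point M := fun g => ⟨g.1.2.obj, _, good g⟩
  have := α.occ_finite.to_subtype
  -- Finitely many expressions occur in `α`, so the points that they name map to a common point.
  obtain ⟨j, hj⟩ := IsFiltered.sup_objs_exists (Set.finite_range P).toFinset
  let k : ∀ g, P g ⟶ j := fun g => (hj (X := P g) (by simp)).some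
  let b : ∀ s, {g // (⟨s, g⟩ : Σ s, _) ∈ α.occ} → (F.obj (FG j.base)).obj.carrier s :=
    fun s g => g.1.value (k ⟨⟨s, g.1⟩, g.2⟩).1
  have h1 : α.ownVars.Realize (F.obj M).obj (fun s g => (F.map j.hom).hom.toFun s (b s g)) := by
    refine (Atom.relRealize_ownVars α _).mp (H.mono ?_)
    rintro s g hg n ⟨h, rfl⟩
    refine ⟨hg, Eq.symm ((Gen.map_value _ _ _).trans ?_)⟩
    exact congrArg (Gen.value g) (k ⟨⟨s, g⟩, hg⟩).2
  obtain ⟨i, u, h2⟩ := FilteredColim.exists_realize (isColimitMap hF M) α.ownVars (j := j) b h1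
  choose θ hθ using fun g => FG.exists_yonedaMap_eq (k g ≫ u).1
  refine ⟨i.base, ⟨θ, ?_⟩, (LInf.realize_exs _ _ _ _).mpr ⟨i.elt,
    (LInf.realize_and _ _ _ _).mpr ⟨?_, ?_⟩⟩⟩
  · refine Eq.mp (congrArg (fun v => Atom.Realize (F.obj (FG i.base)).obj v α.ownVars) ?_) h2
    funext s g
    exact (Gen.map_value _ _ _).trans (congrArg (Gen.value g.1) (hθ ⟨⟨s, g.1⟩, g.2⟩).symm)
  · rw [LInf.realize_rename]
    simp only [Tuple.append_left]
    exact i.mem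
  · intro g
    refine (LInf.realize_rename _ _ _ _).mpr ?_
    have e := Tuple.append_map (fun s v => Tuple.append i.elt a s v)
      (fun s v => Var.right s (g.1.2.args s v)) (fun s (v : Var i.base.ctx s) => Var.left s v)
    rw [e]
    simp only [Tuple.append_left, Tuple.append_right]
    refine (FG.yonedaMap_comp_lift (θ g) i.elt i.mem _ (good g)).mp ?_
    rw [hθ]
    exact (k g ≫ u).2

/-- `M ⊨ At(α(f₁, …, fₙ))(a)` says that all the `fᵢ(aᵢ)` have values in `F M`, and that `α` is true
of these values. -/
theorem realize_atParsed_iff (hF : PreservesFilteredColimitsOfSize.{u, u} F) {M : T'.Mod}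
    {xs : List S'.Srt} (α : Atom S (Gen (NewSym F) (Var xs))) (a : Tuple M.obj.carrier xs) :
    (atParsed F α).Realize M.obj a ↔
      α.RelRealize (F.obj M).obj (fun s g => HasValue M s (g.map a)) :=
  ⟨relRealize_of_atParsed α a, atParsed_of_relRealize hF α a⟩

/-! ### The presentation of `F M` -/

theorem evalsTo_iff_valuationAux {M : T'.Mod} {s : S.Srt}
    (t : Term S (Gen (NewSym F) M.obj.carrier) s) (h : IsGood M t) (n : (F.obj M).obj.carrier s) :
    t.EvalsTo (F.obj M).obj (HasValue M) n ↔ n = valuationAux M t h := by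
  cases t with
  | var g => exact ⟨fun ⟨_, e⟩ => e, fun e => ⟨h, e⟩⟩
  | app f ts => exact False.elim h

theorem evalsTo_iff_valuation {M : T'.Mod} {s : S.Srt}
    (e : ((wordConstruction F).presentation M.obj).gens s) (n : (F.obj M).obj.carrier s) :
    (Word.parse e.1).EvalsTo (F.obj M).obj (HasValue M) n ↔ n = valuation F M s e :=
  evalsTo_iff_valuationAux _ _ n

/-- For an atomic formula `β` over the generators, the condition that makes it a relation of `W(M)`
is its truth in `F M`. -/
theorem realize_at_iff (hF : PreservesFilteredColimitsOfSize.{u, u} F) {M : T'.Mod}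
    {xs : List S'.Srt} (α : AtomOver S (Word (NewSym F) (Var xs))) (a : Tuple M.obj.carrier xs)
    (β : Atom S ((wordConstruction F).presentation M.obj).gens)
    (h : α.map (fun _ t => t.map a) = AtomOver.map (fun _ t => Word.graft (fun _ e => e.1) t) β) :
    ((wordConstruction F).At α).Realize M.obj a ↔ β.Realize (F.obj M).obj (valuation F M) := by
  refine (realize_atParsed_iff hF _ a).trans ?_
  have h1 := (AtomOver.parse_map a α).symm.trans
    ((congrArg (AtomOver.map fun _ (t : Word (NewSym F) M.obj.carrier _) => t.parse) h).trans
      (AtomOver.parse_graft _ β))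
  refine (Atom.relRealize_map (HasValue M) (fun _ g => Gen.map a g) _).symm.trans ?_
  refine (iff_of_eq (congrArg _ h1)).trans ?_
  refine (Atom.relRealize_bind _ _ β).trans (Iff.trans ?_ (Atom.relRealize_eq _ β))
  refine iff_of_eq (congrArg (fun V => Atom.RelRealize _ V β) ?_)
  funext s e n
  exact propext (evalsTo_iff_valuation e n)

/-- An expression `f^c_{⟨x | φ⟩}(a)` with `a ∈ ⟦φ⟧_M`, as a generator of `W(M)`. -/
noncomputable def Gen.generator {M : T'.Mod} {s : S.Srt} (g : Gen (NewSym F) M.obj.carrier s)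
    (h : g.obj.fml.Realize M.obj g.args) : ((wordConstruction F).presentation M.obj).gens s :=
  ⟨g.toWord, g.dom, Gen.toWord (⟨g.dom, g.fn, fun _ v => v⟩ : Gen (NewSym F) (Var g.dom) s),
    g.args, Gen.toWord_map _ _, (realize_te_iff _ M _).mpr h⟩

theorem Gen.valuation_generator {M : T'.Mod} {s : S.Srt} (g : Gen (NewSym F) M.obj.carrier s)
    (h : g.obj.fml.Realize M.obj g.args) :
    valuation F M s (g.generator h) = g.value (FG.lift g.obj M g.args h) := by
  refine ((evalsTo_iff_valuation _ _).mp ?_).symm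
  rw [show Word.parse (g.generator h).1 = .var g from parse_sym _ g]
  exact ⟨h, rfl⟩

/-- The generator `f^c_{⟨x | φ⟩}(a)` that belongs to a point `a ∈ ⟦φ⟧_M` and to `c`. -/
noncomputable def Point.generator {M : T'.Mod} (p : Point M) {s : S.Srt}
    (c : (F.obj (FG p.base)).obj.carrier s) :
    ((wordConstruction F).presentation M.obj).gens s :=
  Gen.generator ⟨p.base.ctx, ⟨p.base.fml, p.base.cart, c⟩, p.elt⟩ p.mem

theorem Point.valuation_generator {M : T'.Mod} (p : Point M) {s : S.Srt}
    (c : (F.obj (FG p.base)).obj.carrier s) :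
    valuation F M s (p.generator c) = (F.map p.hom).hom.toFun s c :=
  Gen.valuation_generator _ _

/-- Every element of `F M` is the value of a generator. -/
theorem exists_generator (hF : PreservesFilteredColimitsOfSize.{u, u} F) {M : T'.Mod} {s : S.Srt}
    (m : (F.obj M).obj.carrier s) : ∃ (p : Point M) (c : (F.obj (FG p.base)).obj.carrier s),
      valuation F M s (p.generator c) = m := by
  obtain ⟨p, c, h⟩ := FilteredColim.exists_rep (isColimitMap hF M) m
  exact ⟨p, c, (p.valuation_generator c).trans h⟩

/-- A valuation in `N` that satisfies the relations of `W(M)` satisfies every atomic formula that is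
true in `F M`, provided that its entries are instances of words in a common context. -/
theorem realize_of_rels (hF : PreservesFilteredColimitsOfSize.{u, u} F) {M : T'.Mod} {N : Str S}
    {b : ∀ s, ((wordConstruction F).presentation M.obj).gens s → N.carrier s}
    (hb : ∀ α ∈ ((wordConstruction F).presentation M.obj).rels, α.Realize N b)
    {xs : List S'.Srt} (a : Tuple M.obj.carrier xs) {Y : S.Srt → Type u} (α : Atom S Y)
    (w : ∀ s, Y s → Word (NewSym F) (Var xs) s)
    (e : ∀ s, Y s → ((wordConstruction F).presentation M.obj).gens s)
    (he : ∀ s y, (w s y).map a = (e s y).1)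
    (h : α.Realize (F.obj M).obj (fun s y => valuation F M s (e s y))) :
    α.Realize N (fun s y => b s (e s y)) := by
  have h1 : AtomOver.map (fun _ t => Word.map a t) (AtomOver.map (fun _ t => Word.graft w t) α) =
      AtomOver.map (fun _ t => Word.graft (fun _ e => e.1) t)
        (AtomOver.map (fun _ t => Term.map e t) α) := by
    refine (AtomOver.map_graft w a α).trans (Eq.trans ?_ (AtomOver.graft_map e _ α).symm)
    simp only [he]
  exact (Atom.realize_map e b α).mp (hb _ ⟨xs, AtomOver.map (fun _ t => Word.graft w t) α, a, h1,
    (realize_at_iff hF _ a _ h1).mpr ((Atom.realize_map e _ α).mpr h)⟩)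

/-- The case of `realize_of_rels` for an equation between two generators. -/
theorem eq_of_rels (hF : PreservesFilteredColimitsOfSize.{u, u} F) {M : T'.Mod} {N : Str S}
    {b : ∀ s, ((wordConstruction F).presentation M.obj).gens s → N.carrier s}
    (hb : ∀ α ∈ ((wordConstruction F).presentation M.obj).rels, α.Realize N b)
    {xs : List S'.Srt} (a : Tuple M.obj.carrier xs) {s : S.Srt}
    (w w' : Word (NewSym F) (Var xs) s)
    (e e' : ((wordConstruction F).presentation M.obj).gens s) (he : w.map a = e.1)
    (he' : w'.map a = e'.1) (h : valuation F M s e = valuation F M s e') : b s e = b s e' := by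
  refine realize_of_rels hF hb a (Y := Var [s, s]) (.eq (.var .zero) (.var (.succ .zero)))
    (Tuple.cons w (Tuple.cons w' Tuple.nil)) (Tuple.cons e (Tuple.cons e' Tuple.nil)) ?_ h
  rintro _ (_ | _ | v)
  exacts [he, he', nomatch v]

/-- The homomorphism `F ⟨x | φ⟩ ⟶ N` with `c ↦ b(f^c_{⟨x | φ⟩}(a))`. -/
noncomputable def leg (hF : PreservesFilteredColimitsOfSize.{u, u} F) {M : T'.Mod} {N : T.Mod}
    {b : ∀ s, ((wordConstruction F).presentation M.obj).gens s → N.obj.carrier s}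
    (hb : ∀ α ∈ ((wordConstruction F).presentation M.obj).rels, α.Realize N.obj b)
    (p : Point M) : F.obj (FG p.base) ⟶ N :=
  have key : ∀ α : Atom S (F.obj (FG p.base)).obj.carrier,
      α.Realize (F.obj M).obj (fun s c => (F.map p.hom).hom.toFun s c) →
        α.Realize N.obj (fun s c => b s (p.generator c)) := fun α h =>
    realize_of_rels hF hb p.elt α
      (fun s c => Gen.toWord ⟨p.base.ctx, ⟨p.base.fml, p.base.cart, c⟩, fun _ v => v⟩)
      (fun s c => p.generator c) (fun s c => Gen.toWord_map _ _) (by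
        simpa only [Point.valuation_generator] using h)
  ObjectProperty.homMk
    { toFun := fun s c => b s (p.generator c)
      map_fn := fun f c => key (.eq (.var ((F.obj (FG p.base)).obj.fn f c))
        (.app f fun s v => .var (c s v))) ((F.map p.hom).hom.map_fn f c)
      map_rl := fun R c h => key (.rel R fun s v => .var (c s v)) ((F.map p.hom).hom.map_rl R c h) }

/-- The homomorphisms `leg`, as a cocone. For a morphism of points, compatibility is an instance of
`eq_of_rels` in the joined context of the two points. -/
noncomputable def legs (hF : PreservesFilteredColimitsOfSize.{u, u} F) {M : T'.Mod} {N : T.Mod}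
    {b : ∀ s, ((wordConstruction F).presentation M.obj).gens s → N.obj.carrier s}
    (hb : ∀ α ∈ ((wordConstruction F).presentation M.obj).rels, α.Realize N.obj b) :
    Cocone (Point.diagram M ⋙ F) where
  pt := N
  ι :=
    { app := fun p => leg hF hb p
      naturality := fun p q k => by
        apply ObjectProperty.hom_ext
        apply Str.Hom.ext
        funext s c
        refine eq_of_rels hF hb (Tuple.append p.elt q.elt)
          (Gen.toWord ⟨q.base.ctx, ⟨q.base.fml, q.base.cart, (F.map k.1).hom.toFun s c⟩,
            fun _ v => Var.right _ v⟩)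
          (Gen.toWord ⟨p.base.ctx, ⟨p.base.fml, p.base.cart, c⟩, fun _ v => Var.left _ v⟩)
          (q.generator ((F.map k.1).hom.toFun s c)) (p.generator c) ?_ ?_ ?_
        · refine (Gen.toWord_map _ _).trans (congrArg Gen.toWord ?_)
          exact congrArg (Gen.mk _ _) (funext fun s => funext fun v => Tuple.append_right _ _ _ _)
        · refine (Gen.toWord_map _ _).trans (congrArg Gen.toWord ?_)
          exact congrArg (Gen.mk _ _) (funext fun s => funext fun v => Tuple.append_left _ _ _ _)
        · refine (q.valuation_generator _).trans (Eq.trans ?_ (p.valuation_generator c).symm)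
          exact congrArg (fun h => h.hom.toFun s c)
            ((F.map_comp k.1 q.hom).symm.trans (congrArg F.map k.2)) }

/-- In a structure that satisfies the relations of `W(M)`, every generator has the value of one
that comes from a point. -/
theorem exists_point_generator (hF : PreservesFilteredColimitsOfSize.{u, u} F) {M : T'.Mod}
    {N : Str S} {b : ∀ s, ((wordConstruction F).presentation M.obj).gens s → N.carrier s}
    (hb : ∀ α ∈ ((wordConstruction F).presentation M.obj).rels, α.Realize N b) {s : S.Srt}
    (e : ((wordConstruction F).presentation M.obj).gens s) :
    ∃ (p : Point M) (c : (F.obj (FG p.base)).obj.carrier s),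
      valuation F M s (p.generator c) = valuation F M s e ∧ b s (p.generator c) = b s e := by
  obtain ⟨e, xs, t, a, rfl, ht⟩ := e
  change (teParsed F t.parse).Realize M.obj a at ht
  rcases hp : t.parse with g | ⟨f, ts⟩
  -- `At` depends only on the reading of its entries, so the equation between the given
  -- generator and the one obtained from its reading is a relation of `W(M)`.
  · have hg : g.obj.fml.Realize M.obj (fun s v => a s (g.args s v)) := by
      rw [hp] at ht
      exact (LInf.realize_rename _ _ _ _).mp ht
    let p : Point M := ⟨g.obj, fun s v => a s (g.args s v), hg⟩
    have hv : valuation F M s (p.generator g.elt) =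
        valuation F M s ⟨t.map a, xs, t, a, rfl, ht⟩ := by
      refine (evalsTo_iff_valuation _ _).mp ?_
      rw [Word.parse_map, hp]
      exact ⟨hg, p.valuation_generator g.elt⟩
    exact ⟨p, g.elt, hv, eq_of_rels hF hb a g.toWord t _ _ (Gen.toWord_map _ _) rfl hv⟩
  · rw [hp] at ht
    obtain ⟨i, _⟩ := ht
    exact nomatch i

theorem presents (hF : PreservesFilteredColimitsOfSize.{u, u} F) (M : T'.Mod) :
    ((wordConstruction F).presentation M.obj).Presents T.IsModel (F.obj M).obj
      (valuation F M) where
  mem := (F.obj M).property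
  generated := by
    intro N _ hN s m
    obtain ⟨p, c, rfl⟩ := exists_generator hF m
    exact hN s _
  rels := by
    rintro β ⟨xs, α, a, h, hα⟩
    exact (realize_at_iff hF α a β h).mp hα
  desc := by
    intro N hN b hb
    let N' : T.Mod := ⟨N, hN⟩
    let h : F.obj M ⟶ N' := (isColimitMap hF M).desc (legs (N := N') hF hb)
    have hh : ∀ (p : Point M) (s : S.Srt) (c : (F.obj (FG p.base)).obj.carrier s),
        h.hom.toFun s (valuation F M s (p.generator c)) = b s (p.generator c) := fun p s c => by
      rw [p.valuation_generator]
      exact congrArg (fun h => h.hom.toFun s c)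
        ((isColimitMap hF M).fac (legs (N := N') hF hb) p)
    refine ⟨h.hom, fun s e => ?_, fun h' hh' => ?_⟩
    · obtain ⟨p, c, hv, hb⟩ := exists_point_generator hF hb e
      rw [← hv, ← hb]
      exact hh p s c
    · apply Str.Hom.ext
      funext s m
      obtain ⟨p, c, rfl⟩ := exists_generator hF m
      exact (hh' s _).trans (hh p s c).symm

/-! ### The translation of formulae -/

theorem realize_translate (hF : PreservesFilteredColimitsOfSize.{u, u} F) {M : T'.Mod}
    {ys : List S.Srt} (ψ : LInf S ys) : ∀ {xs : List S'.Srt}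
    (f : ∀ s, Var ys s → Gen (NewSym F) (Var xs) s) (a : Tuple M.obj.carrier xs)
    (b : Tuple (F.obj M).obj.carrier ys) (_ : ∀ s v, HasValue M s ((f s v).map a) (b s v)),
    ψ.Realize (F.obj M).obj b ↔ (translate F ψ f).Realize M.obj a := by
  -- Expressions over an extended context keep their values, and the new variable of a quantifier
  -- takes the value of the new expression.
  have ext : ∀ {ys : List S.Srt} {xs : List S'.Srt}
      {f : ∀ s, Var ys s → Gen (NewSym F) (Var xs) s} {a : Tuple M.obj.carrier xs}
      {b : Tuple (F.obj M).obj.carrier ys} (_ : ∀ s v, HasValue M s ((f s v).map a) (b s v))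
      (p : Point M) {s : S.Srt} (c : (F.obj (FG p.base)).obj.carrier s) (s' : S.Srt)
      (v : Var (s :: ys) s'),
      HasValue M s' (((Tuple.cons
          ⟨p.base.ctx, ⟨p.base.fml, p.base.cart, c⟩, fun _ v => Var.left _ v⟩
          (fun s v => (f s v).map (fun _ w => Var.right _ w)) :
          ∀ s', Var (s :: ys) s' → Gen (NewSym F) (Var (p.base.ctx ++ xs)) s') s' v).map
          (Tuple.append p.elt a))
        (Tuple.cons ((F.map p.hom).hom.toFun s c) b s' v) := by
    intro ys xs f a b hb p s c s' v
    cases v with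
    | zero =>
      have e : (⟨p.base.ctx, ⟨p.base.fml, p.base.cart, c⟩, fun _ v => Var.left _ v⟩ :
          Gen (NewSym F) (Var (p.base.ctx ++ xs)) s).map (Tuple.append p.elt a) =
          ⟨p.base.ctx, ⟨p.base.fml, p.base.cart, c⟩, p.elt⟩ :=
        congrArg (Gen.mk _ _) (funext fun s => funext fun v => Tuple.append_left _ _ _ _)
      rw [Tuple.cons_zero, Tuple.cons_zero, e]
      exact ⟨p.mem, rfl⟩
    | succ v =>
      have e : ((f s' v).map (fun _ w => Var.right _ w)).map (Tuple.append p.elt a) =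
          (f s' v).map a :=
        congrArg (Gen.mk _ _) (funext fun s => funext fun v => Tuple.append_right _ _ _ _)
      rw [Tuple.cons_succ, Tuple.cons_succ, e]
      exact hb s' v
  have mem_iff : ∀ (A : Obj T') {xs : List S'.Srt} (x : Tuple M.obj.carrier A.ctx)
      (a : Tuple M.obj.carrier xs), (A.fml.toLInf.rename
        (fun _ v => Var.left _ v)).Realize M.obj (Tuple.append x a) ↔ A.fml.Realize M.obj x := by
    intro A xs x a
    rw [LInf.realize_rename]
    simp only [Tuple.append_left]
    exact Iff.rfl
  induction ψ with
  | @atom Γ α =>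
    intro xs f a b hb
    refine Iff.trans ?_ (realize_atParsed_iff hF _ a).symm
    refine Iff.trans ?_ (iff_of_eq (congrArg _ (AtomOver.parse_graft _ α).symm))
    refine (Atom.relRealize_eq b α).symm.trans (Iff.trans ?_ (Atom.relRealize_bind _ _ α).symm)
    refine iff_of_eq (congrArg (fun V => Atom.RelRealize _ V α) ?_)
    funext s v n
    rw [parse_sym]
    exact propext ((hb s v).iff_eq n).symm
  | neg ψ ih => exact fun f a b hb => not_congr (ih f a b hb)
  | conj ψ ih => exact fun f a b hb => forall_congr' fun i => ih i f a b hb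
  | disj ψ ih => exact fun f a b hb => exists_congr fun i => ih i f a b hb
  | @ex Γ s ψ ih =>
    intro xs f a b hb
    constructor
    · rintro ⟨y, hy⟩
      obtain ⟨p, c, rfl⟩ := exists_generator hF y
      rw [p.valuation_generator, ih _ _ _ (ext hb p c)] at hy
      exact ⟨p.base, c, (LInf.realize_exs _ _ _ _).mpr ⟨p.elt,
        (LInf.realize_and _ _ _ _).mpr ⟨(mem_iff _ _ _).mpr p.mem, hy⟩⟩⟩
    · rintro ⟨A, c, h⟩
      obtain ⟨x, hx⟩ := (LInf.realize_exs _ _ _ _).mp h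
      obtain ⟨hA, hx⟩ := (LInf.realize_and _ _ _ _).mp hx
      exact ⟨_, (ih _ _ _ (ext hb ⟨A, x, (mem_iff _ _ _).mp hA⟩ c)).mpr hx⟩
  | @all Γ s ψ ih =>
    intro xs f a b hb
    constructor
    · intro h A c
      refine (LInf.realize_alls _ _ _ _).mpr fun x => (LInf.realize_imp _ _ _ _).mpr fun hA => ?_
      exact (ih _ _ _ (ext hb ⟨A, x, (mem_iff _ _ _).mp hA⟩ c)).mp (h _)
    · intro h y
      obtain ⟨p, c, rfl⟩ := exists_generator hF y
      rw [p.valuation_generator, ih _ _ _ (ext hb p c)]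
      exact (LInf.realize_imp _ _ _ _).mp ((LInf.realize_alls _ _ _ _).mp (h p.base c) p.elt)
        ((mem_iff _ _ _).mpr p.mem)

end Main

end CartLogic

open CartLogic
theorem mainTheorem5 {S S' : Signature.{u}} (T : CartTheory S) (T' : CartTheory S')
    (F : T'.Mod ⥤ T.Mod) (hF : PreservesFilteredColimitsOfSize.{u, u} F) :
    (∀ M : T'.Mod, ((wordConstruction F).presentation M.obj).Presents T.IsModel
      (F.obj M).obj (valuation F M)) ∧
    (∀ (ys : List S.Srt) (ψ : LInf S ys) (xs : List S'.Srt)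
      (f : ∀ s, Var ys s → Gen (NewSym F) (Var xs) s) (M : T'.Mod) (a : Tuple M.obj.carrier xs)
      (h : ∀ s v, ((wordConstruction F).Te (f s v).toWord).Realize M.obj a),
      ψ.Realize (F.obj M).obj (fun s v => (f s v).value
        (FG.lift (f s v).obj M (fun _ w => a _ ((f s v).args _ w))
          ((realize_te_iff (f s v) M a).mp (h s v)))) ↔
      (translate F ψ f).Realize M.obj a) :=
  ⟨presents hF, fun _ ψ _ f M a h => realize_translate hF ψ f a _ fun s v =>
    ⟨(realize_te_iff (f s v) M a).mp (h s v), rfl⟩⟩
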